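/- Let $H$ be a separable complex Hilbert space, let $A:D(A)\subset H\to H$ be a linear operator, put $H_0=\overline{D(A)}$, and let $A_0$ be the part of $A$ in $H_0$, i.e. $D(A_0)=\{y\in D(A):Ay\in H_0\}$, $A_0y=Ay$. Assume that (a) $A_0$ is sectorial: there are $w\in\mathbb R$, $\vartheta\in(\pi/2,\pi)$ and $M>0$ such that every $z\in\mathbb C\setminus\{w\}$ with $|\arg(z-w)|\le\vartheta$ belongs to $\rho(A_0)$ and satisfies $\|(z-A_0)^{-1}\|\le M/|z-w|$; (b) there are $\omega_A<0$ and $p^*\in[1,\infty)$ such that $(\omega_A,\infty)\subset\rho(A)$ and $\limsup_{\lambda\to+\infty}\lambda^{1/p^*}\|(\lambda-A)^{-1}\|_{\mathcal L(H)}<\infty$. Let $T_0$ be the $C_0$-semigroup on $H_0$ generated by $A_0$ and $S_A$ the integrated semigroup on $H$ generated by $A$. Let $G:H_0\to H$ be globally Lipschitz. Let $(\Omega,\mathcal F,\mathbb P,(\theta_t)_{t\in\mathbb R})$ be an ergodic metric dynamical system, and let $(W_t)_{t\in\mathbb R}$ be a two-sided $Q$-Wiener process in $H$, with $Q$ positive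 of finite trace, such that $W_t(\theta_s\omega)=W_{t+s}(\omega)-W_s(\omega)$ for all $s,t\in\mathbb R$ and $\omega\in\Omega$. Let the random variable $Y:\Omega\to H_0$, $\omega\mapsto Y_\omega$, be a version of the stochastic integral $$Y_\omega=\int_{-\infty}^0 S_A'(-r)\,dW(r)$$ for which $t\mapsto Y_{\theta_t\omega}$ is continuous for $\mathbb P$-almost every $\omega$ (so that $t\mapsto Y_{\theta_t\omega}$ is the continuous stationary solution of $dY=AY\,dt+dW$). Then, for every $\omega\in\Omega$ for which $t\mapsto Y_{\theta_t\omega}$ is continuous on $[0,\infty)$ (hence for $\mathbb P$-almost every $\omega$), for every $\xi\in H_0$ and every $\tau>0$, the random PDE $$dV(t)=AV(t)\,dt+G(V(t)+Y_{\theta_t\omega})\,dt,\quad t\in[0,\tau],\qquad V(0)=\xi-Y_\omega,$$ has a unique integrated solution $V\in C([0,\tau],H_0)$, that is, there is exactly one $V\in C([0,\tau],H_0)$ such that, for all $t\in[0,\tau]$, $\int_0^tV(s)\,ds\in D(A)$ and $$V(t)=\xi-Y_\omega+A\int_0^tV(s)\,ds+\int_0^tG(V(s)+Y_{\theta_s\omega})\,ds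 .$$ Moreover, a function $V\in C([0,\tau],H_0)$ is an integrated solution if and only if it is a mild solution, i.e. for all $t\in[0,\tau]$ $$V(t)=T_0(t)(\xi-Y_\omega)+\int_0^tS_A'(t-s)\,G(V(s)+Y_{\theta_s\omega})\,ds .$$ -/

import Mathlib

open Set Filter Topology MeasureTheory ProbabilityTheory
open scoped ENNReal NNReal InnerProductSpace

/-! ### Unbounded operators: resolvent, part in the closure of the domain, sectoriality -/

section Operators

variable {E : Type*} [NormedAddCommGroup E] [NormedSpace ℂ E]

/-- `R` is the bounded inverse of `z - B`: the vector `y = R x` is the one and only element of the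
domain of `B` with `z y - B y = x`. -/
def IsResolventAt (B : E →ₗ.[ℂ] E) (z : ℂ) (R : E →L[ℂ] E) : Prop :=
  ∀ x y : E, R x = y ↔ (y, z • y - x) ∈ B.graph

/-- The resolvent set `ρ(B)`. -/
def opResolventSet (B : E →ₗ.[ℂ] E) : Set ℂ := {z | ∃ R : E →L[ℂ] E, IsResolventAt B z R}

open Classical in
/-- The resolvent `R(z, B) = (z - B)⁻¹`, for `z ∈ ρ(B)` (and `0` for other `z`). -/
noncomputable def opResolvent (B : E →ₗ.[ℂ] E) (z : ℂ) : E →L[ℂ] E :=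
  if h : z ∈ opResolventSet B then h.choose else 0

/-- The sectorial operators: for some real `w`, some `ϑ ∈ (π/2, π)` and some `M > 0`, the sector
`{z ≠ w, |arg (z - w)| ≤ ϑ}` lies in the resolvent set and `‖R(z, B)‖ ≤ M / |z - w|` there. -/
def IsSectorialOp (B : E →ₗ.[ℂ] E) : Prop :=
  ∃ w ϑ M : ℝ, Real.pi / 2 < ϑ ∧ ϑ < Real.pi ∧ 0 < M ∧
    ∀ z : ℂ, z ≠ (w : ℂ) → |Complex.arg (z - (w : ℂ))| ≤ ϑ →
      z ∈ opResolventSet B ∧ ‖opResolvent B z‖ ≤ M / ‖z - (w : ℂ)‖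

/-- The closed subspace `H₀`, the closure of the domain of `A`. -/
abbrev domainClosure (A : E →ₗ.[ℂ] E) : Submodule ℂ E := A.domain.topologicalClosure

/-- The domain `{y ∈ D(A) : A y ∈ H₀}` of the part of `A` in `H₀`. -/
def partDomain (A : E →ₗ.[ℂ] E) : Submodule ℂ (domainClosure A) where
  carrier := {y | ∃ h : (y : E) ∈ A.domain, A ⟨y, h⟩ ∈ domainClosure A}
  zero_mem' := ⟨A.domain.zero_mem, by
    have h0 : A (0 : A.domain) = 0 := A.map_zero
    have h1 : A ⟨((0 : domainClosure A) : E), A.domain.zero_mem⟩ = 0 := h0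
    rw [h1]; exact Submodule.zero_mem _⟩
  add_mem' := by
    rintro a b ⟨ha, ha'⟩ ⟨hb, hb'⟩
    refine ⟨A.domain.add_mem ha hb, ?_⟩
    have h1 : A ⟨((a + b : domainClosure A) : E), A.domain.add_mem ha hb⟩
        = A ⟨(a : E), ha⟩ + A ⟨(b : E), hb⟩ := A.map_add ⟨(a : E), ha⟩ ⟨(b : E), hb⟩
    rw [h1]; exact Submodule.add_mem _ ha' hb'
  smul_mem' := by
    rintro c a ⟨ha, ha'⟩
    refine ⟨A.domain.smul_mem c ha, ?_⟩
    have h1 : A ⟨((c • a : domainClosure A) : E), A.domain.smul_mem c ha⟩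
        = c • A ⟨(a : E), ha⟩ := A.map_smul c ⟨(a : E), ha⟩
    rw [h1]; exact Submodule.smul_mem _ c ha'

/-- The part `A₀` of `A` in `H₀`: the restriction of `A` to `{y ∈ D(A) : A y ∈ H₀}`, as an operator
in `H₀`. -/
noncomputable def partInClosure (A : E →ₗ.[ℂ] E) : domainClosure A →ₗ.[ℂ] domainClosure A where
  domain := partDomain A
  toFun :=
    { toFun := fun y => ⟨A ⟨((y : domainClosure A) : E), y.2.choose⟩, y.2.choose_spec⟩
      map_add' := fun a b => Subtype.ext
        (A.map_add ⟨((a : domainClosure A) : E), a.2.choose⟩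
          ⟨((b : domainClosure A) : E), b.2.choose⟩)
      map_smul' := fun c a => Subtype.ext
        (A.map_smul c ⟨((a : domainClosure A) : E), a.2.choose⟩) }

/-! ### Semigroups and integrated semigroups (only the values at times `t ≥ 0` matter) -/

/-- `T` is a strongly continuous semigroup, with infinitesimal generator `B`. -/
structure IsC0SemigroupGeneratedBy (B : E →ₗ.[ℂ] E) (T : ℝ → E →L[ℂ] E) : Prop where
  zero : T 0 = ContinuousLinearMap.id ℂ E
  add : ∀ s t : ℝ, 0 ≤ s → 0 ≤ t → T (s + t) = (T s).comp (T t)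
  cont : ∀ x, ContinuousOn (fun t => T t x) (Ici 0)
  generator : ∀ x y : E, (x, y) ∈ B.graph ↔
    Tendsto (fun t : ℝ => t⁻¹ • (T t x - x)) (𝓝[>] 0) (𝓝 y)

/-- `S` is a nondegenerate integrated semigroup, with generator `A`: `x ∈ D(A)` and `A x = y` if
and only if `S(t) x = t x + ∫₀ᵗ S(s) y ds` for all `t ≥ 0`. -/
structure IsIntegratedSemigroupGeneratedBy (A : E →ₗ.[ℂ] E) (S : ℝ → E →L[ℂ] E) : Prop where
  zero : S 0 = 0
  cont : ∀ x, ContinuousOn (fun t => S t x) (Ici 0)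
  comp : ∀ t s : ℝ, 0 ≤ t → 0 ≤ s → ∀ x,
    S t (S s x) = ∫ r in (0 : ℝ)..t, (S (s + r) x - S r x)
  nondegenerate : ∀ x, (∀ t, 0 ≤ t → S t x = 0) → x = 0
  generator : ∀ x y : E, (x, y) ∈ A.graph ↔
    ∀ t : ℝ, 0 ≤ t → S t x - t • x = ∫ s in (0 : ℝ)..t, S s y

open Classical in
/-- The strongly continuous semigroup generated by `B` (it is unique if it exists). -/
noncomputable def generatedSemigroup (B : E →ₗ.[ℂ] E) : ℝ → E →L[ℂ] E :=
  if h : ∃ T, IsC0SemigroupGeneratedBy B T then h.choose else 0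

open Classical in
/-- The integrated semigroup generated by `A` (it is unique if it exists). -/
noncomputable def generatedIntegratedSemigroup (A : E →ₗ.[ℂ] E) : ℝ → E →L[ℂ] E :=
  if h : ∃ S, IsIntegratedSemigroupGeneratedBy A S then h.choose else 0

/-! ### Solutions of `dV = A V dt + F(t, V) dt`, `V(0) = x`, on `[0, τ]` -/

/-- Integrated solutions: `∫₀ᵗ V ∈ D(A)` and `V(t) = x + A ∫₀ᵗ V + ∫₀ᵗ F(s, V(s)) ds` for all
`t ∈ [0, τ]`. -/
def IsIntegratedSolution (A : E →ₗ.[ℂ] E) (F : ℝ → domainClosure A → E) (x : domainClosure A)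
    (τ : ℝ) (V : ℝ → domainClosure A) : Prop :=
  ContinuousOn V (Icc 0 τ) ∧ ∀ t ∈ Icc 0 τ,
    IntervalIntegrable (fun s => F s (V s)) volume 0 t ∧
    ∃ h : (∫ s in (0 : ℝ)..t, (V s : E)) ∈ A.domain,
      (V t : E) = x + A ⟨∫ s in (0 : ℝ)..t, (V s : E), h⟩ + ∫ s in (0 : ℝ)..t, F s (V s)

/-- Mild solutions: `V(t) = T₀(t) x + ∫₀ᵗ S_A'(t - s) F(s, V(s)) ds` for all `t ∈ [0, τ]`, where
`T₀` is the semigroup generated by the part of `A` in `H₀`, and `S_A'` is the derivative of the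
integrated semigroup generated by `A`. -/
def IsMildSolution (A : E →ₗ.[ℂ] E) (F : ℝ → domainClosure A → E) (x : domainClosure A)
    (τ : ℝ) (V : ℝ → domainClosure A) : Prop :=
  ContinuousOn V (Icc 0 τ) ∧ ∀ t ∈ Icc 0 τ,
    IntervalIntegrable (fun s => deriv (generatedIntegratedSemigroup A) (t - s) (F s (V s)))
      volume 0 t ∧
    (V t : E) = generatedSemigroup (partInClosure A) t x +
      ∫ s in (0 : ℝ)..t, deriv (generatedIntegratedSemigroup A) (t - s) (F s (V s))

end Operators

/-! ### Metric dynamical systems -/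

/-- `(Ω, P, θ)` is an ergodic metric dynamical system with time set `ℝ`. -/
structure IsErgodicMDS {Ω : Type*} [MeasurableSpace Ω] (P : Measure Ω) (θ : ℝ → Ω → Ω) :
    Prop where
  measurable : Measurable (fun q : ℝ × Ω => θ q.1 q.2)
  zero : ∀ ω, θ 0 ω = ω
  add : ∀ s t ω, θ (t + s) ω = θ t (θ s ω)
  preserving : ∀ t, MeasurePreserving (θ t) P P
  ergodic : ∀ s : Set Ω, MeasurableSet s → (∀ t, θ t ⁻¹' s = s) → P s = 0 ∨ P s = 1

/-! ### `Q`-Wiener processes and the Wiener integral of operator-valued functions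

The complex Hilbert space `H` is also a real Hilbert space, with inner product `Re ⟪x, y⟫`; the
noise is Gaussian with respect to this real structure, and its covariance operator is real-linear.
This contains the noises which live in a real form of `H`. -/

attribute [local instance] InnerProductSpace.complexToReal

section Wiener

variable {H : Type*} [NormedAddCommGroup H] [InnerProductSpace ℂ H] [CompleteSpace H]

/-- The trace `∑ ⟪b i, B (b i)⟫ ∈ [0, ∞]` of a positive operator on the real Hilbert space `H`,
computed in some orthonormal basis `b` (for positive `B` it does not depend on `b`). -/
noncomputable def positiveTrace (B : H →L[ℝ] H) : ℝ≥0∞ :=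
  let b := (exists_hilbertBasis ℝ H).choose_spec.choose
  ∑' i, ENNReal.ofReal (inner ℝ (b i) (B (b i)))

/-- `tr (Ψ Q Ψ*)`, the square of the Hilbert-Schmidt norm of `Ψ Q^{1/2}`. -/
noncomputable def hsWeight (Q : H →L[ℝ] H) (Ψ : H →L[ℂ] H) : ℝ≥0∞ :=
  positiveTrace ((Ψ.restrictScalars ℝ).comp
    (Q.comp ((ContinuousLinearMap.adjoint Ψ).restrictScalars ℝ)))

/-- `W` is a two-sided `Q`-Wiener process in `H`, where `Q` is a positive operator with finite
trace. -/
structure IsTwoSidedQWiener [MeasurableSpace H] {Ω : Type*} [MeasurableSpace Ω] (P : Measure Ω)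
    (Q : H →L[ℝ] H) (W : ℝ → Ω → H) : Prop where
  positive : Q.IsPositive
  trace_finite : positiveTrace Q ≠ ∞
  measurable : ∀ t, Measurable (W t)
  zero : ∀ᵐ ω ∂P, W 0 ω = 0
  continuous_paths : ∀ᵐ ω ∂P, Continuous (fun t => W t ω)
  indep : HasIndepIncrements W P
  gaussian : ∀ s t : ℝ, s ≤ t → ∀ h : H,
    P.map (fun ω => (inner ℝ h (W t ω - W s ω) : ℝ)) =
      gaussianReal 0 (Real.toNNReal ((t - s) * inner ℝ h (Q h)))

/-- A deterministic operator-valued step function `∑_{i < n} 1_{(t i, t (i+1)]} op i`. -/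
structure StepIntegrand (H : Type*) [NormedAddCommGroup H] [InnerProductSpace ℂ H] where
  n : ℕ
  t : ℕ → ℝ
  mono : Monotone t
  op : ℕ → H →L[ℂ] H

/-- The step function as a function of time. -/
noncomputable def StepIntegrand.toFun (φ : StepIntegrand H) (r : ℝ) : H →L[ℂ] H :=
  ∑ i ∈ Finset.range φ.n, (Ioc (φ.t i) (φ.t (i + 1))).indicator (fun _ => φ.op i) r

/-- Its integral `∑_{i < n} op i (W (t (i+1)) - W (t i))`. -/
noncomputable def StepIntegrand.integral {Ω : Type*} (φ : StepIntegrand H) (W : ℝ → Ω → H)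
    (ω : Ω) : H :=
  ∑ i ∈ Finset.range φ.n, φ.op i (W (φ.t (i + 1)) ω - W (φ.t i) ω)

/-- `I` is (a version of) the stochastic integral `∫_ℝ Φ dW` of the deterministic function `Φ`:
step functions `φ k` converge to `Φ` in the sense that `∫ tr ((Φ - φ k) Q (Φ - φ k)*) dr → 0`, and
their integrals converge to `I` in mean square. -/
def IsWienerIntegral {Ω : Type*} [MeasurableSpace Ω] (P : Measure Ω) (Q : H →L[ℝ] H)
    (W : ℝ → Ω → H) (Φ : ℝ → H →L[ℂ] H) (I : Ω → H) : Prop :=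
  ∃ φ : ℕ → StepIntegrand H,
    Tendsto (fun k => ∫⁻ r, hsWeight Q (Φ r - (φ k).toFun r)) atTop (𝓝 0) ∧
    Tendsto (fun k => ∫⁻ ω, ‖I ω - (φ k).integral W ω‖ₑ ^ 2 ∂P) atTop (𝓝 0)

/-- `Y` is the initial value of the stationary solution of `dY = A Y dt + dW`, that is, a version
of `∫_{-∞}^0 S_A'(-r) dW(r)`, with values in `H₀`, for which the path `t ↦ Y (θ t ω)` of
the stationary solution is continuous for almost every `ω`. -/
structure IsStationaryConvolution [MeasurableSpace H] {Ω : Type*} [MeasurableSpace Ω]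
    (P : Measure Ω) (θ : ℝ → Ω → Ω) (Q : H →L[ℝ] H) (W : ℝ → Ω → H) (A : H →ₗ.[ℂ] H)
    (Y : Ω → domainClosure A) : Prop where
  measurable : Measurable Y
  isWienerIntegral : IsWienerIntegral P Q W
    ((Iio 0).indicator fun r => deriv (generatedIntegratedSemigroup A) (-r)) (fun ω => (Y ω : H))
  continuous_paths : ∀ᵐ ω ∂P, Continuous (fun t => Y (θ t ω))

end Wiener

/-! For fixed ω the problem is deterministic: F(t, v) = G(v + Y(θ_t ω)) is continuous in (t, v) and
Lipschitz in v. The difficulty is that F takes values in H, while T₀ acts only on H₀. The bridge is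
R = R(l, A), which maps H injectively into H₀: the kernel K(t) = (l - A₀) T₀(t) R extends T₀ to H,
and R(l, A₀) K(t) = T₀(t) R is bounded again. Identities on H are therefore proved after applying an
injective resolvent, where they become statements about the semigroup on H₀.

Generation. On a half-plane with ‖z R(z)‖ ≤ M, Cauchy integrals over circles bound (λR(λ))ᵏ
uniformly and (λR(λ) - 1)(λR(λ))ᵏ by C/(k+1). Hence the Yosida approximations Aₙ satisfy ‖exp(tAₙ)‖
≤ C and ‖Aₙ exp(tAₙ)‖ ≤ C/t, and their strong limits are T₀ and its derivative
(`exists_analyticSemigroup`). The convergence λR(λ, A₀)x → x on H₀ comes from ‖R(λ, A)‖ → 0.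

Integrability. K does not depend on l, so l = 1/t may be inserted; with ‖R(1/t, A)‖ = O(t^(1/p))
this gives ‖K(t)‖ = O(t^(1/p - 1)) (`intervalIntegrable_extrapolatedKernel`). The primitive of K is
the integrated semigroup of A, and it is the only one, so K = S_A'
(`deriv_generatedIntegratedSemigroup`).

Equivalence. Under the resolvent an integrated solution becomes a solution of an equation in H₀ with
bounded coefficients, solved by Duhamel's formula; injectivity gives back the mild formula, and
conversely (`integrated_iff_mild`). Existence and uniqueness are then a contraction for a Volterra
equation with integrable kernel, in an exponentially weighted norm (`existsUnique_volterra`). -/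

/-! ### Power bounds for resolvents on a half-plane -/

section Resolvent

variable {𝔸 : Type*} [NormedRing 𝔸] [NormedAlgebra ℂ 𝔸]

/-- A resolvent family on the right half-plane with `‖z R(z)‖ ≤ M`. -/
structure IsHalfPlaneResolvent (R : ℂ → 𝔸) (M : ℝ) : Prop where
  sub_eq : ∀ z u : ℂ, 0 < z.re → 0 < u.re → R z - R u = (u - z) • (R z * R u)
  norm_le : ∀ z : ℂ, 0 < z.re → ‖z‖ * ‖R z‖ ≤ M

namespace IsHalfPlaneResolvent

variable {R : ℂ → 𝔸} {M : ℝ}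

theorem bound_nonneg (h : IsHalfPlaneResolvent R M) : 0 ≤ M :=
  le_trans (by positivity) (h.norm_le 1 (by simp))

/-- Exchanging z and u in the resolvent identity changes its sign. -/
theorem commute (h : IsHalfPlaneResolvent R M) {z u : ℂ} (hz : 0 < z.re) (hu : 0 < u.re) :
    Commute (R z) (R u) := by
  by_cases hzu : z = u
  · rw [hzu]
  have h1 := h.sub_eq z u hz hu
  have h2 := h.sub_eq u z hu hz
  have h3 : (u - z) • (R z * R u) = (u - z) • (R u * R z) := by
    rw [← h1, ← neg_sub (R u), h2, ← neg_smul, neg_sub]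
  exact (smul_right_injective 𝔸 (sub_ne_zero.mpr (Ne.symm hzu))) h3

theorem norm_le_div (h : IsHalfPlaneResolvent R M) {z : ℂ} (hz : 0 < z.re) :
    ‖R z‖ ≤ M / ‖z‖ := by
  have hz0 : 0 < ‖z‖ := norm_pos_iff.mpr fun h0 => by simp [h0] at hz
  rw [le_div_iff₀ hz0, mul_comm]
  exact h.norm_le z hz

theorem continuousAt (h : IsHalfPlaneResolvent R M) {z : ℂ} (hz : 0 < z.re) :
    ContinuousAt R z := by
  have hz0 : 0 < ‖z‖ := norm_pos_iff.mpr fun h0 => by simp [h0] at hz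
  have hev : ∀ᶠ u : ℂ in 𝓝 z, 0 < u.re :=
    (isOpen_lt continuous_const Complex.continuous_re).mem_nhds hz
  rw [ContinuousAt, tendsto_iff_norm_sub_tendsto_zero]
  have hlim : Tendsto (fun u : ℂ => ‖z - u‖ * (M / ‖u‖ * ‖R z‖)) (𝓝 z) (𝓝 0) := by
    have : ContinuousAt (fun u : ℂ => ‖z - u‖ * (M / ‖u‖ * ‖R z‖)) z := by
      apply ContinuousAt.mul (by fun_prop)
      apply ContinuousAt.mul _ continuousAt_const
      exact continuousAt_const.div (by fun_prop) hz0.ne'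
    simpa [ContinuousAt] using this
  refine squeeze_zero' (Eventually.of_forall fun _ => norm_nonneg _) ?_ hlim
  filter_upwards [hev] with u hu
  rw [h.sub_eq u z hu hz, norm_smul]
  gcongr
  exact (norm_mul_le _ _).trans (by gcongr; exact h.norm_le_div hu)

theorem hasDerivAt (h : IsHalfPlaneResolvent R M) {z : ℂ} (hz : 0 < z.re) :
    HasDerivAt R (-(R z * R z)) z := by
  rw [hasDerivAt_iff_tendsto_slope]
  have hev : ∀ᶠ u : ℂ in 𝓝 z, 0 < u.re :=
    (isOpen_lt continuous_const Complex.continuous_re).mem_nhds hz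
  have hc : Tendsto (fun u => -(R u * R z)) (𝓝[≠] z) (𝓝 (-(R z * R z))) :=
    (((h.continuousAt hz).mul continuousAt_const).neg.tendsto).mono_left nhdsWithin_le_nhds
  refine hc.congr' ?_
  filter_upwards [hev.filter_mono nhdsWithin_le_nhds, self_mem_nhdsWithin] with u hu huz
  have : u - z ≠ 0 := sub_ne_zero.mpr huz
  rw [slope_def_module, h.sub_eq u z hu hz, smul_smul, ← neg_sub u z, mul_neg,
    inv_mul_cancel₀ this, neg_smul, one_smul]

theorem hasDerivAt_sq (h : IsHalfPlaneResolvent R M) {z : ℂ} (hz : 0 < z.re) :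
    HasDerivAt (fun z => R z ^ 2) ((-2 : ℂ) • R z ^ 3) z := by
  have := (h.hasDerivAt hz).mul (h.hasDerivAt hz)
  convert this using 1
  · ext u; simp [sq]
  · rw [neg_smul, two_smul]; noncomm_ring

/-! ### Cauchy integrals of powers of the resolvent. -/

section Circle

variable {l r : ℝ}

theorem re_pos_of_mem_sphere (hr : r < l) {z : ℂ} (hz : z ∈ Metric.closedBall (l : ℂ) r) :
    0 < z.re := by
  have h1 : ‖z - l‖ ≤ r := by simpa [dist_eq_norm] using hz
  have h2 : |(z - l).re| ≤ r := (Complex.abs_re_le_norm _).trans h1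
  simp only [Complex.sub_re, Complex.ofReal_re] at h2
  linarith [(abs_le.mp h2).1]

theorem sub_ne_zero_of_mem_sphere (hr0 : 0 < r) {z : ℂ} (hz : z ∈ Metric.sphere (l : ℂ) r) :
    z - l ≠ 0 := by
  intro h0
  have : ‖z - l‖ = r := by simpa [dist_eq_norm] using hz
  rw [h0, norm_zero] at this
  exact hr0.ne this

theorem hasDerivAt_zpow_sub {z : ℂ} (hz : z - l ≠ 0) (m : ℤ) :
    HasDerivAt (fun z : ℂ => (z - l) ^ m) (m * (z - l) ^ (m - 1)) z := by
  have := (hasDerivAt_zpow m (z - l) (Or.inl hz)).comp z ((hasDerivAt_id z).sub_const (l : ℂ))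
  simpa [Function.comp_def] using this

theorem circleIntegrable_zpow_smul (hr0 : 0 < r) {f : ℂ → 𝔸}
    (hf : ∀ z ∈ Metric.sphere (l : ℂ) r, ContinuousAt f z) (m : ℤ) :
    CircleIntegrable (fun z : ℂ => (z - l) ^ m • f z) l r := by
  refine ContinuousOn.circleIntegrable hr0.le fun z hz => ContinuousAt.continuousWithinAt ?_
  exact (hasDerivAt_zpow_sub (sub_ne_zero_of_mem_sphere hr0 hz) m).continuousAt.smul (hf z hz)

variable [CompleteSpace 𝔸]

/-- Integration by parts without boundary term: an integer power is single-valued on the closed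
circle. -/
theorem circleIntegral_zpow_smul_parts (hr0 : 0 < r) {f f' : ℂ → 𝔸}
    (hf : ∀ z ∈ Metric.sphere (l : ℂ) r, HasDerivAt f (f' z) z)
    (hf' : ∀ z ∈ Metric.sphere (l : ℂ) r, ContinuousAt f' z) (m : ℤ) :
    (∮ z in C(l, r), (z - l) ^ m • f' z) =
      -((m : ℂ) • ∮ z in C(l, r), (z - l) ^ (m - 1) • f z) := by
  have h0 : (∮ z in C(l, r), ((z - l) ^ m • f' z + ((m : ℂ) * (z - l) ^ (m - 1)) • f z)) = 0 := by
    refine circleIntegral.integral_eq_zero_of_hasDerivWithinAt' (f := fun z => (z - l) ^ m • f z)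
      fun z hz => ?_
    rw [abs_of_pos hr0] at hz
    exact ((hasDerivAt_zpow_sub (sub_ne_zero_of_mem_sphere hr0 hz) m).smul
      (hf z hz)).hasDerivWithinAt
  rw [circleIntegral.integral_add (circleIntegrable_zpow_smul hr0 hf' m)] at h0
  · simp_rw [mul_smul] at h0
    rw [circleIntegral.integral_smul] at h0
    exact eq_neg_of_add_eq_zero_left h0
  · simp_rw [mul_smul]
    simp_rw [smul_comm (m : ℂ)]
    exact circleIntegrable_zpow_smul hr0 (fun z hz => (hf z hz).continuousAt.const_smul (m : ℂ)) _

/-- These are the Taylor coefficients of the resolvent at l. Cauchy's formula gives k = 0; the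
induction substitutes R(z) = R(l) - (z - l) R(z) R(l), whose constant term integrates to 0 because
the exponent is not -1. -/
theorem circleIntegral_pow_one (h : IsHalfPlaneResolvent R M) (hr0 : 0 < r) (hr : r < l) (k : ℕ) :
    (∮ z in C(l, r), (z - l) ^ (-(k : ℤ) - 1) • R z) =
      (2 * Real.pi * Complex.I * (-1) ^ k : ℂ) • R l ^ (k + 1) := by
  have hl : 0 < (l : ℂ).re := by simpa using hr0.trans hr
  induction k with
  | zero =>
    have hd : DiffContOnCl ℂ R (Metric.ball (l : ℂ) r) := by
      apply DifferentiableOn.diffContOnCl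
      intro z hz
      rw [closure_ball _ hr0.ne'] at hz
      exact (h.hasDerivAt (re_pos_of_mem_sphere hr hz)).differentiableAt.differentiableWithinAt
    have := hd.circleIntegral_sub_inv_smul (Metric.mem_ball_self hr0)
    simpa using this
  | succ k ih =>
    have hcont : ∀ z ∈ Metric.sphere (l : ℂ) r, ContinuousAt R z := fun z hz =>
      h.continuousAt (re_pos_of_mem_sphere hr (Metric.sphere_subset_closedBall hz))
    have e1 : (∮ z in C(l, r), (z - l) ^ (-((k + 1 : ℕ) : ℤ) - 1) • R z) =
        ∮ z in C(l, r), ((z - l) ^ (-((k + 1 : ℕ) : ℤ) - 1) • R l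
          - (z - l) ^ (-(k : ℤ) - 1) • (R z * R l)) := by
      refine circleIntegral.integral_congr hr0.le fun z hz => ?_
      have hz0 := sub_ne_zero_of_mem_sphere hr0 hz
      have hs := h.sub_eq z l (re_pos_of_mem_sphere hr (Metric.sphere_subset_closedBall hz)) hl
      have hR : R z = R l - (z - l) • (R z * R l) := by
        rw [← neg_sub (l : ℂ) z, neg_smul, ← hs]; abel
      have hp : (z - l) ^ (-(k : ℤ) - 1) = (z - l) ^ (-((k + 1 : ℕ) : ℤ) - 1) * (z - l) := by
        rw [← zpow_add_one₀ hz0]; congr 1; push_cast; ring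
      rw [hp, mul_smul, ← smul_sub, ← hR]
    rw [e1, circleIntegral.integral_sub]
    · have e2 : (∮ z in C(l, r), (z - l) ^ (-((k + 1 : ℕ) : ℤ) - 1) • R l) = 0 := by
        rw [circleIntegral.integral_smul_const,
          circleIntegral.integral_sub_zpow_of_ne (by push_cast; omega), zero_smul]
      have e3 : (∮ z in C(l, r), (z - l) ^ (-(k : ℤ) - 1) • (R z * R l)) =
          (∮ z in C(l, r), (z - l) ^ (-(k : ℤ) - 1) • R z) * R l := by
        have hi := circleIntegrable_zpow_smul hr0 hcont (-(k : ℤ) - 1)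
        have := (((ContinuousLinearMap.mul ℂ 𝔸).flip (R l)).intervalIntegral_comp_comm
          (hi.out)).symm
        rw [circleIntegral, circleIntegral]
        simp only [ContinuousLinearMap.flip_apply, ContinuousLinearMap.mul_apply'] at this
        rw [this]
        simp
      rw [e2, e3, ih, zero_sub, smul_mul_assoc, ← pow_succ, ← neg_smul]
      congr 1
      ring
    · exact circleIntegrable_zpow_smul hr0 (fun _ _ => continuousAt_const) _
    · exact circleIntegrable_zpow_smul hr0
        (fun z hz => (hcont z hz).mul continuousAt_const) _

/-- Since R² = -R', integration by parts reduces to the previous formula and produces the factor k.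
-/
theorem circleIntegral_pow_two (h : IsHalfPlaneResolvent R M) (hr0 : 0 < r) (hr : r < l) (k : ℕ) :
    (∮ z in C(l, r), (z - l) ^ (-(k : ℤ)) • R z ^ 2) =
      (2 * Real.pi * Complex.I * (-1) ^ (k + 1) * k : ℂ) • R l ^ (k + 1) := by
  have hre : ∀ z ∈ Metric.sphere (l : ℂ) r, 0 < z.re := fun z hz =>
    re_pos_of_mem_sphere hr (Metric.sphere_subset_closedBall hz)
  have := circleIntegral_zpow_smul_parts (f := R) (f' := fun z => -(R z * R z)) hr0
    (fun z hz => h.hasDerivAt (hre z hz))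
    (fun z hz => ((h.continuousAt (hre z hz)).mul (h.continuousAt (hre z hz))).neg) (-(k : ℤ))
  rw [h.circleIntegral_pow_one hr0 hr] at this
  have e : (∮ z in C(l, r), (z - l) ^ (-(k : ℤ)) • R z ^ 2) =
      -∮ z in C(l, r), (z - l) ^ (-(k : ℤ)) • -(R z * R z) := by
    have := circleIntegral.integral_smul (-1 : ℂ)
      (fun z : ℂ => (z - l) ^ (-(k : ℤ)) • -(R z * R z)) (l : ℂ) r
    rw [neg_one_smul] at this
    rw [← this]
    refine circleIntegral.integral_congr hr0.le fun z _ => ?_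
    simp [sq]
  rw [e, this, neg_neg, smul_smul]
  congr 1
  push_cast
  ring

/-- Since R³ = -(R²)'/2, one more integration by parts produces the further factor k + 1. -/
theorem circleIntegral_pow_three (h : IsHalfPlaneResolvent R M) (hr0 : 0 < r) (hr : r < l)
    (k : ℕ) :
    (∮ z in C(l, r), (z - l) ^ (-(k : ℤ)) • R z ^ 3) =
      (Real.pi * Complex.I * (-1) ^ (k + 1) * k * (k + 1) : ℂ) • R l ^ (k + 2) := by
  have hre : ∀ z ∈ Metric.sphere (l : ℂ) r, 0 < z.re := fun z hz =>
    re_pos_of_mem_sphere hr (Metric.sphere_subset_closedBall hz)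
  have := circleIntegral_zpow_smul_parts (f := fun z => R z ^ 2)
    (f' := fun z => (-2 : ℂ) • R z ^ 3) hr0
    (fun z hz => h.hasDerivAt_sq (hre z hz))
    (fun z hz => ((h.continuousAt (hre z hz)).pow 3).const_smul _) (-(k : ℤ))
  have e2 := h.circleIntegral_pow_two hr0 hr (k + 1)
  have e0 : (-(k : ℤ) - 1) = -((k + 1 : ℕ) : ℤ) := by push_cast; ring
  rw [e0, e2] at this
  have e : (∮ z in C(l, r), (z - l) ^ (-(k : ℤ)) • R z ^ 3) =
      (-2 : ℂ)⁻¹ • ∮ z in C(l, r), (z - l) ^ (-(k : ℤ)) • (-2 : ℂ) • R z ^ 3 := by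
    rw [← circleIntegral.integral_smul]
    refine circleIntegral.integral_congr hr0.le fun z _ => ?_
    rw [smul_comm, smul_smul (-2 : ℂ)⁻¹]
    norm_num
  rw [e, this, smul_smul, ← neg_smul, smul_smul]
  congr 1
  push_cast
  ring

end Circle

end IsHalfPlaneResolvent

end Resolvent

/-! ### Uniform bounds for powers of the resolvent. -/

section PowerBounds

/-- The function (2l - z)/z is holomorphic near the disc, equals 1 at the centre, and has real part
(l² - r²)/|z|² on the circle; the mean value property does the rest. -/
theorem integral_norm_sq_inv_circleMap {l r : ℝ} (hr0 : 0 < r) (hr : r < l) :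
    ∫ θ in (0 : ℝ)..2 * Real.pi, 1 / ‖circleMap (l : ℂ) r θ‖ ^ 2 =
      2 * Real.pi / (l ^ 2 - r ^ 2) := by
  have hpos : 0 < l ^ 2 - r ^ 2 := by nlinarith
  have hre : ∀ z ∈ Metric.closedBall (l : ℂ) r, z ≠ 0 := fun z hz h0 => by
    have := IsHalfPlaneResolvent.re_pos_of_mem_sphere hr hz
    simp [h0] at this
  set f : ℂ → ℂ := fun z => (2 * l - z) / z with hf
  have hfd : ∀ z ∈ Metric.closedBall (l : ℂ) r, DifferentiableAt ℂ f z := fun z hz =>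
    (by fun_prop : DifferentiableAt ℂ (fun z : ℂ => 2 * (l : ℂ) - z) z).div differentiableAt_id
      (hre z hz)
  have hd : DiffContOnCl ℂ f (Metric.ball (l : ℂ) |r|) := by
    rw [abs_of_pos hr0]
    apply DifferentiableOn.diffContOnCl
    intro z hz
    rw [closure_ball _ hr0.ne'] at hz
    exact (hfd z hz).differentiableWithinAt
  have havg := hd.circleAverage
  have hl0 : (l : ℂ) ≠ 0 := by exact_mod_cast (hr0.trans hr).ne'
  have hfl : f l = 1 := by
    simp only [hf]; rw [div_eq_one_iff_eq hl0]; ring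
  rw [hfl, Real.circleAverage_def] at havg
  have hcont : Continuous fun θ => f (circleMap (l : ℂ) r θ) :=
    continuous_iff_continuousAt.mpr fun θ =>
      (hfd _ (circleMap_mem_closedBall _ hr0.le θ)).continuousAt.comp
        (continuous_circleMap _ _).continuousAt
  have hint : ∫ θ in (0 : ℝ)..2 * Real.pi, f (circleMap (l : ℂ) r θ) = ((2 * Real.pi : ℝ) : ℂ) := by
    have h2 : (2 * Real.pi : ℝ) ≠ 0 := by positivity
    rw [inv_smul_eq_iff₀ h2] at havg
    rw [havg]; simp
  have hreint := Complex.reCLM.intervalIntegral_comp_comm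
    (hcont.intervalIntegrable (μ := volume) 0 (2 * Real.pi))
  rw [hint] at hreint
  simp only [Complex.reCLM_apply, Complex.ofReal_re] at hreint
  have hpt : ∀ θ : ℝ, (f (circleMap (l : ℂ) r θ)).re =
      (l ^ 2 - r ^ 2) * (1 / ‖circleMap (l : ℂ) r θ‖ ^ 2) := by
    intro θ
    set z := circleMap (l : ℂ) r θ with hz
    have h1 : ‖z - l‖ ^ 2 = r ^ 2 := by
      rw [hz, circleMap_sub_center, norm_circleMap_zero, sq_abs]
    rw [← Complex.normSq_eq_norm_sq, Complex.normSq_apply] at h1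
    simp only [Complex.sub_re, Complex.sub_im, Complex.ofReal_re, Complex.ofReal_im] at h1
    simp only [hf]
    rw [Complex.div_re, ← Complex.normSq_eq_norm_sq, ← add_div, mul_one_div]
    congr 1
    simp
    nlinarith
  simp_rw [hpt] at hreint
  rw [intervalIntegral.integral_const_mul] at hreint
  rw [eq_div_iff hpos.ne', mul_comm]
  exact hreint

/-- Averaging |z|⁻² costs 1/(l² - r²) instead of the maximum 1/(l - r)². For r close to l this saves
the power of k on which the uniform bounds depend. -/
theorem norm_circleIntegral_zpow_smul_le {E : Type*} [NormedAddCommGroup E] [NormedSpace ℂ E]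
    {l r K : ℝ} (hr0 : 0 < r) (hr : r < l) {f : ℂ → E}
    (hf : ∀ z ∈ Metric.sphere (l : ℂ) r, ‖f z‖ ≤ K / ‖z‖ ^ 2) (m : ℤ) :
    ‖∮ z in C(l, r), (z - l) ^ m • f z‖ ≤
      2 * Real.pi * K * (r * r ^ m / (l ^ 2 - r ^ 2)) := by
  have hne : ∀ θ, circleMap (l : ℂ) r θ ≠ 0 := fun θ h0 => by
    have := IsHalfPlaneResolvent.re_pos_of_mem_sphere hr (circleMap_mem_closedBall (l : ℂ) hr0.le θ)
    simp [h0] at this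
  have hc : Continuous fun θ => 1 / ‖circleMap (l : ℂ) r θ‖ ^ 2 :=
    continuous_const.div ((continuous_circleMap _ _).norm.pow 2)
      fun θ => pow_ne_zero 2 (norm_ne_zero_iff.mpr (hne θ))
  rw [circleIntegral]
  calc ‖∫ θ in (0 : ℝ)..2 * Real.pi, deriv (circleMap (l : ℂ) r) θ •
        (circleMap (l : ℂ) r θ - l) ^ m • f (circleMap (l : ℂ) r θ)‖
      ≤ ∫ θ in (0 : ℝ)..2 * Real.pi, (r * r ^ m * K) * (1 / ‖circleMap (l : ℂ) r θ‖ ^ 2) := by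
        refine intervalIntegral.norm_integral_le_of_norm_le Real.two_pi_pos.le
          (Eventually.of_forall fun θ _ => ?_) ((hc.const_mul _).intervalIntegrable _ _)
        rw [norm_smul, norm_smul, deriv_circleMap, norm_mul, norm_circleMap_zero, norm_zpow,
          circleMap_sub_center, norm_circleMap_zero, abs_of_pos hr0, Complex.norm_I, mul_one,
          mul_assoc (r * r ^ m), mul_one_div, mul_assoc r]
        have := hf _ (circleMap_mem_sphere (l : ℂ) hr0.le θ)
        gcongr
    _ = _ := by
        rw [intervalIntegral.integral_const_mul, integral_norm_sq_inv_circleMap hr0 hr]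
        ring

/-- The radius is r = l k/(k+1): then (l/r)ᵏ = (1 + 1/k)ᵏ ≤ e ≤ 3, while l² - r² ≥ l²/(k+1). -/
theorem exists_radius_bound {l : ℝ} (hl : 0 < l) {k : ℕ} (hk : 1 ≤ k) :
    ∃ r, 0 < r ∧ r < l ∧ r * r ^ (-(k : ℤ)) / (l ^ 2 - r ^ 2) * l ^ (k + 1) ≤ 3 * (k + 1) := by
  have hk0 : (0 : ℝ) < k := by exact_mod_cast hk
  set q : ℝ := k / (k + 1) with hq
  have hq0 : 0 < q := by positivity
  have hq1 : q < 1 := by rw [hq, div_lt_one (by positivity)]; linarith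
  have hq2 : 1 - q = 1 / (k + 1) := by rw [hq]; field_simp; ring
  refine ⟨l * q, by positivity, by nlinarith, ?_⟩
  have e : l * q * (l * q) ^ (-(k : ℤ)) / (l ^ 2 - (l * q) ^ 2) * l ^ (k + 1) =
      q * q⁻¹ ^ k / (1 - q ^ 2) := by
    have h1 : 1 - q ^ 2 ≠ 0 := by nlinarith
    have h2 : l ^ 2 - (l * q) ^ 2 ≠ 0 := by
      rw [mul_pow, ← mul_one_sub]; positivity
    rw [zpow_neg, zpow_natCast, mul_pow, inv_pow]
    field_simp
    ring
  rw [e]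
  have h3 : q⁻¹ ^ k ≤ 3 := by
    have : q⁻¹ ≤ Real.exp (1 / k) := by
      have := Real.add_one_le_exp (1 / (k : ℝ))
      refine le_trans (le_of_eq ?_) this
      rw [hq, inv_div, add_div, div_self hk0.ne', add_comm]
    calc q⁻¹ ^ k ≤ Real.exp (1 / k) ^ k := by gcongr
      _ = Real.exp 1 := by rw [← Real.exp_nat_mul]; congr 1; field_simp
      _ ≤ 3 := Real.exp_one_lt_three.le
  have h4 : 1 / (k + 1 : ℝ) ≤ 1 - q ^ 2 := by rw [← hq2]; nlinarith
  rw [div_le_iff₀ (by nlinarith)]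
  calc q * q⁻¹ ^ k ≤ 1 * 3 := by gcongr
    _ = 3 * (k + 1) * (1 / (k + 1)) := by field_simp
    _ ≤ _ := by gcongr

variable {𝔸 : Type*} [NormedRing 𝔸] [NormedAlgebra ℂ 𝔸]
variable {R : ℂ → 𝔸} {M : ℝ}

namespace IsHalfPlaneResolvent

theorem norm_pow_le_sphere (h : IsHalfPlaneResolvent R M) {z : ℂ} (hz : 0 < z.re) :
    ‖R z ^ 2‖ ≤ M ^ 2 / ‖z‖ ^ 2 := by
  rw [← div_pow, sq (R z), sq (M / _)]
  have := h.norm_le_div hz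
  exact (norm_mul_le _ _).trans (mul_le_mul this this (norm_nonneg _) ((norm_nonneg _).trans this))

theorem norm_smul_sub_one_le (h : IsHalfPlaneResolvent R M) (h1 : ‖(1 : 𝔸)‖ ≤ 1) {z : ℂ}
    (hz : 0 < z.re) : ‖z • R z - 1‖ ≤ M + 1 :=
  (norm_sub_le _ _).trans (add_le_add (by rw [norm_smul]; exact h.norm_le z hz) h1)

variable [CompleteSpace 𝔸]

/-- Cauchy's estimate for R² rather than R: the decay |z|⁻² makes the averaged bound available, and
the factor k in the coefficient absorbs the k + 1 ≤ 2k lost in the choice of the radius. -/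
theorem norm_pow_succ_le (h : IsHalfPlaneResolvent R M) {l : ℝ} (hl : 0 < l) {k : ℕ}
    (hk : 1 ≤ k) : l ^ (k + 1) * ‖R l ^ (k + 1)‖ ≤ 6 * M ^ 2 := by
  obtain ⟨r, hr0, hr, hb⟩ := exists_radius_bound hl hk
  have hre : ∀ z ∈ Metric.sphere (l : ℂ) r, 0 < z.re := fun z hz =>
    re_pos_of_mem_sphere hr (Metric.sphere_subset_closedBall hz)
  have h2 := norm_circleIntegral_zpow_smul_le hr0 hr (f := fun z => R z ^ 2)
    (fun z hz => h.norm_pow_le_sphere (hre z hz)) (-(k : ℤ))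
  rw [h.circleIntegral_pow_two hr0 hr, norm_smul] at h2
  have hk0 : (1 : ℝ) ≤ k := by exact_mod_cast hk
  have e : ‖(2 * Real.pi * Complex.I * (-1) ^ (k + 1) * k : ℂ)‖ = 2 * Real.pi * k := by
    simp [abs_of_pos Real.pi_pos]
  rw [e, mul_assoc, mul_assoc (2 * Real.pi), mul_le_mul_iff_right₀ (by positivity)] at h2
  have h3 : k * (l ^ (k + 1) * ‖R l ^ (k + 1)‖) ≤ k * (6 * M ^ 2) := by
    calc k * (l ^ (k + 1) * ‖R l ^ (k + 1)‖) = k * ‖R l ^ (k + 1)‖ * l ^ (k + 1) := by ring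
      _ ≤ M ^ 2 * (r * r ^ (-(k : ℤ)) / (l ^ 2 - r ^ 2)) * l ^ (k + 1) := by gcongr
      _ = M ^ 2 * (r * r ^ (-(k : ℤ)) / (l ^ 2 - r ^ 2) * l ^ (k + 1)) := by ring
      _ ≤ M ^ 2 * (3 * (k + 1)) := by gcongr
      _ ≤ M ^ 2 * (3 * (k + k)) := by gcongr
      _ = _ := by ring
  exact le_of_mul_le_mul_left h3 (by positivity)

/-- The function (zR(z) - 1)R(z)² still decays like |z|⁻², but its coefficient carries k(k+1)
instead of k. The additional factor is the decay in Ritt's bound. -/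
theorem norm_sub_one_mul_pow_succ_le (h : IsHalfPlaneResolvent R M) (h1 : ‖(1 : 𝔸)‖ ≤ 1)
    {l : ℝ} (hl : 0 < l) {k : ℕ} (hk : 1 ≤ k) :
    k * (l ^ (k + 1) * ‖((l : ℂ) • R l - 1) * R l ^ (k + 1)‖) ≤ 6 * ((M + 1) * M ^ 2) := by
  obtain ⟨r, hr0, hr, hb⟩ := exists_radius_bound hl hk
  have hM := h.bound_nonneg
  have hre : ∀ z ∈ Metric.sphere (l : ℂ) r, 0 < z.re := fun z hz =>
    re_pos_of_mem_sphere hr (Metric.sphere_subset_closedBall hz)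
  have h2 := norm_circleIntegral_zpow_smul_le hr0 hr (f := fun z => (z • R z - 1) * R z ^ 2)
    (K := (M + 1) * M ^ 2)
    (fun z hz => (norm_mul_le _ _).trans (by
      rw [mul_div_assoc]
      gcongr
      · exact h.norm_smul_sub_one_le h1 (hre z hz)
      · exact h.norm_pow_le_sphere (hre z hz))) (-(k : ℤ))
  have hc : ∀ j : ℕ, ∀ z ∈ Metric.sphere (l : ℂ) r, ContinuousAt (fun z => R z ^ j) z :=
    fun j z hz => (h.continuousAt (hre z hz)).pow j
  -- Writing z = (z - l) + l reduces the integral to the coefficients of R³ and R².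
  have e1 : (∮ z in C(l, r), (z - l) ^ (-(k : ℤ)) • ((z • R z - 1) * R z ^ 2)) =
      (∮ z in C(l, r), (z - l) ^ (-((k - 1 : ℕ) : ℤ)) • R z ^ 3) +
      ((l : ℂ) • (∮ z in C(l, r), (z - l) ^ (-(k : ℤ)) • R z ^ 3) -
        ∮ z in C(l, r), (z - l) ^ (-(k : ℤ)) • R z ^ 2) := by
    rw [← circleIntegral.integral_smul, ← circleIntegral.integral_sub,
      ← circleIntegral.integral_add]
    · refine circleIntegral.integral_congr hr0.le fun z hz => ?_
      have hz0 := sub_ne_zero_of_mem_sphere hr0 hz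
      have hp : (z - l) ^ (-((k - 1 : ℕ) : ℤ)) = (z - l) ^ (-(k : ℤ)) * (z - l) := by
        rw [← zpow_add_one₀ hz0]; congr 1; push_cast [hk]; ring
      simp only [hp]
      rw [sub_mul, one_mul, smul_mul_assoc, ← pow_succ', mul_smul, smul_comm (l : ℂ), ← smul_sub,
        ← smul_add]
      congr 1
      rw [sub_smul]
      abel
    · exact circleIntegrable_zpow_smul hr0 (hc 3) _
    · simp_rw [smul_comm (l : ℂ)]
      exact CircleIntegrable.sub
        (circleIntegrable_zpow_smul hr0 (fun z hz => (hc 3 z hz).const_smul _) _)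
        (circleIntegrable_zpow_smul hr0 (hc 2) _)
    · simp_rw [smul_comm (l : ℂ)]
      exact circleIntegrable_zpow_smul hr0 (fun z hz => (hc 3 z hz).const_smul _) _
    · exact circleIntegrable_zpow_smul hr0 (hc 2) _
  have e2 : (∮ z in C(l, r), (z - l) ^ (-(k : ℤ)) • ((z • R z - 1) * R z ^ 2)) =
      (Real.pi * Complex.I * (-1) ^ (k + 1) * k * (k + 1) : ℂ) •
        (((l : ℂ) • R l - 1) * R l ^ (k + 1)) := by
    rw [e1, h.circleIntegral_pow_three hr0 hr, h.circleIntegral_pow_three hr0 hr,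
      h.circleIntegral_pow_two hr0 hr]
    obtain ⟨j, rfl⟩ := Nat.exists_eq_add_of_le' hk
    rw [Nat.add_sub_cancel, sub_mul, one_mul, smul_mul_assoc, ← pow_succ']
    push_cast
    simp only [pow_succ (-1 : ℂ)]
    module
  rw [e2, norm_smul] at h2
  have hk0 : (1 : ℝ) ≤ k := by exact_mod_cast hk
  have e : ‖(Real.pi * Complex.I * (-1) ^ (k + 1) * k * (k + 1) : ℂ)‖ =
      Real.pi * (k * (k + 1)) := by
    have : ‖(k + 1 : ℂ)‖ = k + 1 := by exact_mod_cast Complex.norm_natCast (k + 1)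
    simp only [norm_mul, norm_pow, norm_neg, norm_one, one_pow, Complex.norm_real, Complex.norm_I,
      Complex.norm_natCast, this, Real.norm_eq_abs, abs_of_pos Real.pi_pos]
    ring
  rw [e, mul_comm 2 Real.pi, mul_assoc, mul_assoc Real.pi, mul_assoc Real.pi,
    mul_le_mul_iff_right₀ (by positivity)] at h2
  set X := ‖((l : ℂ) • R l - 1) * R l ^ (k + 1)‖
  have h3 : (k + 1) * (k * (l ^ (k + 1) * X)) ≤ (k + 1) * (6 * ((M + 1) * M ^ 2)) := by
    calc (k + 1) * (k * (l ^ (k + 1) * X)) = k * (k + 1) * X * l ^ (k + 1) := by ring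
      _ ≤ 2 * ((M + 1) * M ^ 2) * (r * r ^ (-(k : ℤ)) / (l ^ 2 - r ^ 2)) * l ^ (k + 1) := by
        gcongr ?_ * _
      _ = 2 * ((M + 1) * M ^ 2) * (r * r ^ (-(k : ℤ)) / (l ^ 2 - r ^ 2) * l ^ (k + 1)) := by ring
      _ ≤ 2 * ((M + 1) * M ^ 2) * (3 * (k + 1)) := by gcongr
      _ = _ := by ring
  exact le_of_mul_le_mul_left h3 (by positivity)

/-- The Hille-Yosida bound. -/
theorem norm_smul_pow_le (h : IsHalfPlaneResolvent R M) (h1 : ‖(1 : 𝔸)‖ ≤ 1) {l : ℝ}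
    (hl : 0 < l) (k : ℕ) : ‖((l : ℂ) • R l) ^ k‖ ≤ 18 * (M + 1) ^ 3 := by
  have hM := h.bound_nonneg
  have hl' : 0 < (l : ℂ).re := by simpa using hl
  -- Cauchy's estimate starts at the second power; the constant also dominates the bounds 1 and M
  -- for the powers 0 and 1.
  rcases k with _ | _ | k
  · rw [pow_zero]
    nlinarith [pow_nonneg hM 3, pow_nonneg hM 2]
  · rw [zero_add, pow_one, norm_smul]
    have := h.norm_le l hl'
    nlinarith [pow_nonneg hM 3, pow_nonneg hM 2]
  · have := h.norm_pow_succ_le hl (k := k + 1) (by omega)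
    rw [smul_pow, norm_smul, norm_pow, Complex.norm_real, Real.norm_of_nonneg hl.le]
    nlinarith [pow_nonneg hM 3, pow_nonneg hM 2]

/-- Ritt's bound. -/
theorem norm_sub_one_mul_smul_pow_le (h : IsHalfPlaneResolvent R M) (h1 : ‖(1 : 𝔸)‖ ≤ 1) {l : ℝ}
    (hl : 0 < l) (k : ℕ) :
    ‖((l : ℂ) • R l - 1) * ((l : ℂ) • R l) ^ k‖ ≤ 18 * (M + 1) ^ 3 / (k + 1) := by
  have hM := h.bound_nonneg
  have hl' : 0 < (l : ℂ).re := by simpa using hl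
  have hJ := h.norm_smul_sub_one_le h1 hl'
  rcases k with _ | _ | k
  · rw [pow_zero, mul_one, Nat.cast_zero, zero_add, div_one]
    nlinarith [pow_nonneg hM 3, pow_nonneg hM 2]
  · rw [zero_add, pow_one]
    refine (norm_mul_le _ _).trans ?_
    have h2 : ‖(l : ℂ) • R l‖ ≤ M := by rw [norm_smul]; exact h.norm_le l hl'
    calc _ ≤ (M + 1) * M := by gcongr
      _ ≤ _ := by norm_num; nlinarith [pow_nonneg hM 3, pow_nonneg hM 2]
  · have := h.norm_sub_one_mul_pow_succ_le h1 hl (k := k + 1) (by omega)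
    rw [smul_pow, mul_smul_comm, norm_smul, norm_pow, Complex.norm_real, Real.norm_of_nonneg hl.le,
      le_div_iff₀ (by positivity)]
    set X := l ^ (k + 1 + 1) * ‖((l : ℂ) • R l - 1) * R l ^ (k + 1 + 1)‖
    have hX : 0 ≤ X := by positivity
    push_cast at this ⊢
    -- The index shift by two costs k + 3 ≤ 3(k + 1), whence 18 = 3 · 6.
    have h3 : X * (k + 1 + 1 + 1) ≤ 3 * ((k + 1) * X) := by nlinarith [k.cast_nonneg (α := ℝ)]
    nlinarith [pow_nonneg hM 3, pow_nonneg hM 2]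

end IsHalfPlaneResolvent

end PowerBounds

/-! ### Exponential bounds -/

section ExpBounds

variable {𝔸 : Type*} [NormedRing 𝔸] [NormedAlgebra ℂ 𝔸]

theorem commute_exp_smul {A B : 𝔸} (h : Commute A B) (t : ℂ) :
    Commute (NormedSpace.exp (t • A)) B := by
  let _ : NormedAlgebra ℚ 𝔸 := NormedAlgebra.restrictScalars ℚ ℂ 𝔸
  exact (h.smul_left t).exp_left

variable [CompleteSpace 𝔸]

theorem norm_mul_exp_smul_le (B P : 𝔸) {c : ℕ → ℝ} (hc : ∀ n, ‖B * P ^ n‖ ≤ c n) {s K : ℝ}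
    (hs : 0 ≤ s) (hK : HasSum (fun n : ℕ => s ^ n / n.factorial * c n) K) :
    ‖B * NormedSpace.exp ((s : ℂ) • P)‖ ≤ K := by
  have h1 := (NormedSpace.exp_series_hasSum_exp' (𝕂 := ℂ) ((s : ℂ) • P)).mul_left B
  refine h1.norm_le_of_bounded hK fun n => ?_
  rw [smul_pow, smul_smul, mul_smul_comm, norm_smul]
  have e : ‖((n.factorial : ℂ)⁻¹ * (s : ℂ) ^ n)‖ = s ^ n / n.factorial := by
    rw [norm_mul, norm_inv, norm_pow, Complex.norm_natCast, Complex.norm_real,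
      Real.norm_of_nonneg hs]
    ring
  rw [e]
  gcongr
  exact hc n

theorem exp_smul_sub_one (P : 𝔸) (s : ℝ) :
    NormedSpace.exp ((s : ℂ) • (P - 1)) =
      (Real.exp (-s) : ℂ) • NormedSpace.exp ((s : ℂ) • P) := by
  let _ : NormedAlgebra ℚ 𝔸 := NormedAlgebra.restrictScalars ℚ ℂ 𝔸
  have e : (s : ℂ) • (P - 1) = algebraMap ℂ 𝔸 (-s : ℂ) + (s : ℂ) • P := by
    rw [Algebra.algebraMap_eq_smul_one, smul_sub, neg_smul]; abel
  rw [e, NormedSpace.exp_add_of_commute (Algebra.commutes _ _),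
    ← NormedSpace.algebraMap_exp_comm (𝕂 := ℂ), ← Complex.exp_eq_exp_ℂ,
    ← Algebra.smul_def]
  push_cast
  rfl

/-- The operator exp(s(P - 1)) is the average of the powers Pⁿ with the Poisson weights e⁻ˢ sⁿ/n!.
-/
theorem norm_exp_smul_sub_one_le {P : 𝔸} {C : ℝ} (hP : ∀ n, ‖P ^ n‖ ≤ C) {s : ℝ} (hs : 0 ≤ s) :
    ‖NormedSpace.exp ((s : ℂ) • (P - 1))‖ ≤ C := by
  have h1 : HasSum (fun n : ℕ => s ^ n / n.factorial * C) (Real.exp s * C) := by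
    rw [Real.exp_eq_exp_ℝ]
    exact (NormedSpace.expSeries_div_hasSum_exp s).mul_right C
  have h2 := norm_mul_exp_smul_le 1 P (fun n => by simpa using hP n) hs h1
  rw [one_mul] at h2
  rw [exp_smul_sub_one, norm_smul, Complex.norm_real, Real.norm_of_nonneg (Real.exp_pos _).le]
  calc _ ≤ Real.exp (-s) * (Real.exp s * C) := by gcongr
    _ = C := by rw [← mul_assoc, ← Real.exp_add]; simp

/-- The Poisson average of 1/(n+1) is (1 - e⁻ˢ)/s. This turns Ritt's decay in n into decay in time.
-/
theorem norm_sub_one_mul_exp_le {P : 𝔸} {C : ℝ} (hC : 0 ≤ C)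
    (hP : ∀ n : ℕ, ‖(P - 1) * P ^ n‖ ≤ C / (n + 1)) {s : ℝ} (hs : 0 < s) :
    ‖(P - 1) * NormedSpace.exp ((s : ℂ) • (P - 1))‖ ≤ C / s := by
  have h0 : HasSum (fun n : ℕ => s ^ n / n.factorial) (Real.exp s) := by
    rw [Real.exp_eq_exp_ℝ]
    exact NormedSpace.expSeries_div_hasSum_exp s
  have h1 : HasSum (fun n : ℕ => s ^ n / n.factorial * (C / (n + 1)))
      ((Real.exp s - 1) * (C / s)) := by
    have := ((hasSum_nat_add_iff' 1).mpr h0).mul_right (C / s)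
    simp only [Finset.sum_range_one, pow_zero, Nat.factorial_zero, Nat.cast_one, div_one] at this
    refine this.congr_fun fun n => ?_
    rw [Nat.factorial_succ]
    push_cast
    field_simp
    ring
  have h2 := norm_mul_exp_smul_le (P - 1) P hP hs.le h1
  rw [exp_smul_sub_one, mul_smul_comm, norm_smul, Complex.norm_real,
    Real.norm_of_nonneg (Real.exp_pos _).le]
  calc _ ≤ Real.exp (-s) * ((Real.exp s - 1) * (C / s)) := by gcongr
    _ ≤ Real.exp (-s) * (Real.exp s * (C / s)) := by gcongr; linarith
    _ = C / s := by rw [← mul_assoc, ← Real.exp_add]; simp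

theorem hasDerivAt_exp_ofReal_smul (A : 𝔸) (t : ℝ) :
    HasDerivAt (fun t : ℝ => NormedSpace.exp ((t : ℂ) • A))
      (A * NormedSpace.exp ((t : ℂ) • A)) t := by
  have := (hasDerivAt_exp_smul_const' A (t : ℂ)).scomp t Complex.ofRealCLM.hasDerivAt
  simpa [Function.comp_def] using this

theorem exp_ofReal_add_smul (A : 𝔸) (s t : ℝ) :
    NormedSpace.exp (((s + t : ℝ) : ℂ) • A) =
      NormedSpace.exp ((s : ℂ) • A) * NormedSpace.exp ((t : ℂ) • A) := by
  let _ : NormedAlgebra ℚ 𝔸 := NormedAlgebra.restrictScalars ℚ ℂ 𝔸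
  rw [← NormedSpace.exp_add_of_commute (((Commute.refl A).smul_left _).smul_right _), ← add_smul]
  push_cast
  rfl

/-- The path s ↦ exp(sA) exp((t-s)B) joins exp(tB) to exp(tA); its derivative contains the
difference A - B, which may be small on suitable vectors. -/
theorem hasDerivAt_exp_smul_mul_exp_smul {A B : 𝔸} (hAB : Commute A B) (t s : ℝ) :
    HasDerivAt (fun s : ℝ => NormedSpace.exp ((s : ℂ) • A) * NormedSpace.exp (((t - s : ℝ) : ℂ) • B))
      (NormedSpace.exp ((s : ℂ) • A) * NormedSpace.exp (((t - s : ℝ) : ℂ) • B) * (A - B)) s := by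
  have h1 := hasDerivAt_exp_ofReal_smul A s
  have h2 := (hasDerivAt_exp_ofReal_smul B (t - s)).scomp s ((hasDerivAt_id s).const_sub t)
  have h3 : HasDerivAt (fun s : ℝ => NormedSpace.exp ((s : ℂ) • A) *
      NormedSpace.exp (((t - s : ℝ) : ℂ) • B)) _ s := h1.mul h2
  have c1 := commute_exp_smul (Commute.refl A) (s : ℂ)
  have c2 := commute_exp_smul (Commute.refl B) ((t - s : ℝ) : ℂ)
  have c3 := commute_exp_smul hAB.symm ((t - s : ℝ) : ℂ)
  refine h3.congr_deriv ?_
  rw [neg_smul, one_smul, ← c2.eq, ← c1.eq, mul_sub, mul_assoc _ _ A, c3.eq]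
  noncomm_ring

end ExpBounds

/-! ### Strong limits of operators and comparison of exponentials. -/

section Yosida

variable {X : Type*} [NormedAddCommGroup X] [NormedSpace ℂ X]

/-- The product rule in the mixed setting used throughout: real time, complex-linear operators. -/
theorem hasDerivAt_clm_apply {Y : Type*} [NormedAddCommGroup Y] [NormedSpace ℂ Y]
    {c : ℝ → X →L[ℂ] Y} {c' : X →L[ℂ] Y} {u : ℝ → X} {u' : X} {s : ℝ} (hc : HasDerivAt c c' s)
    (hu : HasDerivAt u u' s) : HasDerivAt (fun s => c s (u s)) (c' (u s) + c s u') s :=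
  HasDerivAt.clm_apply (c := fun s => (c s).restrictScalars ℝ)
    ((ContinuousLinearMap.restrictScalarsL ℂ X Y ℝ ℝ).hasFDerivAt.comp_hasDerivAt s hc) hu

theorem tendsto_apply_of_norm_le {F : ℕ → X →L[ℂ] X} {K : ℝ} (hF : ∀ n, ‖F n‖ ≤ K)
    {T : X →L[ℂ] X} (hT : ∀ x, Tendsto (fun n => F n x) atTop (𝓝 (T x)))
    {y : ℕ → X} {x : X} (hy : Tendsto y atTop (𝓝 x)) :
    Tendsto (fun n => F n (y n)) atTop (𝓝 (T x)) := by
  have h1 : Tendsto (fun n => F n (y n - x)) atTop (𝓝 0) := by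
    refine squeeze_zero_norm (a := fun n => K * ‖y n - x‖) (fun n => ?_) ?_
    · exact (F n).le_of_opNorm_le (hF n) _
    · have := (tendsto_iff_norm_sub_tendsto_zero.mp hy).const_mul K
      simpa using this
  have := h1.add (hT x)
  simpa using this

theorem exists_strong_limit [CompleteSpace X] {F : ℕ → X →L[ℂ] X} {K : ℝ} (hF : ∀ n, ‖F n‖ ≤ K)
    {s : Set X} (hs : Dense s) (hc : ∀ x ∈ s, CauchySeq fun n => F n x) :
    ∃ T : X →L[ℂ] X, ‖T‖ ≤ K ∧ ∀ x, Tendsto (fun n => F n x) atTop (𝓝 (T x)) := by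
  have hK : 0 ≤ K := (norm_nonneg _).trans (hF 0)
  have hc' : ∀ x, CauchySeq fun n => F n x := by
    intro x
    rw [Metric.cauchySeq_iff']
    intro ε hε
    have hK1 : 0 < 3 * (K + 1) := by positivity
    obtain ⟨y, hy, hyx⟩ := Metric.dense_iff.mp hs x (ε / (3 * (K + 1))) (by positivity)
    have hyx' : ‖x - y‖ < ε / (3 * (K + 1)) := by
      rw [← dist_eq_norm, dist_comm]; exact hy
    rw [lt_div_iff₀ hK1] at hyx'
    obtain ⟨N, hN⟩ := Metric.cauchySeq_iff'.mp (hc y hyx) (ε / 3) (by positivity)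
    refine ⟨N, fun n hn => ?_⟩
    have h1 := hN n hn
    rw [dist_eq_norm] at h1 ⊢
    have h2 : F n x - F N x = F n (x - y) + (F n y - F N y) - F N (x - y) := by
      simp only [map_sub]; abel
    have h3 := (F n).le_of_opNorm_le (hF n) (x - y)
    have h4 := (F N).le_of_opNorm_le (hF N) (x - y)
    have h5 : ‖F n x - F N x‖ ≤ ‖F n (x - y)‖ + ‖F n y - F N y‖ + ‖F N (x - y)‖ := by
      rw [h2]
      exact (norm_sub_le _ _).trans (by gcongr; exact norm_add_le _ _)
    nlinarith [norm_nonneg (x - y)]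
  choose f hf using fun x => cauchySeq_tendsto_of_complete (hc' x)
  have hft : Tendsto (fun n x => F n x) atTop (𝓝 f) := tendsto_pi_nhds.mpr hf
  refine ⟨continuousLinearMapOfTendsto F hft, ?_, hf⟩
  refine ContinuousLinearMap.opNorm_le_bound _ hK fun x => ?_
  exact le_of_tendsto (hf x).norm (Eventually.of_forall fun n => (F n).le_of_opNorm_le (hF n) x)

theorem norm_exp_sub_exp_apply_le [CompleteSpace X] {A B : X →L[ℂ] X} (hAB : Commute A B) {C : ℝ}
    (hA : ∀ t : ℝ, 0 ≤ t → ‖NormedSpace.exp ((t : ℂ) • A)‖ ≤ C)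
    (hB : ∀ t : ℝ, 0 ≤ t → ‖NormedSpace.exp ((t : ℂ) • B)‖ ≤ C) {t : ℝ} (ht : 0 ≤ t) (x : X) :
    ‖NormedSpace.exp ((t : ℂ) • A) x - NormedSpace.exp ((t : ℂ) • B) x‖ ≤
      C * C * ‖A x - B x‖ * t := by
  have hC : 0 ≤ C := (norm_nonneg _).trans (hA 0 le_rfl)
  have hd := fun s : ℝ => hasDerivAt_clm_apply (hasDerivAt_exp_smul_mul_exp_smul hAB t s)
    (hasDerivAt_const s x)
  have := norm_image_sub_le_of_norm_deriv_le_segment' (a := 0) (b := t)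
    (C := C * C * ‖A x - B x‖) (fun s _ => (hd s).hasDerivWithinAt) (fun s hs => ?_) t ⟨ht, le_rfl⟩
  · simpa using this
  · simp only [map_zero, add_zero]
    have h1 : ‖NormedSpace.exp ((s : ℂ) • A) * NormedSpace.exp (((t - s : ℝ) : ℂ) • B)‖ ≤ C * C :=
      (norm_mul_le _ _).trans (mul_le_mul (hA s hs.1) (hB _ (by linarith [hs.2])) (norm_nonneg _) hC)
    exact ContinuousLinearMap.le_of_opNorm_le _ h1 _

end Yosida

/-! ### Generation of analytic semigroups -/

section Generation

variable {X : Type*} [NormedAddCommGroup X] [NormedSpace ℂ X]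

/-- An analytic semigroup `T` with derivative `D = B T`, where `B` is the operator with resolvent
`R z` for `re z > a`. -/
structure IsAnalyticSemigroup (R : ℂ → X →L[ℂ] X) (a : ℝ) (T D : ℝ → X →L[ℂ] X) : Prop where
  zero : T 0 = 1
  add : ∀ s t : ℝ, 0 ≤ s → 0 ≤ t → T (s + t) = T s * T t
  cont : ∀ x, ContinuousOn (fun t => T t x) (Ici 0)
  bound : ∀ τ : ℝ, ∃ C, 0 ≤ C ∧ ∀ t, 0 ≤ t → t ≤ τ → ‖T t‖ ≤ C ∧ t * ‖D t‖ ≤ C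
  hasDerivAt : ∀ t, 0 < t → HasDerivAt T (D t) t
  contD : ContinuousOn D (Ioi 0)
  commute : ∀ t, 0 ≤ t → ∀ z : ℂ, a < z.re → Commute (T t) (R z)
  resolvent_mul : ∀ t, 0 < t → ∀ z : ℂ, a < z.re → R z * D t = (z • R z - 1) * T t

/-- The Yosida approximation `λ (λ R(λ) - 1)`, `λ = n + 1`. -/
noncomputable def yosida (R : ℂ → X →L[ℂ] X) (n : ℕ) : X →L[ℂ] X :=
  ((n + 1 : ℝ) : ℂ) • (((n + 1 : ℝ) : ℂ) • R ((n + 1 : ℝ) : ℂ) - 1)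

/-- The semigroup generated by the Yosida approximation. -/
noncomputable def yosidaExp (R : ℂ → X →L[ℂ] X) (n : ℕ) (t : ℝ) : X →L[ℂ] X :=
  NormedSpace.exp ((t : ℂ) • yosida R n)

namespace IsHalfPlaneResolvent

variable {R : ℂ → X →L[ℂ] X} {M : ℝ}

theorem natCast_re_pos (n : ℕ) : 0 < (((n + 1 : ℝ) : ℂ)).re := by
  rw [Complex.ofReal_re]; positivity

theorem commute_yosida (h : IsHalfPlaneResolvent R M) (n : ℕ) {z : ℂ} (hz : 0 < z.re) :
    Commute (yosida R n) (R z) :=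
  (((h.commute (natCast_re_pos n) hz).smul_left _).sub_left (Commute.one_left _)).smul_left _

theorem commute_yosida_yosida (h : IsHalfPlaneResolvent R M) (n m : ℕ) :
    Commute (yosida R n) (yosida R m) :=
  (((h.commute_yosida n (natCast_re_pos m)).smul_right _).sub_right
    (Commute.one_right _)).smul_right _

/-- In terms of the operator B with resolvent R, the approximation is nR(n)B, and BR(z) = zR(z) - 1
(here n stands for n + 1). -/
theorem yosida_mul (h : IsHalfPlaneResolvent R M) (n : ℕ) {z : ℂ} (hz : 0 < z.re) :
    yosida R n * R z =
      (((n + 1 : ℝ) : ℂ) • R ((n + 1 : ℝ) : ℂ)) * (z • R z - 1) := by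
  set l : ℂ := ((n + 1 : ℝ) : ℂ) with hl
  have h1 := h.sub_eq l z (natCast_re_pos n) hz
  have h2 : R l * R z * (1 : X →L[ℂ] X) = R l * R z := mul_one _
  rw [yosida, ← hl]
  have h3 : R z = R l - (z - l) • (R l * R z) := by rw [← h1]; abel
  simp only [smul_mul_assoc, sub_mul, mul_sub, mul_smul_comm, one_mul, mul_one]
  nth_rw 2 [h3]
  simp only [smul_sub, smul_smul]
  module

theorem yosida_mul_comm (h : IsHalfPlaneResolvent R M) (n : ℕ) {z : ℂ} (hz : 0 < z.re) :
    R z * yosida R n =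
      (z • R z - 1) * (((n + 1 : ℝ) : ℂ) • R ((n + 1 : ℝ) : ℂ)) := by
  rw [← (h.commute_yosida n hz).eq, h.yosida_mul n hz]
  exact (((h.commute (natCast_re_pos n) hz).smul_right z).sub_right
    (Commute.one_right _)).smul_left _

/-- By the resolvent identity λR(λ)x lies in the range of R(z) for each λ = n + 1, and these vectors
converge to x. -/
theorem dense_range (h : IsHalfPlaneResolvent R M)
    (happ : ∀ x, Tendsto (fun n : ℕ => ((n + 1 : ℝ) : ℂ) • R ((n + 1 : ℝ) : ℂ) x) atTop (𝓝 x))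
    {z : ℂ} (hz : 0 < z.re) : Dense (range (R z)) := by
  intro x
  refine mem_closure_of_tendsto (happ x) (Eventually.of_forall fun n => ?_)
  have h1 := h.sub_eq z _ hz (natCast_re_pos n)
  refine ⟨((n + 1 : ℝ) : ℂ) • (x - (((n + 1 : ℝ) : ℂ) - z) • R ((n + 1 : ℝ) : ℂ) x), ?_⟩
  have h2 : R z x - R ((n + 1 : ℝ) : ℂ) x =
      (((n + 1 : ℝ) : ℂ) - z) • R z (R ((n + 1 : ℝ) : ℂ) x) := congrArg (fun S => S x) h1
  rw [map_smul, map_sub, map_smul, ← h2]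
  congr 1
  abel

theorem tendsto_yosida_apply (h : IsHalfPlaneResolvent R M)
    (happ : ∀ x, Tendsto (fun n : ℕ => ((n + 1 : ℝ) : ℂ) • R ((n + 1 : ℝ) : ℂ) x) atTop (𝓝 x))
    {z : ℂ} (hz : 0 < z.re) (y : X) :
    Tendsto (fun n => yosida R n (R z y)) atTop (𝓝 ((z • R z - 1) y)) := by
  refine (happ ((z • R z - 1) y)).congr fun n => ?_
  have := congrArg (fun S => S y) (h.yosida_mul n hz)
  exact this.symm

theorem commute_yosidaExp_yosida (R : ℂ → X →L[ℂ] X) (n : ℕ) (t : ℝ) :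
    Commute (yosidaExp R n t) (yosida R n) :=
  commute_exp_smul (Commute.refl _) _

variable [CompleteSpace X]

theorem norm_yosidaExp_le (h : IsHalfPlaneResolvent R M) (n : ℕ) {t : ℝ} (ht : 0 ≤ t) :
    ‖yosidaExp R n t‖ ≤ 18 * (M + 1) ^ 3 := by
  have hn : (0 : ℝ) < n + 1 := by positivity
  have := norm_exp_smul_sub_one_le (P := ((n + 1 : ℝ) : ℂ) • R ((n + 1 : ℝ) : ℂ))
    (fun k => h.norm_smul_pow_le ContinuousLinearMap.norm_id_le hn k)
    (s := t * (n + 1)) (by positivity)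
  rw [yosidaExp, yosida, smul_smul]
  rwa [Complex.ofReal_mul] at this

theorem norm_yosida_mul_exp_le (h : IsHalfPlaneResolvent R M) (n : ℕ) {t : ℝ} (ht : 0 < t) :
    ‖yosida R n * yosidaExp R n t‖ ≤ 18 * (M + 1) ^ 3 / t := by
  have hM := h.bound_nonneg
  have hn : (0 : ℝ) < n + 1 := by positivity
  have := norm_sub_one_mul_exp_le (P := ((n + 1 : ℝ) : ℂ) • R ((n + 1 : ℝ) : ℂ)) (by positivity)
    (fun k => h.norm_sub_one_mul_smul_pow_le ContinuousLinearMap.norm_id_le hn k)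
    (s := t * (n + 1)) (by positivity)
  rw [Complex.ofReal_mul] at this
  rw [yosidaExp, yosida, smul_smul, smul_mul_assoc, norm_smul, Complex.norm_real,
    Real.norm_of_nonneg hn.le]
  calc _ ≤ (n + 1 : ℝ) * (18 * (M + 1) ^ 3 / (t * (n + 1))) := by gcongr
    _ = _ := by field_simp

theorem hasDerivAt_yosidaExp (R : ℂ → X →L[ℂ] X) (n : ℕ) (t : ℝ) :
    HasDerivAt (yosidaExp R n) (yosida R n * yosidaExp R n t) t :=
  hasDerivAt_exp_ofReal_smul (𝔸 := X →L[ℂ] X) (yosida R n) t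

theorem yosidaExp_add (R : ℂ → X →L[ℂ] X) (n : ℕ) (s t : ℝ) :
    yosidaExp R n (s + t) = yosidaExp R n s * yosidaExp R n t :=
  exp_ofReal_add_smul (𝔸 := X →L[ℂ] X) (yosida R n) s t

theorem continuous_yosidaExp (R : ℂ → X →L[ℂ] X) (n : ℕ) : Continuous (yosidaExp R n) :=
  continuous_iff_continuousAt.mpr fun t => (hasDerivAt_yosidaExp R n t).continuousAt

/-- On the dense range of R(1) the generators Aₙ converge, and exp(tAₙ) - exp(tAₘ) is controlled by
Aₙ - Aₘ there; the uniform bound carries the convergence to all vectors. -/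
theorem exists_limit (h : IsHalfPlaneResolvent R M)
    (happ : ∀ x, Tendsto (fun n : ℕ => ((n + 1 : ℝ) : ℂ) • R ((n + 1 : ℝ) : ℂ) x) atTop (𝓝 x))
    {t : ℝ} (ht : 0 ≤ t) : ∃ T : X →L[ℂ] X, ‖T‖ ≤ 18 * (M + 1) ^ 3 ∧
      ∀ x, Tendsto (fun n => yosidaExp R n t x) atTop (𝓝 (T x)) := by
  have hM := h.bound_nonneg
  have h1 : 0 < (1 : ℂ).re := by simp
  refine exists_strong_limit (fun n => h.norm_yosidaExp_le n ht) (h.dense_range happ h1) ?_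
  rintro _ ⟨y, rfl⟩
  have hc := (h.tendsto_yosida_apply happ h1 y).cauchySeq
  rw [Metric.cauchySeq_iff'] at hc ⊢
  intro ε hε
  set K := 18 * (M + 1) ^ 3 with hK
  have hK0 : 0 < K * K * t + 1 := by positivity
  obtain ⟨N, hN⟩ := hc (ε / (K * K * t + 1)) (by positivity)
  refine ⟨N, fun n hn => ?_⟩
  have h2 := hN n hn
  rw [dist_eq_norm] at h2 ⊢
  have h3 := norm_exp_sub_exp_apply_le (h.commute_yosida_yosida n N)
    (fun t ht => h.norm_yosidaExp_le n ht) (fun t ht => h.norm_yosidaExp_le N ht) ht (R 1 y)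
  rw [lt_div_iff₀ hK0] at h2
  refine h3.trans_lt (lt_of_le_of_lt ?_ h2)
  nlinarith [norm_nonneg (yosida R n (R 1 y) - yosida R N (R 1 y))]

/-- On the range of R(1) one has Aₙ exp(tAₙ) = exp(tAₙ)Aₙ with both factors converging strongly.
Ritt's bound K/t extends this to all vectors, which is where analyticity enters. -/
theorem exists_limit_deriv (h : IsHalfPlaneResolvent R M)
    (happ : ∀ x, Tendsto (fun n : ℕ => ((n + 1 : ℝ) : ℂ) • R ((n + 1 : ℝ) : ℂ) x) atTop (𝓝 x))
    {t : ℝ} (ht : 0 < t) : ∃ D : X →L[ℂ] X, ‖D‖ ≤ 18 * (M + 1) ^ 3 / t ∧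
      ∀ x, Tendsto (fun n => (yosida R n * yosidaExp R n t) x) atTop (𝓝 (D x)) := by
  have h1 : 0 < (1 : ℂ).re := by simp
  refine exists_strong_limit (fun n => h.norm_yosida_mul_exp_le n ht) (h.dense_range happ h1) ?_
  rintro _ ⟨y, rfl⟩
  obtain ⟨T, _, hT⟩ := h.exists_limit happ ht.le
  have := tendsto_apply_of_norm_le (fun n => h.norm_yosidaExp_le n ht.le) hT
    (h.tendsto_yosida_apply happ h1 y)
  refine Tendsto.cauchySeq (this.congr fun n => ?_)
  rw [← (commute_yosidaExp_yosida R n t).eq]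
  rfl

theorem exists_analyticSemigroup (h : IsHalfPlaneResolvent R M)
    (happ : ∀ x, Tendsto (fun n : ℕ => ((n + 1 : ℝ) : ℂ) • R ((n + 1 : ℝ) : ℂ) x) atTop (𝓝 x)) :
    ∃ T D : ℝ → X →L[ℂ] X, IsAnalyticSemigroup R 0 T D := by
  have hM := h.bound_nonneg
  set K := 18 * (M + 1) ^ 3 with hK
  have hK0 : 0 ≤ K := by positivity
  -- The limit is taken only for t ≥ 0, and for D only for t > 0; elsewhere the value is 0.
  have hTex : ∀ t : ℝ, ∃ T : X →L[ℂ] X, 0 ≤ t → ‖T‖ ≤ K ∧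
      ∀ x, Tendsto (fun n => yosidaExp R n t x) atTop (𝓝 (T x)) := fun t => by
    by_cases ht : 0 ≤ t
    · obtain ⟨T, hT⟩ := h.exists_limit happ ht
      exact ⟨T, fun _ => hT⟩
    · exact ⟨0, fun h0 => (ht h0).elim⟩
  have hDex : ∀ t : ℝ, ∃ D : X →L[ℂ] X, 0 < t → ‖D‖ ≤ K / t ∧
      ∀ x, Tendsto (fun n => (yosida R n * yosidaExp R n t) x) atTop (𝓝 (D x)) := fun t => by
    by_cases ht : 0 < t
    · obtain ⟨T, hT⟩ := h.exists_limit_deriv happ ht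
      exact ⟨T, fun _ => hT⟩
    · exact ⟨0, fun h0 => (ht h0).elim⟩
  choose T hT using hTex
  choose D hD using hDex
  have hlim : ∀ {t : ℝ}, 0 ≤ t → ∀ {y : ℕ → X} {x : X}, Tendsto y atTop (𝓝 x) →
      Tendsto (fun n => yosidaExp R n t (y n)) atTop (𝓝 (T t x)) := fun ht _ _ hy =>
    tendsto_apply_of_norm_le (fun n => h.norm_yosidaExp_le n ht) (hT _ ht).2 hy
  have hzero : T 0 = 1 := by
    ext x
    refine tendsto_nhds_unique ((hT 0 le_rfl).2 x) ?_
    have : ∀ n, yosidaExp R n 0 x = x := fun n => by simp [yosidaExp]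
    simp only [this]
    exact tendsto_const_nhds
  have hadd : ∀ s t : ℝ, 0 ≤ s → 0 ≤ t → T (s + t) = T s * T t := by
    intro s t hs ht
    ext x
    refine tendsto_nhds_unique ((hT _ (add_nonneg hs ht)).2 x) ?_
    refine (hlim hs ((hT t ht).2 x)).congr fun n => ?_
    rw [yosidaExp_add]
    rfl
  have hDadd : ∀ s t : ℝ, 0 ≤ s → 0 < t → D (s + t) = T s * D t := by
    intro s t hs ht
    ext x
    refine tendsto_nhds_unique ((hD _ (add_pos_of_nonneg_of_pos hs ht)).2 x) ?_
    refine (hlim hs ((hD t ht).2 x)).congr fun n => ?_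
    have : yosida R n * yosidaExp R n (s + t) =
        yosidaExp R n s * (yosida R n * yosidaExp R n t) := by
      rw [← mul_assoc, (commute_yosidaExp_yosida R n s).eq, mul_assoc]
      congr 1
      exact yosidaExp_add R n s t
    rw [this]
    rfl
  -- The fundamental theorem for the approximations passes to the limit by dominated convergence,
  -- with the bound K/s on [s, t].
  have hsub : ∀ s t : ℝ, 0 < s → s ≤ t → ∀ x,
      IntervalIntegrable (fun q => D q x) volume s t ∧
        T t x - T s x = ∫ q in s..t, D q x := by
    intro s t hs hst x
    have hpos : ∀ q ∈ uIoc s t, 0 < q := fun q hq => by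
      rw [uIoc_of_le hst] at hq; exact hs.trans hq.1
    have hcont : ∀ n, Continuous fun q => (yosida R n * yosidaExp R n q) x := fun n =>
      (continuous_const.mul (continuous_yosidaExp R n)).clm_apply continuous_const
    have hlimD : ∀ q ∈ uIoc s t, Tendsto (fun n => (yosida R n * yosidaExp R n q) x) atTop
        (𝓝 (D q x)) := fun q hq => (hD q (hpos q hq)).2 x
    have hbd : ∀ n, ∀ q ∈ uIoc s t, ‖(yosida R n * yosidaExp R n q) x‖ ≤ K / s * ‖x‖ := by
      intro n q hq
      refine ContinuousLinearMap.le_of_opNorm_le _ ?_ x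
      refine (h.norm_yosida_mul_exp_le n (hpos q hq)).trans ?_
      rw [uIoc_of_le hst] at hq
      have := hq.1
      gcongr
    constructor
    · refine (intervalIntegrable_const (c := K / s * ‖x‖)).mono_fun' ?_ ?_
      · exact aestronglyMeasurable_of_tendsto_ae atTop
          (fun n => (hcont n).aestronglyMeasurable)
          ((ae_restrict_iff' measurableSet_uIoc).mpr (Eventually.of_forall hlimD))
      · refine (ae_restrict_iff' measurableSet_uIoc).mpr (Eventually.of_forall fun q hq => ?_)
        exact le_of_tendsto (hlimD q hq).norm (Eventually.of_forall fun n => hbd n q hq)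
    · have h1 : Tendsto (fun n => ∫ q in s..t, (yosida R n * yosidaExp R n q) x) atTop
          (𝓝 (∫ q in s..t, D q x)) := by
        refine intervalIntegral.tendsto_integral_filter_of_dominated_convergence
          (fun _ => K / s * ‖x‖) (Eventually.of_forall fun n => (hcont n).aestronglyMeasurable)
          (Eventually.of_forall fun n => Eventually.of_forall (hbd n)) (by simp)
          (Eventually.of_forall hlimD)
      have h2 : Tendsto (fun n => yosidaExp R n t x - yosidaExp R n s x) atTop
          (𝓝 (T t x - T s x)) :=
        ((hT t (hs.le.trans hst)).2 x).sub ((hT s hs.le).2 x)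
      refine tendsto_nhds_unique h2 (h1.congr fun n => ?_)
      refine intervalIntegral.integral_eq_sub_of_hasDerivAt
        (f := fun q => yosidaExp R n q x) (fun q _ => ?_)
        ((hcont n).intervalIntegrable _ _)
      simpa using hasDerivAt_clm_apply (hasDerivAt_yosidaExp R n q) (hasDerivAt_const q x)
  have hlip : ∀ s t : ℝ, 0 < s → s ≤ t → ‖T t - T s‖ ≤ K / s * (t - s) := by
    intro s t hs hst
    refine ContinuousLinearMap.opNorm_le_bound _
      (mul_nonneg (by positivity) (by linarith)) fun x => ?_
    rw [sub_apply, (hsub s t hs hst x).2]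
    have := intervalIntegral.norm_integral_le_of_norm_le_const (a := s) (b := t)
      (f := fun q => D q x) (C := K / s * ‖x‖) fun q hq => by
        rw [uIoc_of_le hst] at hq
        refine ContinuousLinearMap.le_of_opNorm_le _ ((hD q (hs.trans hq.1)).1.trans ?_) x
        have := hq.1
        gcongr
    rw [abs_of_nonneg (by linarith)] at this
    linarith
  have hTcont : ContinuousOn T (Ioi 0) := by
    intro t ht
    have ht' : 0 < t := ht
    refine ContinuousAt.continuousWithinAt ?_
    rw [ContinuousAt, tendsto_iff_norm_sub_tendsto_zero]
    refine squeeze_zero' (g := fun s => K / (t / 2) * |s - t|)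
      (Eventually.of_forall fun _ => norm_nonneg _) ?_ ?_
    · filter_upwards [Ioi_mem_nhds (by linarith : t / 2 < t)] with s hs
      have hs' : t / 2 < s := hs
      rcases le_total s t with hst | hst
      · rw [norm_sub_rev, abs_of_nonpos (by linarith), neg_sub]
        refine (hlip s t (by linarith) hst).trans ?_
        gcongr
      · rw [abs_of_nonneg (by linarith)]
        refine (hlip t s ht' hst).trans ?_
        gcongr
        linarith
    · have : Continuous fun s => K / (t / 2) * |s - t| := by fun_prop
      simpa using this.tendsto t
  -- Near t one has D(s) = T(s - t/2) D(t/2), so continuity of D in operator norm follows from that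
  -- of T at t/2.
  have hDcont : ContinuousOn D (Ioi 0) := by
    intro t ht
    have ht' : 0 < t := ht
    refine ContinuousAt.continuousWithinAt ?_
    have h1 : ContinuousAt (fun s => T (s - t / 2) * D (t / 2)) t := by
      refine ContinuousAt.mul ?_ continuousAt_const
      have h2 : ContinuousAt T (t - t / 2) :=
        hTcont.continuousAt (Ioi_mem_nhds (by linarith))
      exact ContinuousAt.comp (g := T) (f := fun s => s - t / 2) h2 (by fun_prop)
    refine h1.congr ?_
    filter_upwards [Ioi_mem_nhds (by linarith : t / 2 < t)] with s hs
    have hs' : t / 2 < s := hs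
    rw [← hDadd _ _ (by linarith) (by linarith), sub_add_cancel]
  refine ⟨T, D, hzero, hadd, ?_, ?_, ?_, hDcont, ?_, ?_⟩
  · intro x
    -- Continuity up to t = 0: orbits starting in the range of R(1) are Lipschitz on [0, ∞), since
    -- ‖Aₙ R(1) y‖ is bounded in n, and by density they approximate every orbit uniformly.
    refine continuousOn_of_uniform_approx_of_continuousOn fun u hu => ?_
    obtain ⟨ε, hε, hεu⟩ := Metric.mem_uniformity_dist.mp hu
    have hK1 : 0 < K + 1 := by positivity
    obtain ⟨_, hy, y, rfl⟩ := Metric.dense_iff.mp (h.dense_range happ (z := 1) (by simp)) x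
      (ε / (K + 1)) (by positivity)
    refine ⟨fun t => T t (R 1 y), ?_, fun t ht => hεu ?_⟩
    · have hJ : ∀ n, ‖yosida R n (R 1 y)‖ ≤ K * ‖((1 : ℂ) • R 1 - 1) y‖ := by
        intro n
        have e := congrArg (fun S => S y) (h.yosida_mul n (z := 1) (by simp))
        have e' : yosida R n (R 1 y) = (((n + 1 : ℝ) : ℂ) • R ((n + 1 : ℝ) : ℂ))
          (((1 : ℂ) • R 1 - 1) y) := e
        rw [e']
        refine ContinuousLinearMap.le_of_opNorm_le _ ?_ _
        simpa using h.norm_smul_pow_le ContinuousLinearMap.norm_id_le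
          (l := n + 1) (by positivity) 1
      set K' := K * (K * ‖((1 : ℂ) • R 1 - 1) y‖) with hK'
      have hl : ∀ s ∈ Ici (0 : ℝ), ∀ t ∈ Ici (0 : ℝ), s ≤ t →
          ‖T t (R 1 y) - T s (R 1 y)‖ ≤ K' * (t - s) := by
        intro s hs t ht hst
        refine le_of_tendsto (((hT t ht).2 _).sub ((hT s hs).2 _)).norm
          (Eventually.of_forall fun n => ?_)
        refine norm_image_sub_le_of_norm_deriv_le_segment' (a := s) (b := t)
          (f := fun q => yosidaExp R n q (R 1 y))
          (f' := fun q => yosidaExp R n q (yosida R n (R 1 y))) (fun q _ => ?_) (fun q hq => ?_)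
          t ⟨hst, le_rfl⟩
        · have := hasDerivAt_clm_apply (hasDerivAt_yosidaExp R n q) (hasDerivAt_const q (R 1 y))
          rw [← (commute_yosidaExp_yosida R n q).eq, map_zero, add_zero] at this
          exact this.hasDerivWithinAt
        · refine (ContinuousLinearMap.le_of_opNorm_le _
            (h.norm_yosidaExp_le n (le_trans hs hq.1)) _).trans ?_
          exact mul_le_mul_of_nonneg_left (hJ n) hK0
      have hK'0 : 0 ≤ K' := by positivity
      refine (LipschitzOnWith.of_dist_le_mul (K := K'.toNNReal) fun t ht s hs => ?_).continuousOn
      rw [dist_eq_norm, Real.dist_eq, Real.coe_toNNReal _ hK'0]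
      rcases le_total s t with hst | hst
      · rw [abs_of_nonneg (by linarith)]
        exact hl s hs t ht hst
      · rw [norm_sub_rev, abs_of_nonpos (by linarith), neg_sub]
        exact hl t ht s hs hst
    · rw [dist_eq_norm, ← map_sub]
      refine (ContinuousLinearMap.le_of_opNorm_le _ (hT t ht).1 _).trans_lt ?_
      have hy' : ‖x - R 1 y‖ < ε / (K + 1) := by rw [← dist_eq_norm, dist_comm]; exact hy
      rw [lt_div_iff₀ hK1] at hy'
      nlinarith [norm_nonneg (x - R 1 y)]
  · intro τ
    refine ⟨K, hK0, fun t ht _ => ⟨(hT t ht).1, ?_⟩⟩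
    rcases ht.eq_or_lt with rfl | ht
    · simpa using hK0
    · have := (hD t ht).1
      rw [le_div_iff₀ ht] at this
      linarith
  · intro t ht
    -- As D is norm-continuous away from 0, T is a norm primitive of D starting from t/2.
    have hi : ∀ s, t / 2 ≤ s → IntervalIntegrable D volume (t / 2) s := fun s hs =>
      (hDcont.mono fun q hq => by
        rw [uIcc_of_le hs] at hq
        exact lt_of_lt_of_le (by linarith) hq.1).intervalIntegrable
    have h1 : HasDerivAt (fun s => T (t / 2) + ∫ q in (t / 2)..s, D q) (D t) t := by
      refine (intervalIntegral.integral_hasDerivAt_right (hi t (by linarith)) ?_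
        (hDcont.continuousAt (Ioi_mem_nhds ht))).const_add _
      exact hDcont.stronglyMeasurableAtFilter isOpen_Ioi t ht
    refine h1.congr_of_eventuallyEq ?_
    filter_upwards [Ioi_mem_nhds (by linarith : t / 2 < t)] with s hs
    have hs' : t / 2 < s := hs
    ext x
    rw [add_apply, ContinuousLinearMap.intervalIntegral_apply (hi s hs'.le),
      ← (hsub (t / 2) s (by linarith) hs'.le x).2]
    abel
  · intro t ht z hz
    ext x
    refine tendsto_nhds_unique ((hT t ht).2 (R z x)) ?_
    refine (((R z).continuous.tendsto _).comp ((hT t ht).2 x)).congr fun n => ?_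
    have := (commute_exp_smul (h.commute_yosida n hz) (t : ℂ)).eq
    exact (congrArg (fun S => S x) this).symm
  · intro t ht z hz
    ext x
    refine tendsto_nhds_unique (((R z).continuous.tendsto _).comp ((hD t ht).2 x)) ?_
    -- The limit is taken in R(z) Aₙ exp(tAₙ) = (zR(z) - 1) nR(n) exp(tAₙ), where nR(n) tends
    -- strongly to 1.
    have h1 : Tendsto (fun n : ℕ => (((n + 1 : ℝ) : ℂ) • R ((n + 1 : ℝ) : ℂ))
        (yosidaExp R n t x)) atTop (𝓝 (T t x)) := by
      refine tendsto_apply_of_norm_le (T := 1) (K := 18 * (M + 1) ^ 3) (fun n => ?_) happ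
        ((hT t ht.le).2 x)
      simpa using h.norm_smul_pow_le ContinuousLinearMap.norm_id_le
          (l := n + 1) (by positivity) 1
    refine (((z • R z - 1).continuous.tendsto _).comp h1).congr fun n => ?_
    have := congrArg (fun S => S (yosidaExp R n t x)) (h.yosida_mul_comm n hz)
    exact this.symm

end IsHalfPlaneResolvent

end Generation

/-! ### Inhomogeneous problems for analytic semigroups -/

section Inhomogeneous

/-- Fubini on the triangle 0 < s < q < t, with the inner integrals extended to (0, t] by an
indicator function. -/
theorem integral_integral_triangle {E : Type*} [NormedAddCommGroup E] [NormedSpace ℝ E]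
    {φ : ℝ → ℝ → E} (hφ : Continuous (Function.uncurry φ)) {t : ℝ} (ht : 0 ≤ t) :
    ∫ s in (0 : ℝ)..t, ∫ q in s..t, φ s q = ∫ q in (0 : ℝ)..t, ∫ s in (0 : ℝ)..q, φ s q := by
  set ψ : ℝ → ℝ → E := fun s q => {p : ℝ × ℝ | p.1 < p.2}.indicator (Function.uncurry φ) (s, q)
    with hψ
  have hm : MeasurableSet {p : ℝ × ℝ | p.1 < p.2} := measurableSet_lt measurable_fst measurable_snd
  have e1 : ∀ s ∈ uIcc 0 t, ∫ q in s..t, φ s q = ∫ q in (0 : ℝ)..t, ψ s q := by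
    intro s hs
    rw [uIcc_of_le ht] at hs
    rw [intervalIntegral.integral_of_le hs.2, intervalIntegral.integral_of_le ht,
      ← integral_indicator measurableSet_Ioc, ← integral_indicator measurableSet_Ioc]
    congr 1
    ext q
    by_cases hq : s < q
    · have h0 : 0 < q := hs.1.trans_lt hq
      simp [indicator, hψ, hq, h0]
    · simp [indicator, hψ, hq]
  have e2 : ∀ q ∈ uIcc 0 t, ∫ s in (0 : ℝ)..q, φ s q = ∫ s in (0 : ℝ)..t, ψ s q := by
    intro q hq
    rw [uIcc_of_le ht] at hq
    rw [intervalIntegral.integral_of_le hq.1, intervalIntegral.integral_of_le ht,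
      integral_Ioc_eq_integral_Ioo, integral_Ioc_eq_integral_Ioo,
      ← integral_indicator measurableSet_Ioo, ← integral_indicator measurableSet_Ioo]
    congr 1
    ext s
    by_cases hs : s < q
    · have h0 : s < t := hs.trans_le hq.2
      simp [indicator, hψ, hs, h0]
    · simp [indicator, hψ, hs]
  rw [intervalIntegral.integral_congr e1, intervalIntegral.integral_congr e2]
  refine intervalIntegral_intervalIntegral_swap ?_
  have hc : IntegrableOn (Function.uncurry φ) (uIcc 0 t ×ˢ uIcc 0 t) (volume.prod volume) :=
    hφ.continuousOn.integrableOn_compact (isCompact_uIcc.prod isCompact_uIcc)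
  exact (hc.mono_set (prod_mono uIoc_subset_uIcc uIoc_subset_uIcc)).indicator hm

namespace IsAnalyticSemigroup

variable {X : Type*} [NormedAddCommGroup X] [NormedSpace ℂ X]
variable {R : ℂ → X →L[ℂ] X} {a : ℝ} {T D : ℝ → X →L[ℂ] X} {l : ℂ}

/-- Strong continuity and local boundedness give joint continuity. Cutting time off at 0 makes the
map continuous on all of ℝ, so that integrands need no side conditions. -/
theorem continuous_apply (h : IsAnalyticSemigroup R a T D) :
    Continuous fun p : ℝ × X => T (max p.1 0) p.2 := by
  rw [continuous_iff_continuousAt]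
  rintro ⟨t, x⟩
  obtain ⟨C, hC, hb⟩ := h.bound (max t 0 + 1)
  have h1 : Continuous fun s : ℝ => T (max s 0) x :=
    (h.cont x).comp_continuous (by fun_prop) fun s => le_max_right s 0
  have h2 : Tendsto (fun p : ℝ × X => T (max p.1 0) (p.2 - x)) (𝓝 (t, x)) (𝓝 0) := by
    have hev : ∀ᶠ p : ℝ × X in 𝓝 (t, x), max p.1 0 < max t 0 + 1 :=
      (isOpen_lt (by fun_prop : Continuous fun p : ℝ × X => max p.1 0) continuous_const).mem_nhds
        (lt_add_one (max t 0))
    refine squeeze_zero_norm' (a := fun p : ℝ × X => C * ‖p.2 - x‖) ?_ ?_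
    · filter_upwards [hev] with p hp
      exact ContinuousLinearMap.le_of_opNorm_le _ (hb _ (le_max_right _ _) hp.le).1 _
    · have : Continuous fun p : ℝ × X => C * ‖p.2 - x‖ := by fun_prop
      simpa using this.tendsto (t, x)
  have h3 : Tendsto (fun p : ℝ × X => T (max p.1 0) x) (𝓝 (t, x)) (𝓝 (T (max t 0) x)) :=
    (h1.comp continuous_fst).tendsto (t, x)
  have h4 := h2.add h3
  rw [zero_add] at h4
  refine h4.congr fun p => ?_
  rw [← map_add, sub_add_cancel]

theorem continuous_comp (h : IsAnalyticSemigroup R a T D) {Y : Type*} [TopologicalSpace Y]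
    {f : Y → ℝ} {g : Y → X} (hf : Continuous f) (hg : Continuous g) :
    Continuous fun y => T (max (f y) 0) (g y) :=
  h.continuous_apply.comp (hf.prodMk hg)

theorem commute_deriv (h : IsAnalyticSemigroup R a T D) {t : ℝ} (ht : 0 < t) (hl : a < l.re) :
    Commute (D t) (R l) := by
  have h1 := (h.hasDerivAt t ht).mul (hasDerivAt_const t (R l))
  have h2 := (hasDerivAt_const t (R l)).mul (h.hasDerivAt t ht)
  rw [mul_zero, add_zero] at h1
  rw [zero_mul, zero_add] at h2
  refine h1.unique (h2.congr_of_eventuallyEq ?_)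
  filter_upwards [Ioi_mem_nhds ht] with s hs
  exact (h.commute s (le_of_lt hs) l hl).eq

/-- The generator falls on R(l)x, which lies in its domain; the singularity of D at t = 0
disappears. -/
theorem deriv_resolvent (h : IsAnalyticSemigroup R a T D) {t : ℝ} (ht : 0 < t) (hl : a < l.re)
    (x : X) : D t (R l x) = T t ((l • R l - 1) x) := by
  have h1 := congrArg (fun S => S x) (h.commute_deriv ht hl).eq
  have h2 := congrArg (fun S => S x) (h.resolvent_mul t ht l hl)
  have h3 : Commute (l • R l - 1) (T t) :=
    ((h.commute t ht.le l hl).symm.smul_left l).sub_left (Commute.one_left _)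
  exact h1.trans (h2.trans (congrArg (fun S => S x) h3.eq))

theorem continuous_duhamel (h : IsAnalyticSemigroup R a T D) {f : ℝ → X} (hf : Continuous f) :
    Continuous fun t => ∫ s in (0 : ℝ)..t, T (max (t - s) 0) (f s) :=
  intervalIntegral.continuous_parametric_intervalIntegral_of_continuous
    (f := fun t s => T (max (t - s) 0) (f s)) (a₀ := 0)
    (h.continuous_comp (by fun_prop) (hf.comp continuous_snd)) continuous_id

variable [CompleteSpace X]

/-- The semigroup solves the homogeneous problem. -/
theorem apply_resolvent_sub (h : IsAnalyticSemigroup R a T D) (hl : a < l.re) {t : ℝ} (ht : 0 ≤ t)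
    (x : X) : T t (R l x) - R l x = ∫ s in (0 : ℝ)..t, T (max s 0) ((l • R l - 1) x) := by
  have hc : Continuous fun s : ℝ => T (max s 0) (R l x) :=
    h.continuous_comp continuous_id continuous_const
  have hc' : Continuous fun s : ℝ => T (max s 0) ((l • R l - 1) x) :=
    h.continuous_comp continuous_id continuous_const
  rw [intervalIntegral.integral_eq_sub_of_hasDerivAt_of_le ht hc.continuousOn (fun s hs => ?_)
    (hc'.intervalIntegrable _ _)]
  · simp [ht, h.zero]
  · have h1 : HasDerivAt (fun s => T s (R l x)) (D s (R l x)) s := by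
      simpa using hasDerivAt_clm_apply (h.hasDerivAt s hs.1) (hasDerivAt_const s (R l x))
    rw [h.deriv_resolvent hs.1 hl] at h1
    rw [max_eq_left hs.1.le]
    refine h1.congr_of_eventuallyEq ?_
    filter_upwards [Ioi_mem_nhds hs.1] with q hq
    rw [max_eq_left (le_of_lt hq)]

theorem resolvent_apply (h : IsAnalyticSemigroup R a T D) (hl : a < l.re) {t : ℝ} (ht : 0 ≤ t)
    (x : X) : R l (T t x) = R l x + ∫ s in (0 : ℝ)..t, (l • R l - 1) (T (max s 0) x) := by
  have h1 := congrArg (fun S => S x) (h.commute t ht l hl).eq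
  have h2 : T t (R l x) = R l (T t x) := h1
  rw [← h2, ← sub_eq_iff_eq_add', h.apply_resolvent_sub hl ht]
  refine intervalIntegral.integral_congr fun s _ => ?_
  have h3 : Commute (T (max s 0)) (l • R l - 1) :=
    ((h.commute _ (le_max_right s 0) l hl).smul_right l).sub_right (Commute.one_right _)
  exact congrArg (fun S => S x) h3.eq

/-- Solutions of the resolved inhomogeneous problem are given by Duhamel's formula. -/
theorem duhamel_of_integral_eq (h : IsAnalyticSemigroup R a T D) (hl : a < l.re) {τ : ℝ}
    {V f : ℝ → X} {y : X} (hV : Continuous V) (hf : Continuous f)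
    (hsol : ∀ t ∈ Icc 0 τ, R l (V t) = y + (∫ s in (0 : ℝ)..t, (l • R l - 1) (V s))
      + ∫ s in (0 : ℝ)..t, f s) {t : ℝ} (ht : t ∈ Icc 0 τ) :
    R l (V t) = T t y + ∫ s in (0 : ℝ)..t, T (max (t - s) 0) (f s) := by
  have hV' : Continuous fun s => (l • R l - 1) (V s) := (l • R l - 1).continuous.comp hV
  -- The right-hand side is differentiable on the whole line; it equals R(l)V only on [0, τ].
  set u : ℝ → X := fun t => y + (∫ s in (0 : ℝ)..t, (l • R l - 1) (V s))
    + ∫ s in (0 : ℝ)..t, f s with hu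
  have hud : ∀ s, HasDerivAt u ((l • R l - 1) (V s) + f s) s := fun s =>
    ((hV'.integral_hasStrictDerivAt 0 s).hasDerivAt.const_add y).add
      (hf.integral_hasStrictDerivAt 0 s).hasDerivAt
  have huc : Continuous u := continuous_iff_continuousAt.mpr fun s => (hud s).continuousAt
  have hg : Continuous fun s => T (max (t - s) 0) (u s) :=
    h.continuous_comp (by fun_prop) huc
  have hg' : Continuous fun s => T (max (t - s) 0) (f s) :=
    h.continuous_comp (by fun_prop) hf
  have hFTC := intervalIntegral.integral_eq_sub_of_hasDerivAt_of_le ht.1 hg.continuousOn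
    (f' := fun s => T (max (t - s) 0) (f s)) (fun s hs => ?_) (hg'.intervalIntegrable _ _)
  · rw [hFTC, hsol t ht]
    simp [ht.1, h.zero, hu]
  · have hts : 0 < t - s := by linarith [hs.2]
    have h1 : HasDerivAt (fun s => T (t - s)) (-D (t - s)) s := by
      have := (h.hasDerivAt (t - s) hts).scomp s ((hasDerivAt_id s).const_sub t)
      rw [neg_smul, one_smul] at this
      exact this
    have h2 := hasDerivAt_clm_apply h1 (hud s)
    have hus : u s = R l (V s) := (hsol s ⟨hs.1.le, hs.2.le.trans ht.2⟩).symm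
    -- The derivative of T(t-s)u(s): the two terms with (lR(l) - 1)V(s) cancel and only the forcing
    -- remains.
    have e : (-D (t - s)) (u s) + T (t - s) ((l • R l - 1) (V s) + f s) =
        T (max (t - s) 0) (f s) := by
      rw [neg_apply, hus, h.deriv_resolvent hts hl, map_add, max_eq_left hts.le]
      abel
    rw [← e]
    refine h2.congr_of_eventuallyEq ?_
    filter_upwards [Iio_mem_nhds hs.2] with q hq
    have hq' : q < t := hq
    rw [max_eq_left (by linarith)]

/-- Duhamel's formula solves the resolved inhomogeneous problem. -/
theorem resolvent_duhamel (h : IsAnalyticSemigroup R a T D) (hl : a < l.re) {f : ℝ → X}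
    (hf : Continuous f) {t : ℝ} (ht : 0 ≤ t) :
    R l (∫ s in (0 : ℝ)..t, T (max (t - s) 0) (f s)) =
      (∫ q in (0 : ℝ)..t, (l • R l - 1) (∫ s in (0 : ℝ)..q, T (max (q - s) 0) (f s)))
      + ∫ s in (0 : ℝ)..t, R l (f s) := by
  have hc : ∀ q : ℝ, Continuous fun s => T (max (q - s) 0) (f s) := fun q =>
    h.continuous_comp (by fun_prop) hf
  have hφ : Continuous (Function.uncurry fun s q => (l • R l - 1) (T (max (q - s) 0) (f s))) :=
    (l • R l - 1).continuous.comp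
      (h.continuous_comp (Y := ℝ × ℝ) (f := fun p => p.2 - p.1) (g := fun p => f p.1)
        (by fun_prop) (hf.comp continuous_fst))
  rw [← ContinuousLinearMap.intervalIntegral_comp_comm _ ((hc t).intervalIntegrable _ _)]
  -- For each s the homogeneous equation is used for the orbit started at time s from f(s);
  -- exchanging the order of integration then recovers the Duhamel integral.
  have e1 : ∀ s ∈ uIcc 0 t, R l (T (max (t - s) 0) (f s)) =
      (∫ q in s..t, (l • R l - 1) (T (max (q - s) 0) (f s))) + R l (f s) := by
    intro s hs
    rw [uIcc_of_le ht] at hs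
    rw [h.resolvent_apply hl (le_max_right _ _), add_comm, max_eq_left (by linarith [hs.2])]
    congr 1
    have := intervalIntegral.integral_comp_sub_right
      (fun q => (l • R l - 1) (T (max q 0) (f s))) s (a := s) (b := t)
    rw [sub_self] at this
    exact this.symm
  rw [intervalIntegral.integral_congr e1, intervalIntegral.integral_add,
    integral_integral_triangle hφ ht]
  · congr 1
    refine intervalIntegral.integral_congr fun q _ => ?_
    exact ContinuousLinearMap.intervalIntegral_comp_comm _ ((hc q).intervalIntegrable _ _)
  · refine Continuous.intervalIntegrable ?_ _ _
    have : Continuous fun s => -∫ q in t..s, (l • R l - 1) (T (max (q - s) 0) (f s)) :=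
      (intervalIntegral.continuous_parametric_intervalIntegral_of_continuous (a₀ := t)
        hφ continuous_id).neg
    exact this.congr fun s => (intervalIntegral.integral_symm _ _).symm
  · exact ((R l).continuous.comp hf).intervalIntegrable _ _

end IsAnalyticSemigroup

end Inhomogeneous

/-! ### Resolvents of unbounded operators and of their parts -/

section OperatorResolvent

variable {E : Type*} [NormedAddCommGroup E] [NormedSpace ℂ E]

theorem isResolventAt_opResolvent {B : E →ₗ.[ℂ] E} {z : ℂ} (hz : z ∈ opResolventSet B) :
    IsResolventAt B z (opResolvent B z) := by
  rw [opResolvent, dif_pos hz]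
  exact hz.choose_spec

namespace IsResolventAt

variable {B : E →ₗ.[ℂ] E} {z u : ℂ} {R S : E →L[ℂ] E}

theorem apply_eq_iff (h : IsResolventAt B z R) {x y : E} :
    R (z • x - y) = x ↔ (x, y) ∈ B.graph := by
  rw [h, sub_sub_cancel]

theorem mem_graph (h : IsResolventAt B z R) (x : E) : (R x, z • R x - x) ∈ B.graph :=
  (h x _).mp rfl

theorem sub_eq (h : IsResolventAt B z R) (h' : IsResolventAt B u S) :
    R - S = (u - z) • (R * S) := by
  ext x
  have h1 := h.apply_eq_iff.mpr (h'.mem_graph x)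
  have h2 : z • S x - (u • S x - x) = x - (u - z) • S x := by module
  rw [h2, map_sub, map_smul] at h1
  change R x - S x = (u - z) • R (S x)
  rw [sub_eq_iff_eq_add', ← sub_eq_iff_eq_add]
  exact h1

theorem injective (h : IsResolventAt B z R) : Function.Injective R := by
  intro x y hxy
  have h1 := h.mem_graph x
  have h2 := h.mem_graph y
  rw [hxy] at h1
  simpa using B.mem_graph_snd_inj h1 h2 rfl

end IsResolventAt

theorem mem_graph_partInClosure {A : E →ₗ.[ℂ] E} {x y : domainClosure A} :
    (x, y) ∈ (partInClosure A).graph ↔ ((x : E), (y : E)) ∈ A.graph := by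
  rw [LinearPMap.mem_graph_iff, LinearPMap.mem_graph_iff]
  constructor
  · rintro ⟨v, rfl, rfl⟩
    exact ⟨⟨_, v.2.choose⟩, rfl, rfl⟩
  · rintro ⟨v, hv, hvy⟩
    simp only at hv hvy
    have hx : (x : E) ∈ A.domain := hv ▸ v.2
    have e : v = ⟨(x : E), hx⟩ := Subtype.ext hv
    subst e
    refine ⟨⟨x, hx, hvy ▸ y.2⟩, rfl, Subtype.ext hvy⟩

theorem opResolvent_mem_domainClosure (A : E →ₗ.[ℂ] E) (z : ℂ) (x : E) :
    opResolvent A z x ∈ domainClosure A := by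
  by_cases hz : z ∈ opResolventSet A
  · exact Submodule.le_topologicalClosure _
      (LinearPMap.mem_domain_of_mem_graph ((isResolventAt_opResolvent hz).mem_graph x))
  · rw [opResolvent, dif_neg hz]
    exact Submodule.zero_mem _

/-- The resolvent of `A` as an operator into the closure of the domain of `A`. -/
noncomputable def resolventToClosure (A : E →ₗ.[ℂ] E) (z : ℂ) : E →L[ℂ] domainClosure A :=
  (opResolvent A z).codRestrict (domainClosure A) (opResolvent_mem_domainClosure A z)

@[simp]
theorem coe_resolventToClosure (A : E →ₗ.[ℂ] E) (z : ℂ) (x : E) :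
    (resolventToClosure A z x : E) = opResolvent A z x := rfl

/-- The solution of zy - A₀y = x also solves zy - Ay = x, and that solution is unique. -/
theorem resolventToClosure_coe {A : E →ₗ.[ℂ] E} {z : ℂ} (hz : z ∈ opResolventSet A)
    (hz0 : z ∈ opResolventSet (partInClosure A)) (x : domainClosure A) :
    resolventToClosure A z x = opResolvent (partInClosure A) z x := by
  have h1 := mem_graph_partInClosure.mp ((isResolventAt_opResolvent hz0).mem_graph x)
  refine Subtype.ext ?_
  rw [coe_resolventToClosure]
  exact (isResolventAt_opResolvent hz x _).mpr h1

theorem norm_resolventToClosure_le (A : E →ₗ.[ℂ] E) (z : ℂ) :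
    ‖resolventToClosure A z‖ ≤ ‖opResolvent A z‖ :=
  ContinuousLinearMap.opNorm_le_bound _ (norm_nonneg _) fun x => (opResolvent A z).le_opNorm x

theorem resolventToClosure_sub {A : E →ₗ.[ℂ] E} {z u : ℂ} (hz : z ∈ opResolventSet A)
    (hu : u ∈ opResolventSet A) (x : E) :
    resolventToClosure A z x - resolventToClosure A u x =
      (u - z) • resolventToClosure A z (resolventToClosure A u x) := by
  have := (isResolventAt_opResolvent hz).sub_eq (isResolventAt_opResolvent hu)
  exact Subtype.ext (congrArg (fun S => S x) this)

end OperatorResolvent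

/-! ### The analytic semigroup generated by the part of A. -/

section PartSemigroup

variable {E : Type*} [NormedAddCommGroup E] [NormedSpace ℂ E]

theorem tendsto_norm_opResolvent {A : E →ₗ.[ℂ] E} {p : ℝ} (hp : 1 ≤ p)
    (hgrowth : ∃ C : ℝ, ∀ᶠ r : ℝ in atTop, r ^ (1 / p) * ‖opResolvent A (r : ℂ)‖ ≤ C) :
    Tendsto (fun r : ℝ => ‖opResolvent A (r : ℂ)‖) atTop (𝓝 0) := by
  obtain ⟨C, hC⟩ := hgrowth
  have h1 : Tendsto (fun r : ℝ => C * r ^ (-(1 / p))) atTop (𝓝 0) := by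
    simpa using (tendsto_rpow_neg_atTop (by positivity : 0 < 1 / p)).const_mul C
  refine squeeze_zero' (Eventually.of_forall fun _ => norm_nonneg _) ?_ h1
  filter_upwards [hC, eventually_gt_atTop 0] with r hr hr0
  rw [Real.rpow_neg hr0.le, ← div_eq_mul_inv, le_div_iff₀ (Real.rpow_pos_of_pos hr0 _), mul_comm]
  exact hr

/-- Rescaling by exp(wt) moves the vertex of the sector from 0 to w. -/
theorem IsAnalyticSemigroup.shift {X : Type*} [NormedAddCommGroup X] [NormedSpace ℂ X]
    {R : ℂ → X →L[ℂ] X} {w : ℝ} {T D : ℝ → X →L[ℂ] X}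
    (h : IsAnalyticSemigroup (fun z => R (z + w)) 0 T D) :
    IsAnalyticSemigroup R w (fun t => (Real.exp (w * t) : ℂ) • T t)
      (fun t => (Real.exp (w * t) : ℂ) • (D t + (w : ℂ) • T t)) := by
  have hexp : Continuous fun t : ℝ => (Real.exp (w * t) : ℂ) := by fun_prop
  have hTd : ∀ t, 0 < t → HasDerivAt (fun t : ℝ => (Real.exp (w * t) : ℂ) • T t)
      ((Real.exp (w * t) : ℂ) • (D t + (w : ℂ) • T t)) t := by
    intro t ht
    have h1 : HasDerivAt (fun t : ℝ => Real.exp (w * t) • T t)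
        (Real.exp (w * t) • D t + (Real.exp (w * t) * w) • T t) t := by
      have := ((hasDerivAt_id t).const_mul w).exp.smul (h.hasDerivAt t ht)
      simp only [id_eq, mul_one] at this
      exact this
    have e : ∀ (c : ℝ) (S : X →L[ℂ] X), (c : ℂ) • S = c • S := fun c S => Complex.coe_smul c S
    simp only [e, smul_add, smul_smul]
    exact h1
  have hshift : ∀ z : ℂ, z - w + w = z := fun z => sub_add_cancel z (w : ℂ)
  refine ⟨by simp [h.zero], ?_, ?_, ?_, hTd, ?_, ?_, ?_⟩
  · intro s t hs ht
    rw [h.add s t hs ht, smul_mul_smul_comm, mul_add, Real.exp_add]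
    push_cast
    rfl
  · intro x
    exact hexp.continuousOn.smul (h.cont x)
  · intro τ
    obtain ⟨C, hC, hb⟩ := h.bound τ
    refine ⟨Real.exp (|w| * |τ|) * (C + |τ| * |w| * C), by positivity, fun t ht htτ => ?_⟩
    have hτ : 0 ≤ τ := ht.trans htτ
    obtain ⟨h1, h2⟩ := hb t ht htτ
    have h3 : Real.exp (w * t) ≤ Real.exp (|w| * |τ|) := by
      rw [Real.exp_le_exp, abs_of_nonneg hτ]
      exact mul_le_mul (le_abs_self w) htτ ht (abs_nonneg w)
    have hn : ‖((Real.exp (w * t) : ℝ) : ℂ)‖ = Real.exp (w * t) := by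
      rw [Complex.norm_real, Real.norm_of_nonneg (Real.exp_pos _).le]
    have hCle : C ≤ C + |τ| * |w| * C := le_add_of_nonneg_right (by positivity)
    constructor
    · rw [norm_smul, hn]
      gcongr
      exact h1.trans hCle
    · rw [norm_smul, hn]
      calc t * (Real.exp (w * t) * ‖D t + (w : ℂ) • T t‖)
          = Real.exp (w * t) * (t * ‖D t + (w : ℂ) • T t‖) := by ring
        _ ≤ Real.exp (|w| * |τ|) * (t * (‖D t‖ + |w| * ‖T t‖)) := by
          gcongr
          refine (norm_add_le _ _).trans (add_le_add le_rfl ?_)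
          rw [norm_smul, Complex.norm_real, Real.norm_eq_abs]
        _ = Real.exp (|w| * |τ|) * (t * ‖D t‖ + t * |w| * ‖T t‖) := by ring
        _ ≤ _ := by
          have : t ≤ |τ| := htτ.trans (le_abs_self τ)
          gcongr
  · have hTc : ContinuousOn T (Ioi 0) := fun t ht =>
      (h.hasDerivAt t ht).continuousAt.continuousWithinAt
    have hwT : ContinuousOn (fun t => (w : ℂ) • T t) (Ioi 0) := by fun_prop
    exact hexp.continuousOn.smul (h.contD.add hwT)
  · intro t ht z hz
    have := h.commute t ht (z - w) (by simpa using hz)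
    simp only [hshift] at this
    exact this.smul_left _
  · intro t ht z hz
    have := h.resolvent_mul t ht (z - w) (by simpa using hz)
    simp only [hshift] at this
    rw [mul_smul_comm, mul_smul_comm, mul_add, this, mul_smul_comm]
    congr 1
    simp only [sub_mul, smul_mul_assoc, one_mul]
    module

/-- For y in D(A) and λ = n + 1 + w the error is R(λ, A)(Ay - wy), which tends to 0. Here Ay may lie
outside H₀, so the resolvent of A is needed, not that of the part. Density of D(A) in H₀ and the
bound M give all x. -/
theorem tendsto_smul_opResolvent_partInClosure {A : E →ₗ.[ℂ] E} {w M : ℝ}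
    (hM : ∀ z : ℂ, 0 < z.re → z + w ∈ opResolventSet (partInClosure A) ∧
      ‖z‖ * ‖opResolvent (partInClosure A) (z + w)‖ ≤ M)
    {ωA : ℝ} (hres : ∀ r : ℝ, ωA < r → (r : ℂ) ∈ opResolventSet A)
    (hdecay : Tendsto (fun r : ℝ => ‖opResolvent A (r : ℂ)‖) atTop (𝓝 0)) [CompleteSpace E]
    (x : domainClosure A) :
    Tendsto (fun n : ℕ => ((n + 1 : ℝ) : ℂ) • opResolvent (partInClosure A) ((n + 1 : ℝ) + w) x)
      atTop (𝓝 x) := by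
  set F : ℕ → domainClosure A →L[ℂ] domainClosure A := fun n =>
    ((n + 1 : ℝ) : ℂ) • opResolvent (partInClosure A) ((n + 1 : ℝ) + w) with hF
  have hpos : ∀ n : ℕ, 0 < (((n + 1 : ℝ) : ℂ)).re := fun n => by
    rw [Complex.ofReal_re]; positivity
  have hFb : ∀ n, ‖F n‖ ≤ M := fun n =>
    (ContinuousLinearMap.opNorm_smul_le _ _).trans (hM _ (hpos n)).2
  set s : Set (domainClosure A) := {y | (y : E) ∈ A.domain} with hs
  have hdense : Dense s := by
    intro y
    rw [Metric.mem_closure_iff]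
    intro ε hε
    obtain ⟨v, hv, hvy⟩ := Metric.mem_closure_iff.mp (show (y : E) ∈ closure (A.domain : Set E)
      from y.2) ε hε
    exact ⟨⟨v, Submodule.le_topologicalClosure _ hv⟩, hv, hvy⟩
  have hlim : ∀ y ∈ s, Tendsto (fun n => F n y) atTop (𝓝 y) := by
    intro y hy
    have hat : Tendsto (fun n : ℕ => (n + 1 : ℝ) + w) atTop atTop :=
      tendsto_atTop_add_const_right _ _
        (tendsto_atTop_add_const_right _ _ tendsto_natCast_atTop_atTop)
    rw [tendsto_iff_norm_sub_tendsto_zero]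
    refine squeeze_zero' (g := fun n : ℕ =>
      ‖opResolvent A (((n + 1 : ℝ) + w : ℝ) : ℂ)‖ * ‖A ⟨y, hy⟩ - (w : ℂ) • (y : E)‖)
      (Eventually.of_forall fun _ => norm_nonneg _) ?_ ?_
    · filter_upwards [hat.eventually_gt_atTop ωA] with n hn
      have hz := hres _ hn
      have hz0 := (hM _ (hpos n)).1
      rw [← Complex.ofReal_add] at hz0
      have h1 : opResolvent A (((n + 1 : ℝ) + w : ℝ) : ℂ)
          ((((n + 1 : ℝ) + w : ℝ) : ℂ) • (y : E) - A ⟨y, hy⟩) = y :=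
        (isResolventAt_opResolvent hz).apply_eq_iff.mpr (A.mem_graph ⟨y, hy⟩)
      have h2 : ((F n y - y : domainClosure A) : E) =
          opResolvent A (((n + 1 : ℝ) + w : ℝ) : ℂ) (A ⟨y, hy⟩ - (w : ℂ) • (y : E)) := by
        have h3 : ((F n y : domainClosure A) : E) =
            ((n + 1 : ℝ) : ℂ) • opResolvent A (((n + 1 : ℝ) + w : ℝ) : ℂ) y := by
          have := resolventToClosure_coe hz hz0 y
          rw [← coe_resolventToClosure, this, Complex.ofReal_add (n + 1 : ℝ) w]
          rfl
        rw [AddSubgroupClass.coe_sub, h3]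
        nth_rw 2 [← h1]
        rw [← map_smul, ← map_sub]
        congr 1
        push_cast
        module
      change ‖((F n y - y : domainClosure A) : E)‖ ≤ _
      rw [h2]
      exact ContinuousLinearMap.le_opNorm _ _
    · simpa using (hdecay.comp hat).mul_const _
  obtain ⟨S, _, hS⟩ := exists_strong_limit hFb hdense fun y hy => (hlim y hy).cauchySeq
  have hS1 : S = 1 := by
    refine DFunLike.coe_injective ?_
    exact Continuous.ext_on hdense S.continuous continuous_id fun y hy =>
      tendsto_nhds_unique (hS y) (hlim y hy)
  have := hS x
  rwa [hS1] at this

theorem exists_analyticSemigroup_partInClosure [CompleteSpace E] {A : E →ₗ.[ℂ] E}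
    (hsect : IsSectorialOp (partInClosure A)) {ωA : ℝ}
    (hres : ∀ r : ℝ, ωA < r → (r : ℂ) ∈ opResolventSet A) {p : ℝ} (hp : 1 ≤ p)
    (hgrowth : ∃ C : ℝ, ∀ᶠ r : ℝ in atTop, r ^ (1 / p) * ‖opResolvent A (r : ℂ)‖ ≤ C) :
    ∃ (w : ℝ) (T D : ℝ → domainClosure A →L[ℂ] domainClosure A),
      (∀ z : ℂ, w < z.re → z ∈ opResolventSet (partInClosure A)) ∧
      IsAnalyticSemigroup (opResolvent (partInClosure A)) w T D := by
  obtain ⟨w, ϑ, M, hϑ, _, hM0, hM⟩ := hsect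
  have hM' : ∀ z : ℂ, 0 < z.re → z + w ∈ opResolventSet (partInClosure A) ∧
      ‖z‖ * ‖opResolvent (partInClosure A) (z + w)‖ ≤ M := by
    intro z hz
    have hz0 : z ≠ 0 := fun h0 => by simp [h0] at hz
    have h1 := hM (z + w) (by simpa using hz0) (by
      rw [add_sub_cancel_right]
      -- The open half-plane to the right of the vertex lies in the sector, as ϑ > π/2.
      exact ((Complex.abs_arg_lt_pi_div_two_iff.mpr (Or.inl hz)).trans hϑ).le)
    rw [add_sub_cancel_right, le_div_iff₀ (norm_pos_iff.mpr hz0), mul_comm] at h1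
    exact h1
  have hH : IsHalfPlaneResolvent (fun z : ℂ => opResolvent (partInClosure A) (z + w)) M := by
    refine ⟨fun z u hz hu => ?_, fun z hz => (hM' z hz).2⟩
    rw [(isResolventAt_opResolvent (hM' z hz).1).sub_eq
      (isResolventAt_opResolvent (hM' u hu).1), add_sub_add_right_eq_sub]
  obtain ⟨T, D, hTD⟩ := hH.exists_analyticSemigroup
    (tendsto_smul_opResolvent_partInClosure hM' hres (tendsto_norm_opResolvent hp hgrowth))
  refine ⟨w, _, _, fun z hz => ?_, hTD.shift⟩
  have := (hM' (z - w) (by simpa using hz)).1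
  rwa [sub_add_cancel] at this

end PartSemigroup

/-! ### The generator of an analytic semigroup -/

section Generator

namespace IsAnalyticSemigroup

variable {X : Type*} [NormedAddCommGroup X] [NormedSpace ℂ X] [CompleteSpace X]
variable {R : ℂ → X →L[ℂ] X} {a : ℝ} {T D : ℝ → X →L[ℂ] X} {l : ℂ} {B : X →ₗ.[ℂ] X}

theorem tendsto_slope_integral (h : IsAnalyticSemigroup R a T D) (y : X) :
    Tendsto (fun t : ℝ => t⁻¹ • ∫ s in (0 : ℝ)..t, T (max s 0) y) (𝓝[>] 0) (𝓝 y) := by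
  have hc : Continuous fun s : ℝ => T (max s 0) y :=
    h.continuous_comp continuous_id continuous_const
  have h1 := (hc.integral_hasStrictDerivAt 0 0).hasDerivAt
  rw [hasDerivAt_iff_tendsto_slope] at h1
  have h2 := h1.mono_left (nhdsWithin_mono 0 fun t (ht : 0 < t) => ht.ne')
  rw [max_self, h.zero] at h2
  refine h2.congr fun t => ?_
  rw [slope_def_module]
  simp

theorem isC0SemigroupGeneratedBy (h : IsAnalyticSemigroup R a T D) (hl : a < l.re)
    (hB : IsResolventAt B l (R l)) : IsC0SemigroupGeneratedBy B T where
  zero := h.zero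
  add := h.add
  cont := h.cont
  generator := by
    intro x y
    constructor
    · intro hxy
      have hx := hB.apply_eq_iff.mpr hxy
      refine (h.tendsto_slope_integral y).congr' ?_
      filter_upwards [self_mem_nhdsWithin] with t ht
      have e := h.apply_resolvent_sub hl (le_of_lt ht) (l • x - y)
      have e2 : (l • R l - 1) (l • x - y) = y := by
        change l • R l (l • x - y) - (l • x - y) = y
        rw [hx, sub_sub_cancel]
      rw [hx, e2] at e
      rw [e]
    · intro hxy
      -- Two limits of the same difference quotient at R(l)x: R(l)y by hypothesis, and (lR(l) - 1)x
      -- by the homogeneous equation.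
      have h1 : Tendsto (fun t : ℝ => t⁻¹ • (T t (R l x) - R l x)) (𝓝[>] 0) (𝓝 (R l y)) := by
        refine (((R l).continuous.tendsto _).comp hxy).congr' ?_
        filter_upwards [self_mem_nhdsWithin] with t ht
        have := congrArg (fun S => S x) (h.commute t (le_of_lt ht) l hl).eq
        have h2 : T t (R l x) = R l (T t x) := this
        rw [h2, ← map_sub, Function.comp_apply]
        exact (R l).map_smul_of_tower t⁻¹ _
      have h3 : Tendsto (fun t : ℝ => t⁻¹ • (T t (R l x) - R l x)) (𝓝[>] 0)
          (𝓝 ((l • R l - 1) x)) := by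
        refine (h.tendsto_slope_integral _).congr' ?_
        filter_upwards [self_mem_nhdsWithin] with t ht
        rw [h.apply_resolvent_sub hl (le_of_lt ht)]
      have h4 : R l y = l • R l x - x := tendsto_nhds_unique h1 h3
      refine hB.apply_eq_iff.mp ?_
      rw [map_sub, map_smul, h4, sub_sub_cancel]

/-- Needed because `generatedSemigroup` is obtained by choice. A competitor T' commutes with R(l),
hence R(l)T'(·)x solves the homogeneous resolved problem, whose solution is R(l)T(·)x; R(l) is
injective. -/
theorem eq_of_isC0SemigroupGeneratedBy (h : IsAnalyticSemigroup R a T D) (hl : a < l.re)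
    (hB : IsResolventAt B l (R l)) {T' : ℝ → X →L[ℂ] X} (h' : IsC0SemigroupGeneratedBy B T')
    {t : ℝ} (ht : 0 ≤ t) : T' t = T t := by
  ext x
  set y := (l • R l - 1) x with hy
  have hgr : (R l x, y) ∈ B.graph := hB.mem_graph x
  have hgen := (h'.generator _ _).mp hgr
  have hmap : ∀ t, 0 ≤ t →
      Tendsto (fun q : ℝ => q⁻¹ • (T' q (T' t (R l x)) - T' t (R l x))) (𝓝[>] 0) (𝓝 (T' t y)) ∧
      Tendsto (fun q : ℝ => q⁻¹ • (T' (t + q) (R l x) - T' t (R l x))) (𝓝[>] 0)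
        (𝓝 (T' t y)) := by
    intro t ht
    have h1 := ((T' t).continuous.tendsto _).comp hgen
    have e : ∀ q : ℝ, (T' t) (q⁻¹ • (T' q (R l x) - R l x)) =
        q⁻¹ • (T' t (T' q (R l x)) - T' t (R l x)) := fun q => by
      rw [← map_sub]; exact (T' t).map_smul_of_tower q⁻¹ _
    constructor
    · refine h1.congr' ?_
      filter_upwards [self_mem_nhdsWithin] with q hq
      have hq' : (0 : ℝ) ≤ q := le_of_lt hq
      rw [Function.comp_apply, e]
      have e1 : T' t (T' q (R l x)) = T' (t + q) (R l x) := by rw [h'.add t q ht hq']; rfl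
      have e2 : T' q (T' t (R l x)) = T' (q + t) (R l x) := by rw [h'.add q t hq' ht]; rfl
      rw [e1, e2, add_comm]
    · refine h1.congr' ?_
      filter_upwards [self_mem_nhdsWithin] with q hq
      have hq' : (0 : ℝ) ≤ q := le_of_lt hq
      rw [Function.comp_apply, e]
      have e1 : T' t (T' q (R l x)) = T' (t + q) (R l x) := by rw [h'.add t q ht hq']; rfl
      rw [e1]
  have hcomm : ∀ t, 0 ≤ t → R l (T' t x) = T' t (R l x) := by
    intro t ht
    have h1 := hB.apply_eq_iff.mpr ((h'.generator _ _).mpr (hmap t ht).1)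
    have e : l • T' t (R l x) - T' t y = T' t x := by
      rw [← map_smul, ← map_sub]
      congr 1
      change l • R l x - (l • R l x - x) = x
      abel
    rwa [e] at h1
  have hcont : ∀ z, Continuous fun s : ℝ => T' (max s 0) z := fun z =>
    (h'.cont z).comp_continuous (by fun_prop) fun s => le_max_right s 0
  have hint : ∀ t, 0 ≤ t → T' t (R l x) = R l x + ∫ s in (0 : ℝ)..t, T' (max s 0) y := by
    intro t ht
    have := intervalIntegral.integral_eq_sub_of_hasDeriv_right_of_le (a := 0) (b := t)
      (f := fun s => T' (max s 0) (R l x)) (f' := fun s => T' (max s 0) y) ht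
      (hcont _).continuousOn (fun s hs => ?_) ((hcont y).intervalIntegrable _ _)
    · rw [this]
      simp [ht, h'.zero]
    · have h2 := (hmap s hs.1.le).2
      rw [hasDerivWithinAt_iff_tendsto_slope' (by simp), max_eq_left hs.1.le]
      have hsub : Tendsto (fun q : ℝ => q - s) (𝓝[>] s) (𝓝[>] 0) := by
        refine tendsto_nhdsWithin_iff.mpr ⟨?_, ?_⟩
        · have : Continuous fun q : ℝ => q - s := by fun_prop
          have h3 := this.tendsto s
          rw [sub_self] at h3
          exact h3.mono_left nhdsWithin_le_nhds
        · filter_upwards [self_mem_nhdsWithin] with q hq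
          exact sub_pos.mpr (mem_Ioi.mp hq)
      refine (h2.comp hsub).congr' ?_
      filter_upwards [self_mem_nhdsWithin] with q hq
      have hq' : s < q := hq
      rw [slope_def_module, Function.comp_apply, add_sub_cancel, max_eq_left hs.1.le,
        max_eq_left (hs.1.trans hq').le]
  have hsol : ∀ s ∈ Icc 0 t, R l (T' (max s 0) x) = R l x +
      (∫ q in (0 : ℝ)..s, (l • R l - 1) (T' (max q 0) x)) + ∫ q in (0 : ℝ)..s, (0 : X) := by
    intro s hs
    rw [max_eq_left hs.1, hcomm s hs.1, hint s hs.1, intervalIntegral.integral_zero, add_zero]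
    congr 1
    refine intervalIntegral.integral_congr fun q _ => ?_
    have := hcomm _ (le_max_right q 0)
    change T' (max q 0) (l • R l x - x) = l • R l (T' (max q 0) x) - T' (max q 0) x
    rw [this, map_sub, map_smul]
  have hfin := h.duhamel_of_integral_eq hl (hcont x) continuous_const hsol ⟨ht, le_rfl⟩
  simp only [map_zero, intervalIntegral.integral_zero, add_zero, max_eq_left ht] at hfin
  have h5 : T t (R l x) = R l (T t x) := congrArg (fun S => S x) (h.commute t ht l hl).eq
  rw [h5] at hfin
  exact hB.injective hfin

theorem generatedSemigroup_eq (h : IsAnalyticSemigroup R a T D) (hl : a < l.re)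
    (hB : IsResolventAt B l (R l)) {t : ℝ} (ht : 0 ≤ t) : generatedSemigroup B t = T t := by
  have hex : ∃ T, IsC0SemigroupGeneratedBy B T := ⟨T, h.isC0SemigroupGeneratedBy hl hB⟩
  rw [generatedSemigroup, dif_pos hex]
  exact h.eq_of_isC0SemigroupGeneratedBy hl hB hex.choose_spec ht

end IsAnalyticSemigroup

end Generator

/-! ### The extrapolated kernel -/

section Kernel

variable {X E : Type*} [NormedAddCommGroup X] [NormedSpace ℂ X] [NormedAddCommGroup E]
  [NormedSpace ℂ E]

/-- The kernel `(l - B) T(t) R`, the derivative of the integrated semigroup. -/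
noncomputable def extrapolatedKernel (l : ℂ) (R : E →L[ℂ] X) (T D : ℝ → X →L[ℂ] X) (t : ℝ) :
    E →L[ℂ] X :=
  (l • T t - D t).comp R

variable {ι : X →L[ℂ] E} {R R' : E →L[ℂ] X} {Rf : ℂ → X →L[ℂ] X} {a : ℝ}
  {T D : ℝ → X →L[ℂ] X} {l r : ℂ}

namespace IsAnalyticSemigroup

theorem smul_sub_deriv_resolvent (h : IsAnalyticSemigroup Rf a T D) (hl : a < l.re) {t : ℝ}
    (ht : 0 < t) (x : X) : (l • T t - D t) (Rf l x) = T t x := by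
  change l • T t (Rf l x) - D t (Rf l x) = T t x
  rw [h.deriv_resolvent ht hl]
  change l • T t (Rf l x) - T t (l • Rf l x - x) = T t x
  rw [map_sub, map_smul, sub_sub_cancel]

/-- The resolvent identity together with (l - B)R(l, B) = 1 shows that the kernel does not depend on
l. Thus l may be adapted to t. -/
theorem extrapolatedKernel_eq (h : IsAnalyticSemigroup Rf a T D) (hl : a < l.re)
    (hR : ∀ x, R (ι x) = Rf l x) (hR' : ∀ x, R x - R' x = (r - l) • R (ι (R' x))) {t : ℝ}
    (ht : 0 < t) : extrapolatedKernel l R T D t = extrapolatedKernel r R' T D t := by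
  ext x
  have h1 : R x = R' x + (r - l) • Rf l (R' x) := by rw [← hR, ← hR']; abel
  change (l • T t - D t) (R x) = (r • T t - D t) (R' x)
  rw [h1, map_add, map_smul, h.smul_sub_deriv_resolvent hl ht]
  change l • T t (R' x) - D t (R' x) + (r - l) • T t (R' x) = r • T t (R' x) - D t (R' x)
  module

theorem resolvent_extrapolatedKernel (h : IsAnalyticSemigroup Rf a T D) (hl : a < l.re) {t : ℝ}
    (ht : 0 < t) (x : E) : Rf l (extrapolatedKernel l R T D t x) = T t (R x) := by
  have h1 : Commute (l • T t - D t) (Rf l) :=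
    ((h.commute t ht.le l hl).smul_left l).sub_left (h.commute_deriv ht hl)
  have h2 := congrArg (fun S => S (R x)) h1.eq
  exact h2.symm.trans (h.smul_sub_deriv_resolvent hl ht (R x))

theorem continuousOn_extrapolatedKernel (h : IsAnalyticSemigroup Rf a T D) (l : ℂ)
    (R : E →L[ℂ] X) : ContinuousOn (extrapolatedKernel l R T D) (Ioi 0) := by
  have hT : ContinuousOn T (Ioi 0) := fun t ht =>
    (h.hasDerivAt t ht).continuousAt.continuousWithinAt
  have hD := h.contD
  have h1 : ContinuousOn (fun t => l • T t - D t) (Ioi 0) := by fun_prop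
  exact h1.clm_comp continuousOn_const

theorem norm_extrapolatedKernel_le (l : ℂ) (R : E →L[ℂ] X) {t C : ℝ} (ht : 0 < t)
    (hT : ‖T t‖ ≤ C) (hD : t * ‖D t‖ ≤ C) :
    ‖extrapolatedKernel l R T D t‖ ≤ (‖l‖ * C + C / t) * ‖R‖ := by
  refine (ContinuousLinearMap.opNorm_comp_le _ _).trans ?_
  gcongr
  refine (norm_sub_le _ _).trans (add_le_add ?_ ?_)
  · rw [norm_smul]
    gcongr
  · rwa [le_div_iff₀ ht, mul_comm]

/-- The kernel has an integrable singularity at `0`, if `‖R(r)‖ = O(r ^ (-q))` with `q > 0`. -/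
theorem intervalIntegrable_extrapolatedKernel (h : IsAnalyticSemigroup Rf a T D) (hl : a < l.re)
    (hR : ∀ x, R (ι x) = Rf l x) {RE : ℝ → E →L[ℂ] X} {q C r₀ : ℝ} (hq : 0 < q)
    (hr₀ : 0 < r₀) (hRE : ∀ r, r₀ ≤ r → (∀ x, R x - RE r x = (r - l) • R (ι (RE r x))) ∧
      r ^ q * ‖RE r‖ ≤ C) (τ : ℝ) (hτ : 0 ≤ τ) :
    IntervalIntegrable (extrapolatedKernel l R T D) volume 0 τ := by
  obtain ⟨K, hK, hb⟩ := h.bound τ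
  set c := (‖l‖ * K + K * r₀) * ‖R‖ with hc
  have hg : IntervalIntegrable (fun t : ℝ => c + 2 * K * C * t ^ (q - 1)) volume 0 τ :=
    intervalIntegrable_const.add
      ((intervalIntegral.intervalIntegrable_rpow' (by linarith)).const_mul _)
  have hC : 0 ≤ C := le_trans (by positivity) (hRE r₀ le_rfl).2
  refine hg.mono_fun' ?_ ?_
  · rw [uIoc_of_le hτ]
    exact ((h.continuousOn_extrapolatedKernel l R).mono fun t ht => ht.1).aestronglyMeasurable
      measurableSet_Ioc
  · rw [uIoc_of_le hτ]
    refine (ae_restrict_iff' measurableSet_Ioc).mpr (Eventually.of_forall fun t ht => ?_)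
    have ht0 : 0 < t := ht.1
    obtain ⟨hT, hD⟩ := hb t ht0.le ht.2
    have hpow : 0 ≤ 2 * K * C * t ^ (q - 1) := by positivity
    have hc0 : 0 ≤ c := by positivity
    -- For small t the representation at the point 1/t gives (K/t + K/t) · C t^q, integrable since q
    -- - 1 > -1; for t > 1/r₀ the fixed l suffices.
    rcases le_or_gt r₀ t⁻¹ with hrt | hrt
    · obtain ⟨h1, h2⟩ := hRE _ hrt
      have h3 := norm_extrapolatedKernel_le (D := D) ((t⁻¹ : ℝ) : ℂ) (RE t⁻¹) ht0 hT hD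
      rw [← h.extrapolatedKernel_eq hl hR h1 ht0] at h3
      rw [Real.inv_rpow ht0.le, inv_mul_le_iff₀ (Real.rpow_pos_of_pos ht0 q)] at h2
      have hn : ‖((t⁻¹ : ℝ) : ℂ)‖ = t⁻¹ := by
        rw [Complex.norm_real, Real.norm_of_nonneg (by positivity)]
      rw [hn] at h3
      calc _ ≤ _ := h3
        _ ≤ (t⁻¹ * K + K / t) * (t ^ q * C) := by gcongr
        _ = 2 * K * C * t ^ (q - 1) := by
          rw [Real.rpow_sub_one ht0.ne']
          field_simp
          ring
        _ ≤ _ := le_add_of_nonneg_left hc0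
    · have h3 := norm_extrapolatedKernel_le (D := D) l R ht0 hT hD
      calc _ ≤ _ := h3
        _ ≤ c := by
          rw [hc, div_eq_mul_inv]
          gcongr
        _ ≤ _ := le_add_of_nonneg_right hpow

end IsAnalyticSemigroup

end Kernel

/-! ### The integrated semigroup generated by a non-densely defined operator -/

section IntegratedSemigroup

theorem integral_comp_add_left_eq_sub {E : Type*} [NormedAddCommGroup E] [NormedSpace ℝ E]
    {F : ℝ → E} (hF : Continuous F) (r t : ℝ) :
    ∫ q in (0 : ℝ)..t, F (r + q) = (∫ q in (0 : ℝ)..(r + t), F q) - ∫ q in (0 : ℝ)..r, F q := by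
  rw [intervalIntegral.integral_comp_add_left F r, add_zero,
    intervalIntegral.integral_interval_sub_left (hF.intervalIntegrable _ _)
      (hF.intervalIntegrable _ _)]

variable {X E : Type*} [NormedAddCommGroup X] [NormedSpace ℂ X] [NormedAddCommGroup E]
  [NormedSpace ℂ E]

/-- An operator `A` in `E` with resolvent `ι ∘ R` at `l`, whose part in the subspace `ι : X → E`
generates an analytic semigroup `T`, such that the kernel `(l - A) T(t) R` is integrable. -/
structure IsExtrapolatedSemigroup (A : E →ₗ.[ℂ] E) (ι : X →L[ℂ] E) (l : ℂ) (R : E →L[ℂ] X)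
    (Rf : ℂ → X →L[ℂ] X) (a : ℝ) (T D : ℝ → X →L[ℂ] X) : Prop where
  semigroup : IsAnalyticSemigroup Rf a T D
  lt_re : a < l.re
  injective : Function.Injective ι
  resolvent : IsResolventAt A l (ι.comp R)
  part : ∀ x, R (ι x) = Rf l x
  integrable : ∀ τ : ℝ, 0 ≤ τ → IntervalIntegrable (extrapolatedKernel l R T D) volume 0 τ

/-- The integrated semigroup, as the primitive of the extrapolated kernel. -/
noncomputable def extrapolatedIntegral (ι : X →L[ℂ] E) (l : ℂ) (R : E →L[ℂ] X)
    (T D : ℝ → X →L[ℂ] X) (t : ℝ) : E →L[ℂ] E :=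
  ι.comp (∫ s in (0 : ℝ)..t, extrapolatedKernel l R T D s)

namespace IsExtrapolatedSemigroup

variable {A : E →ₗ.[ℂ] E} {ι : X →L[ℂ] E} {l : ℂ} {R : E →L[ℂ] X} {Rf : ℂ → X →L[ℂ] X} {a : ℝ}
  {T D : ℝ → X →L[ℂ] X}

theorem injective_resolvent (h : IsExtrapolatedSemigroup A ι l R Rf a T D) :
    Function.Injective R := fun _ _ hxy => h.resolvent.injective (congrArg ι hxy)

theorem injective_part (h : IsExtrapolatedSemigroup A ι l R Rf a T D) :
    Function.Injective (Rf l) := fun x y hxy => by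
  rw [← h.part, ← h.part] at hxy
  exact h.injective (h.injective_resolvent hxy)

theorem mem_graph_iff (h : IsExtrapolatedSemigroup A ι l R Rf a T D) {x y : E} :
    (x, y) ∈ A.graph ↔ ι (R (l • x - y)) = x :=
  h.resolvent.apply_eq_iff.symm

theorem resolvent_extrapolatedKernel (h : IsExtrapolatedSemigroup A ι l R Rf a T D) {t : ℝ}
    (ht : 0 < t) (x : E) : Rf l (extrapolatedKernel l R T D t x) = T t (R x) :=
  h.semigroup.resolvent_extrapolatedKernel h.lt_re ht x

theorem continuousOn_integral_kernel (h : IsExtrapolatedSemigroup A ι l R Rf a T D) :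
    ContinuousOn (fun t => ∫ s in (0 : ℝ)..t, extrapolatedKernel l R T D s) (Ici 0) := by
  intro t ht
  have ht0 : (0 : ℝ) ≤ t := ht
  have h1 : ContinuousOn (fun t => ∫ s in (0 : ℝ)..t, extrapolatedKernel l R T D s)
      (Icc 0 (t + 1)) := by
    have h2 := intervalIntegral.continuousOn_primitive_interval (a := 0) (b := t + 1)
      (f := extrapolatedKernel l R T D) (μ := volume) ?_
    · rwa [uIcc_of_le (by linarith)] at h2
    · have := h.integrable (t + 1) (by linarith)
      rw [intervalIntegrable_iff_integrableOn_Icc_of_le (by linarith)] at this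
      rwa [uIcc_of_le (by linarith)]
  refine (h1 t ⟨ht0, by linarith⟩).mono_of_mem_nhdsWithin ?_
  exact mem_nhdsWithin.mpr ⟨Iio (t + 1), isOpen_Iio, by simp, fun s hs => ⟨hs.2, (le_of_lt hs.1)⟩⟩

theorem continuous_primitive (h : IsExtrapolatedSemigroup A ι l R Rf a T D) (y : X) :
    Continuous fun t => ∫ s in (0 : ℝ)..t, T (max s 0) y :=
  intervalIntegral.continuous_primitive
    (fun _ _ => (h.semigroup.continuous_comp continuous_id continuous_const).intervalIntegrable
      _ _) 0

theorem continuousOn_extrapolatedIntegral (h : IsExtrapolatedSemigroup A ι l R Rf a T D) (x : E) :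
    ContinuousOn (fun t => extrapolatedIntegral ι l R T D t x) (Ici 0) :=
  ι.continuous.comp_continuousOn (h.continuousOn_integral_kernel.clm_apply continuousOn_const)

variable [CompleteSpace X]

theorem resolvent_integral (h : IsExtrapolatedSemigroup A ι l R Rf a T D) {t : ℝ} (ht : 0 ≤ t)
    (x : E) : Rf l ((∫ s in (0 : ℝ)..t, extrapolatedKernel l R T D s) x) =
      ∫ s in (0 : ℝ)..t, T (max s 0) (R x) := by
  have hi := h.integrable t ht
  have hix : IntervalIntegrable (fun s => extrapolatedKernel l R T D s x) volume 0 t := by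
    rw [intervalIntegrable_iff] at hi ⊢
    exact hi.apply_continuousLinearMap x
  rw [ContinuousLinearMap.intervalIntegral_apply hi,
    ← ContinuousLinearMap.intervalIntegral_comp_comm _ hix,
    intervalIntegral.integral_of_le ht, intervalIntegral.integral_of_le ht]
  refine setIntegral_congr_fun measurableSet_Ioc fun s hs => ?_
  rw [h.resolvent_extrapolatedKernel hs.1, max_eq_left hs.1.le]

theorem resolvent_extrapolatedIntegral (h : IsExtrapolatedSemigroup A ι l R Rf a T D) {t : ℝ}
    (ht : 0 ≤ t) (x : E) : R (extrapolatedIntegral ι l R T D t x) =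
      ∫ s in (0 : ℝ)..t, T (max s 0) (R x) :=
  (h.part _).trans (h.resolvent_integral ht x)

theorem hasDerivAt_extrapolatedIntegral (h : IsExtrapolatedSemigroup A ι l R Rf a T D) {t : ℝ}
    (ht : 0 < t) : HasDerivAt (extrapolatedIntegral ι l R T D)
      (ι.comp (extrapolatedKernel l R T D t)) t := by
  have hc := h.semigroup.continuousOn_extrapolatedKernel l R
  have h1 := intervalIntegral.integral_hasDerivAt_right (h.integrable t ht.le)
    (hc.stronglyMeasurableAtFilter isOpen_Ioi t ht) (hc.continuousAt (Ioi_mem_nhds ht))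
  exact ((ContinuousLinearMap.compL ℂ E X E ι).restrictScalars ℝ).hasFDerivAt.comp_hasDerivAt t h1

/-- The right derivative at t = 0 recovers the vector. -/
theorem primitive_injective (h : IsExtrapolatedSemigroup A ι l R Rf a T D) {y z : X}
    (hyz : ∀ t : ℝ, 0 ≤ t → ∫ s in (0 : ℝ)..t, T (max s 0) y = ∫ s in (0 : ℝ)..t, T (max s 0) z) :
    y = z := by
  refine tendsto_nhds_unique (h.semigroup.tendsto_slope_integral y)
    ((h.semigroup.tendsto_slope_integral z).congr' ?_)
  filter_upwards [self_mem_nhdsWithin] with t ht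
  rw [hyz t (le_of_lt ht)]

theorem resolvent_integral_extrapolatedIntegral (h : IsExtrapolatedSemigroup A ι l R Rf a T D)
    [CompleteSpace E] {t : ℝ} (ht : 0 ≤ t) (x : E) :
    R (∫ s in (0 : ℝ)..t, extrapolatedIntegral ι l R T D s x) =
      ∫ s in (0 : ℝ)..t, ∫ q in (0 : ℝ)..s, T (max q 0) (R x) := by
  have hc : ContinuousOn (fun s => extrapolatedIntegral ι l R T D s x) (uIcc 0 t) := by
    rw [uIcc_of_le ht]
    exact (h.continuousOn_extrapolatedIntegral x).mono fun s hs => hs.1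
  rw [← ContinuousLinearMap.intervalIntegral_comp_comm _ hc.intervalIntegrable]
  refine intervalIntegral.integral_congr fun s hs => ?_
  rw [uIcc_of_le ht] at hs
  exact h.resolvent_extrapolatedIntegral hs.1 x

/-- Each identity is checked after the injective map R, which turns the integrated semigroup into
the primitive of T(·)R. -/
theorem isIntegratedSemigroupGeneratedBy (h : IsExtrapolatedSemigroup A ι l R Rf a T D)
    [CompleteSpace E] : IsIntegratedSemigroupGeneratedBy A (extrapolatedIntegral ι l R T D) where
  zero := by
    ext x
    simp [extrapolatedIntegral]
  cont := h.continuousOn_extrapolatedIntegral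
  comp := by
    intro t s ht hs x
    apply h.injective_resolvent
    rw [h.resolvent_extrapolatedIntegral ht, h.resolvent_extrapolatedIntegral hs]
    have hc1 : ContinuousOn (fun r => extrapolatedIntegral ι l R T D (s + r) x) (uIcc 0 t) := by
      rw [uIcc_of_le ht]
      exact (h.continuousOn_extrapolatedIntegral x).comp (by fun_prop)
        fun r hr => add_nonneg hs hr.1
    have hc2 : ContinuousOn (fun r => extrapolatedIntegral ι l R T D r x) (uIcc 0 t) := by
      rw [uIcc_of_le ht]
      exact (h.continuousOn_extrapolatedIntegral x).mono fun r hr => hr.1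
    rw [← ContinuousLinearMap.intervalIntegral_comp_comm _
      (hc1.intervalIntegrable.sub hc2.intervalIntegrable)]
    refine intervalIntegral.integral_congr fun r hr => ?_
    rw [uIcc_of_le ht] at hr
    have hr0 : 0 ≤ r := hr.1
    have hcont : Continuous fun q : ℝ => T (max q 0) (R x) :=
      h.semigroup.continuous_comp continuous_id continuous_const
    rw [map_sub, h.resolvent_extrapolatedIntegral (add_nonneg hs hr0),
      h.resolvent_extrapolatedIntegral hr0, max_eq_left hr0, add_comm s r,
      ← integral_comp_add_left_eq_sub hcont,
      ← ContinuousLinearMap.intervalIntegral_comp_comm _ (hcont.intervalIntegrable _ _)]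
    refine intervalIntegral.integral_congr fun q hq => ?_
    rw [uIcc_of_le hs] at hq
    rw [max_eq_left hq.1, max_eq_left (add_nonneg hr0 hq.1), h.semigroup.add r q hr0 hq.1]
    rfl
  nondegenerate := by
    intro x hx
    apply h.injective_resolvent
    refine h.primitive_injective fun t ht => ?_
    rw [← h.resolvent_extrapolatedIntegral ht, ← h.resolvent_extrapolatedIntegral ht, hx t ht,
      map_zero]
    simp
  generator := by
    intro x y
    have hcont : ∀ z, Continuous fun q : ℝ => T (max q 0) z := fun z =>
      h.semigroup.continuous_comp continuous_id continuous_const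
    have hred : (∀ t : ℝ, 0 ≤ t → extrapolatedIntegral ι l R T D t x - t • x =
          ∫ s in (0 : ℝ)..t, extrapolatedIntegral ι l R T D s y) ↔
        ∀ t : ℝ, 0 ≤ t → (∫ s in (0 : ℝ)..t, T (max s 0) (R x)) - t • R x =
          ∫ s in (0 : ℝ)..t, ∫ q in (0 : ℝ)..s, T (max q 0) (R y) := by
      refine forall_congr' fun t => forall_congr' fun ht => ?_
      rw [← h.injective_resolvent.eq_iff, map_sub, h.resolvent_extrapolatedIntegral ht,
        h.resolvent_integral_extrapolatedIntegral ht, R.map_smul_of_tower t x]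
    rw [hred]
    constructor
    · intro hxy t ht
      have hx := h.mem_graph_iff.mp hxy
      set x' := R (l • x - y) with hx'
      have hRx : R x = Rf l x' := by rw [← h.part, hx]
      have hRy : R y = (l • Rf l - 1) x' := by
        change R y = l • Rf l x' - x'
        rw [← hRx, hx', map_sub, map_smul, sub_sub_cancel]
      have e : t • R x = ∫ s in (0 : ℝ)..t, R x := by simp
      rw [e, ← intervalIntegral.integral_sub ((hcont _).intervalIntegrable _ _)
        intervalIntegrable_const]
      refine intervalIntegral.integral_congr fun s hs => ?_
      rw [uIcc_of_le ht] at hs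
      rw [hRx, hRy, ← h.semigroup.apply_resolvent_sub h.lt_re hs.1, max_eq_left hs.1]
    · intro hxy
      -- Both sides are differentiated in t on [0, ∞), one-sidedly at 0.
      have hprim : ∀ t : ℝ, 0 ≤ t → T t (R x) - R x = ∫ q in (0 : ℝ)..t, T (max q 0) (R y) := by
        intro t ht
        have hd1 : HasDerivAt (fun t => (∫ s in (0 : ℝ)..t, T (max s 0) (R x)) - t • R x)
            (T (max t 0) (R x) - R x) t := by
          have := ((hcont (R x)).integral_hasStrictDerivAt 0 t).hasDerivAt.sub
            ((hasDerivAt_id t).smul_const (R x))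
          simp only [one_smul] at this
          exact this
        have hd2 : HasDerivAt (fun t => ∫ s in (0 : ℝ)..t, ∫ q in (0 : ℝ)..s, T (max q 0) (R y))
            (∫ q in (0 : ℝ)..t, T (max q 0) (R y)) t :=
          ((h.continuous_primitive (R y)).integral_hasStrictDerivAt 0 t).hasDerivAt
        have hu : UniqueDiffWithinAt ℝ (Ici (0 : ℝ)) t := uniqueDiffOn_Ici 0 t ht
        have := hu.eq_deriv _ hd1.hasDerivWithinAt
          (hd2.hasDerivWithinAt.congr (fun s hs => hxy s hs) (hxy t ht))
        rwa [max_eq_left ht] at this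
      -- After one more resolvent both vectors have the same primitive under T; undoing R then gives
      -- ι(Ry) = lι(Rx) - x, which is membership in the graph.
      have h1 : Rf l (R y) = (l • Rf l - 1) (R x) := by
        refine h.primitive_injective fun t ht => ?_
        rw [← h.semigroup.apply_resolvent_sub h.lt_re ht]
        have h2 := congrArg (Rf l) (hprim t ht)
        have hcm := fun t ht => h.semigroup.commute t ht l h.lt_re
        have hcm' : ∀ t, 0 ≤ t → ∀ z, Rf l (T t z) = T t (Rf l z) := fun t ht z =>
          (congrArg (fun S => S z) (hcm t ht).eq).symm
        rw [map_sub, hcm' t ht,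
          ← ContinuousLinearMap.intervalIntegral_comp_comm _ ((hcont _).intervalIntegrable _ _)]
          at h2
        rw [h2]
        refine intervalIntegral.integral_congr fun s _ => ?_
        exact (hcm' _ (le_max_right s 0) _).symm
      have h3 : R (ι (R y)) = R (l • ι (R x) - x) := by
        rw [h.part, h1, map_sub, map_smul, h.part]
        rfl
      have h4 := h.injective_resolvent h3
      rw [h.mem_graph_iff, map_sub, map_smul, map_sub, map_smul, h4, sub_sub_cancel]

end IsExtrapolatedSemigroup

namespace IsIntegratedSemigroupGeneratedBy

variable {A : E →ₗ.[ℂ] E} {S : ℝ → E →L[ℂ] E}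

theorem continuous_max (hS : IsIntegratedSemigroupGeneratedBy A S) (x : E) :
    Continuous fun t : ℝ => S (max t 0) x :=
  (hS.cont x).comp_continuous (by fun_prop) fun s => le_max_right s 0

theorem comp_eq (hS : IsIntegratedSemigroupGeneratedBy A S) {t s : ℝ} (ht : 0 ≤ t) (hs : 0 ≤ s)
    (x : E) : S t (S s x) = (∫ q in (0 : ℝ)..(s + t), S (max q 0) x)
      - (∫ q in (0 : ℝ)..s, S (max q 0) x) - ∫ q in (0 : ℝ)..t, S (max q 0) x := by
  have hc := hS.continuous_max x
  have hc' : Continuous fun q : ℝ => S (max (s + q) 0) x := hc.comp (by fun_prop)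
  rw [hS.comp t s ht hs, ← integral_comp_add_left_eq_sub hc,
    ← intervalIntegral.integral_sub (hc'.intervalIntegrable _ _) (hc.intervalIntegrable _ _)]
  refine intervalIntegral.integral_congr fun q hq => ?_
  rw [uIcc_of_le ht] at hq
  rw [max_eq_left hq.1, max_eq_left (add_nonneg hs hq.1)]

variable [CompleteSpace E]

/-- By `comp_eq` both sides of the generator identity are combinations of the primitive of S(·)x and
of its primitive, symmetric in t and τ. -/
theorem integral_mem_graph (hS : IsIntegratedSemigroupGeneratedBy A S) {t : ℝ} (ht : 0 ≤ t)
    (x : E) : (∫ s in (0 : ℝ)..t, S (max s 0) x, S t x - t • x) ∈ A.graph := by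
  rw [hS.generator]
  intro τ hτ
  have hc := hS.continuous_max x
  set I : ℝ → E := fun t => ∫ s in (0 : ℝ)..t, S (max s 0) x with hI
  have hIc : Continuous I :=
    intervalIntegral.continuous_primitive (fun _ _ => hc.intervalIntegrable _ _) 0
  have hIr : ∀ r, Continuous fun s => I (r + s) := fun r => hIc.comp (by fun_prop)
  have e1 : S τ (I t) = ∫ r in (0 : ℝ)..t, (I (τ + r) - I r - I τ) := by
    rw [hI, ← ContinuousLinearMap.intervalIntegral_comp_comm _ (hc.intervalIntegrable _ _)]
    refine intervalIntegral.integral_congr fun r hr => ?_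
    rw [uIcc_of_le ht] at hr
    simp only
    rw [max_eq_left hr.1, hS.comp_eq hτ hr.1, add_comm r τ]
  have e2 : ∫ s in (0 : ℝ)..τ, S s (S t x - t • x) =
      ∫ s in (0 : ℝ)..τ, (I (t + s) - I t - I s - t • S (max s 0) x) := by
    refine intervalIntegral.integral_congr fun s hs => ?_
    rw [uIcc_of_le hτ] at hs
    rw [map_sub, hS.comp_eq hs.1 ht, (S s).map_smul_of_tower t x, max_eq_left hs.1]
  rw [e1, e2]
  have hsub : ∀ {F G : ℝ → E} (_ : Continuous F) (_ : Continuous G) (b : ℝ),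
      ∫ s in (0 : ℝ)..b, (F s - G s) = (∫ s in (0 : ℝ)..b, F s) - ∫ s in (0 : ℝ)..b, G s :=
    fun hF hG b => intervalIntegral.integral_sub (hF.intervalIntegrable _ _)
      (hG.intervalIntegrable _ _)
  have hconst : ∀ z : E, Continuous fun _ : ℝ => z := fun z => continuous_const
  have hct : Continuous fun s : ℝ => t • S (max s 0) x := hc.const_smul t
  rw [hsub (F := fun r => I (τ + r) - I r) ((hIr τ).sub hIc) (hconst (I τ)),
    hsub (hIr τ) hIc,
    hsub (F := fun s => I (t + s) - I t - I s) (((hIr t).sub (hconst (I t))).sub hIc) hct,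
    hsub (F := fun s => I (t + s) - I t) ((hIr t).sub (hconst (I t))) hIc,
    hsub (hIr t) (hconst (I t)),
    integral_comp_add_left_eq_sub hIc, integral_comp_add_left_eq_sub hIc,
    intervalIntegral.integral_const, intervalIntegral.integral_const,
    intervalIntegral.integral_smul, sub_zero, sub_zero, add_comm t τ]
  abel

variable [CompleteSpace X] {ι : X →L[ℂ] E} {l : ℂ} {R : E →L[ℂ] X}
  {Rf : ℂ → X →L[ℂ] X} {a : ℝ} {T D : ℝ → X →L[ℂ] X}

/-- Here u is ∫₀ᵗ S(s)x seen in X. It solves the resolved problem with forcing s Rx, so Duhamel's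
formula determines R(l)u, then u, then S(t)x: this is uniqueness of the integrated semigroup. -/
theorem exists_resolvent_eq (hS : IsIntegratedSemigroupGeneratedBy A S)
    (h : IsExtrapolatedSemigroup A ι l R Rf a T D) {t : ℝ} (ht : 0 ≤ t) (x : E) :
    ∃ u : X, R (S t x) = l • Rf l u - u + t • R x ∧
      Rf l u = ∫ s in (0 : ℝ)..t, T (max (t - s) 0) (s • R x) := by
  have hc := hS.continuous_max x
  obtain ⟨I, hI⟩ : ∃ I : ℝ → E, I = fun t => ∫ s in (0 : ℝ)..t, S (max s 0) x := ⟨_, rfl⟩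
  have hIc : Continuous I := by
    rw [hI]
    exact intervalIntegral.continuous_primitive (fun _ _ => hc.intervalIntegrable _ _) 0
  set u : ℝ → X := fun t => R (l • I t - (S (max t 0) x - t • x)) with hu
  have hIl : Continuous fun t => l • I t := hIc.const_smul l
  have htx : Continuous fun t : ℝ => t • x := continuous_id.smul continuous_const
  have huc : Continuous u := R.continuous.comp (hIl.sub (hc.sub htx))
  have hιu : ∀ s, 0 ≤ s → ι (u s) = I s := by
    intro s hs
    have := h.mem_graph_iff.mp (hS.integral_mem_graph hs x)
    rw [hu, hI]
    simp only [max_eq_left hs]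
    exact this
  have hRS : ∀ s, 0 ≤ s → R (S (max s 0) x) = (l • Rf l - 1) (u s) + s • R x := by
    intro s hs
    change R (S (max s 0) x) = l • Rf l (u s) - u s + s • R x
    rw [← h.part, hιu s hs]
    have : u s = l • R (I s) - (R (S (max s 0) x) - s • R x) := by
      rw [hu]
      simp only [map_sub, map_smul]
      rw [R.map_smul_of_tower s x]
    rw [this]
    abel
  have hcu : Continuous fun s => (l • Rf l - 1) (u s) := (l • Rf l - 1).continuous.comp huc
  have hcx : Continuous fun s : ℝ => s • R x := by fun_prop
  have hsol : ∀ s ∈ Icc 0 t, Rf l (u s) = 0 + (∫ q in (0 : ℝ)..s, (l • Rf l - 1) (u q)) +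
      ∫ q in (0 : ℝ)..s, q • R x := by
    intro s hs
    rw [← h.part, hιu s hs.1, hI, zero_add,
      ← ContinuousLinearMap.intervalIntegral_comp_comm _ (hc.intervalIntegrable _ _),
      ← intervalIntegral.integral_add (hcu.intervalIntegrable _ _) (hcx.intervalIntegrable _ _)]
    refine intervalIntegral.integral_congr fun q hq => ?_
    rw [uIcc_of_le hs.1] at hq
    exact hRS q hq.1
  refine ⟨u t, ?_, ?_⟩
  · have := hRS t ht
    rwa [max_eq_left ht] at this
  · have := h.semigroup.duhamel_of_integral_eq h.lt_re huc hcx hsol ⟨ht, le_rfl⟩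
    rwa [map_zero, zero_add] at this

theorem eq_of_generator (hS : IsIntegratedSemigroupGeneratedBy A S)
    (h : IsExtrapolatedSemigroup A ι l R Rf a T D) {S' : ℝ → E →L[ℂ] E}
    (hS' : IsIntegratedSemigroupGeneratedBy A S') {t : ℝ} (ht : 0 ≤ t) : S t = S' t := by
  ext x
  obtain ⟨u, hu, hu'⟩ := hS.exists_resolvent_eq h ht x
  obtain ⟨v, hv, hv'⟩ := hS'.exists_resolvent_eq h ht x
  have huv : u = v := h.injective_part (hu'.trans hv'.symm)
  apply h.injective_resolvent
  rw [hu, hv, huv]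

end IsIntegratedSemigroupGeneratedBy

namespace IsExtrapolatedSemigroup

variable [CompleteSpace E] [CompleteSpace X] {A : E →ₗ.[ℂ] E} {ι : X →L[ℂ] E} {l : ℂ}
  {R : E →L[ℂ] X} {Rf : ℂ → X →L[ℂ] X} {a : ℝ} {T D : ℝ → X →L[ℂ] X}

theorem generatedIntegratedSemigroup_eq (h : IsExtrapolatedSemigroup A ι l R Rf a T D) {t : ℝ}
    (ht : 0 ≤ t) : generatedIntegratedSemigroup A t = extrapolatedIntegral ι l R T D t := by
  have hex : ∃ S, IsIntegratedSemigroupGeneratedBy A S := ⟨_, h.isIntegratedSemigroupGeneratedBy⟩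
  rw [generatedIntegratedSemigroup, dif_pos hex]
  exact hex.choose_spec.eq_of_generator h h.isIntegratedSemigroupGeneratedBy ht

theorem deriv_generatedIntegratedSemigroup (h : IsExtrapolatedSemigroup A ι l R Rf a T D) {t : ℝ}
    (ht : 0 < t) : deriv (generatedIntegratedSemigroup A) t =
      ι.comp (extrapolatedKernel l R T D t) := by
  refine ((h.hasDerivAt_extrapolatedIntegral ht).congr_of_eventuallyEq ?_).deriv
  filter_upwards [Ioi_mem_nhds ht] with s hs
  exact h.generatedIntegratedSemigroup_eq (le_of_lt hs)

end IsExtrapolatedSemigroup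

end IntegratedSemigroup

/-! ### Volterra equations with an integrable operator-valued kernel -/

section Volterra

variable {X E : Type*} [NormedAddCommGroup X] [NormedSpace ℂ X] [NormedAddCommGroup E]
  [NormedSpace ℂ E] {K : ℝ → E →L[ℂ] X} {f : ℝ → E}

theorem IntervalIntegrable.clm_apply_continuous {a b : ℝ} (hK : IntervalIntegrable K volume a b)
    (hf : Continuous f) : IntervalIntegrable (fun s => K s (f s)) volume a b := by
  obtain ⟨C, hC⟩ := (isCompact_uIcc (a := a) (b := b)).exists_bound_of_continuousOn hf.continuousOn
  refine (hK.norm.mul_const C).mono_fun' ?_ ?_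
  · exact (ContinuousLinearMap.id ℂ (E →L[ℂ] X)).aestronglyMeasurable_comp₂
      (intervalIntegrable_iff.mp hK).aestronglyMeasurable hf.aestronglyMeasurable
  · refine (ae_restrict_iff' measurableSet_uIoc).mpr (Eventually.of_forall fun s hs => ?_)
    exact ((K s).le_opNorm _).trans
      (mul_le_mul_of_nonneg_left (hC s (uIoc_subset_uIcc hs)) (norm_nonneg _))

theorem intervalIntegrable_kernel_sub {t : ℝ} (hK : IntervalIntegrable K volume 0 t) :
    IntervalIntegrable (fun s => K (t - s)) volume 0 t := by
  have := hK.comp_sub_left t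
  rw [sub_zero, sub_self] at this
  exact this.symm

theorem intervalIntegrable_convolution {t : ℝ} (hK : IntervalIntegrable K volume 0 t)
    (hf : Continuous f) : IntervalIntegrable (fun s => K (t - s) (f s)) volume 0 t :=
  (intervalIntegrable_kernel_sub hK).clm_apply_continuous hf

/-- Splitting off the value f(0) leaves g vanishing for s ≤ 0, so its convolution becomes an
integral over the fixed interval [0, τ], continuous in t by domination. The constant part is the
primitive of K. -/
theorem continuousOn_convolution {τ : ℝ} (hτ : 0 ≤ τ) (hK : IntervalIntegrable K volume 0 τ)
    (hf : Continuous f) {C : ℝ} (hC : ∀ s, ‖f s‖ ≤ C) :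
    ContinuousOn (fun t => ∫ s in (0 : ℝ)..t, K (t - s) (f s)) (Icc 0 τ) := by
  set g : ℝ → E := fun s => f (max s 0) - f 0 with hg
  have hgc : Continuous g := by fun_prop
  have hg0 : ∀ s ≤ 0, g s = 0 := fun s hs => by simp [hg, hs]
  have hgC : ∀ s, ‖g s‖ ≤ C + C := fun s => (norm_sub_le _ _).trans (add_le_add (hC _) (hC _))
  have hsub : ∀ t ∈ Icc 0 τ, IntervalIntegrable K volume 0 t ∧ IntervalIntegrable K volume t τ :=
    fun t ht => ⟨hK.mono_set (by rw [uIcc_of_le ht.1, uIcc_of_le hτ]; exact Icc_subset_Icc_right ht.2),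
      hK.mono_set (by rw [uIcc_of_le ht.2, uIcc_of_le hτ]; exact Icc_subset_Icc_left ht.1)⟩
  have e : ∀ t ∈ Icc 0 τ, ∫ s in (0 : ℝ)..t, K (t - s) (f s) =
      (∫ r in (0 : ℝ)..τ, K r (g (t - r))) + (∫ r in (0 : ℝ)..t, K r) (f 0) := by
    intro t ht
    obtain ⟨h1, h2⟩ := hsub t ht
    have hgt : Continuous fun r => g (t - r) := hgc.comp (by fun_prop)
    have e1 : ∫ s in (0 : ℝ)..t, K (t - s) (f s) = ∫ r in (0 : ℝ)..t, K r (f (t - r)) := by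
      have := intervalIntegral.integral_comp_sub_left (fun r => K r (f (t - r))) t
        (a := 0) (b := t)
      simpa using this
    have e2 : ∫ r in t..τ, K r (g (t - r)) = 0 := by
      rw [← intervalIntegral.integral_zero (a := t) (b := τ) (μ := volume)]
      refine intervalIntegral.integral_congr fun r hr => ?_
      rw [uIcc_of_le ht.2] at hr
      rw [hg0 _ (by linarith [hr.1]), map_zero]
    rw [e1, ← intervalIntegral.integral_add_adjacent_intervals (h1.clm_apply_continuous hgt)
      (h2.clm_apply_continuous hgt), e2, add_zero, ContinuousLinearMap.intervalIntegral_apply h1,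
      ← intervalIntegral.integral_add (h1.clm_apply_continuous hgt)
        (h1.clm_apply_continuous continuous_const)]
    refine intervalIntegral.integral_congr fun r hr => ?_
    rw [uIcc_of_le ht.1] at hr
    simp only [hg]
    rw [← map_add, max_eq_left (by linarith [hr.2]), sub_add_cancel]
  refine ContinuousOn.congr (ContinuousOn.add ?_ ?_) e
  · refine Continuous.continuousOn ?_
    refine intervalIntegral.continuous_of_dominated_interval (bound := fun r => ‖K r‖ * (C + C))
      (fun t => ?_) (fun t => ?_) (hK.norm.mul_const _) ?_
    · have hgt : Continuous fun r => g (t - r) := hgc.comp (by fun_prop)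
      exact (intervalIntegrable_iff.mp (hK.clm_apply_continuous hgt)).aestronglyMeasurable
    · exact Eventually.of_forall fun r _ => ((K r).le_opNorm _).trans
        (mul_le_mul_of_nonneg_left (hgC _) (norm_nonneg _))
    · exact Eventually.of_forall fun r _ => (K r).continuous.comp (hgc.comp (by fun_prop))
  · have h2 := intervalIntegral.continuousOn_primitive_interval (a := 0) (b := τ)
      (f := K) (μ := volume) (by
        rw [uIcc_of_le hτ]
        rwa [intervalIntegrable_iff_integrableOn_Icc_of_le hτ] at hK)
    rw [uIcc_of_le hτ] at h2
    exact h2.clm_apply continuousOn_const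

/-- Dominated convergence: the weights tend to 0 for every r > 0, with no rate required of k. -/
theorem exists_weight {k : ℝ → ℝ} {τ : ℝ} (hτ : 0 ≤ τ) (hk : IntervalIntegrable k volume 0 τ)
    {ε : ℝ} (hε : 0 < ε) : ∃ γ : ℝ, ∫ r in (0 : ℝ)..τ, k r * Real.exp (-(γ * r)) < ε := by
  have h1 : Tendsto (fun n : ℕ => ∫ r in (0 : ℝ)..τ, k r * Real.exp (-((n : ℝ) * r))) atTop
      (𝓝 (∫ r in (0 : ℝ)..τ, (0 : ℝ))) := by
    refine intervalIntegral.tendsto_integral_filter_of_dominated_convergence (fun r => ‖k r‖)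
      (Eventually.of_forall fun n => ?_) (Eventually.of_forall fun n => ?_) hk.norm ?_
    · exact (intervalIntegrable_iff.mp hk).aestronglyMeasurable.mul
        (by fun_prop : Continuous fun r : ℝ => Real.exp (-((n : ℝ) * r))).aestronglyMeasurable
    · refine Eventually.of_forall fun r hr => ?_
      rw [uIoc_of_le hτ] at hr
      rw [norm_mul, Real.norm_of_nonneg (Real.exp_pos _).le]
      refine mul_le_of_le_one_right (norm_nonneg _) ?_
      rw [Real.exp_le_one_iff]
      have : 0 ≤ (n : ℝ) * r := mul_nonneg n.cast_nonneg hr.1.le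
      linarith
    · refine Eventually.of_forall fun r hr => ?_
      rw [uIoc_of_le hτ] at hr
      have h2 : Tendsto (fun n : ℕ => Real.exp (-((n : ℝ) * r))) atTop (𝓝 0) :=
        Real.tendsto_exp_neg_atTop_nhds_zero.comp
          (tendsto_natCast_atTop_atTop.atTop_mul_const hr.1)
      simpa using h2.const_mul (k r)
  rw [intervalIntegral.integral_zero] at h1
  obtain ⟨n, hn⟩ := (h1.eventually_lt_const hε).exists
  exact ⟨n, hn⟩

/-- Multiplication by `exp (γ t)`. -/
noncomputable def expWeight {τ : ℝ} (γ : ℝ) (U : C(Icc (0 : ℝ) τ, X)) : C(Icc (0 : ℝ) τ, X) where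
  toFun t := Real.exp (γ * t) • U t
  continuous_toFun := by fun_prop

variable [CompleteSpace X]

/-- The Picard map contracts in the norm sup e^(-γt)‖V(t)‖ for large γ, on the whole interval at
once. The weight is put into the map by conjugation, so the metric remains the uniform one. -/
theorem existsUnique_volterra {τ : ℝ} (hτ : 0 ≤ τ) (hK : IntervalIntegrable K volume 0 τ)
    {F : Icc (0 : ℝ) τ → X → E} (hF : Continuous (Function.uncurry F)) {L : ℝ≥0}
    (hL : ∀ s, LipschitzWith L (F s)) (y : C(Icc (0 : ℝ) τ, X)) :
    ∃! V : C(Icc (0 : ℝ) τ, X), ∀ t : Icc (0 : ℝ) τ,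
      V t = y t + ∫ s in (0 : ℝ)..t, K (t - s) (IccExtend hτ (fun s => F s (V s)) s) := by
  have hcont : ∀ V : C(Icc (0 : ℝ) τ, X), Continuous (IccExtend hτ fun s => F s (V s)) := fun V =>
    (hF.comp (continuous_id.prodMk V.continuous)).Icc_extend'
  have hbdd : ∀ V : C(Icc (0 : ℝ) τ, X), ∃ C, ∀ s, ‖IccExtend hτ (fun s => F s (V s)) s‖ ≤ C := by
    intro V
    obtain ⟨C, hC⟩ := isCompact_univ.exists_bound_of_continuousOn
      (hF.comp (continuous_id.prodMk V.continuous)).continuousOn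
    exact ⟨C, fun s => hC (projIcc 0 τ hτ s) (mem_univ _)⟩
  have hKt : ∀ t : Icc (0 : ℝ) τ, IntervalIntegrable K volume 0 t := fun t =>
    hK.mono_set (by rw [uIcc_of_le t.2.1, uIcc_of_le hτ]; exact Icc_subset_Icc_right t.2.2)
  set N : C(Icc (0 : ℝ) τ, X) → C(Icc (0 : ℝ) τ, X) := fun V =>
    { toFun := fun t => y t + ∫ s in (0 : ℝ)..t, K (t - s) (IccExtend hτ (fun s => F s (V s)) s)
      continuous_toFun := y.continuous.add (by
        obtain ⟨C, hC⟩ := hbdd V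
        exact (continuousOn_convolution hτ hK (hcont V) hC).domRestrict) } with hN
  have hL0 : (0 : ℝ) < L + 1 := by positivity
  -- The choice gives Lκ ≤ 1/2; L + 1 replaces L because L may vanish.
  obtain ⟨γ, hγ⟩ := exists_weight hτ hK.norm (ε := 1 / 2 / (L + 1)) (by positivity)
  set κ := ∫ r in (0 : ℝ)..τ, ‖K r‖ * Real.exp (-(γ * r)) with hκ
  have hexpc : Continuous fun r : ℝ => Real.exp (-(γ * r)) := by fun_prop
  have hkint : IntervalIntegrable (fun r => ‖K r‖ * Real.exp (-(γ * r))) volume 0 τ :=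
    hK.norm.mul_continuousOn hexpc.continuousOn
  have hκ0 : 0 ≤ κ := intervalIntegral.integral_nonneg hτ fun r _ => by positivity
  have hLκ : L * κ ≤ 1 / 2 := by
    rw [lt_div_iff₀ hL0] at hγ
    nlinarith
  set Ψ : C(Icc (0 : ℝ) τ, X) → C(Icc (0 : ℝ) τ, X) := fun U =>
    expWeight (-γ) (N (expWeight γ U)) with hΨ
  have hcontr : ContractingWith (1 / 2) Ψ := by
    refine ⟨by
      rw [← NNReal.coe_lt_coe]; norm_num, LipschitzWith.of_dist_le_mul fun U U' => ?_⟩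
    rw [ContinuousMap.dist_le (by positivity)]
    intro t
    set δ := dist U U' with hδ
    have h1 : Ψ U t - Ψ U' t = Real.exp (-γ * t) • ∫ s in (0 : ℝ)..t,
        (K (t - s) (IccExtend hτ (fun s => F s (expWeight γ U s)) s) -
          K (t - s) (IccExtend hτ (fun s => F s (expWeight γ U' s)) s)) := by
      rw [intervalIntegral.integral_sub
        (intervalIntegrable_convolution (hKt t) (hcont (expWeight γ U)))
        (intervalIntegrable_convolution (hKt t) (hcont (expWeight γ U')))]
      change Real.exp (-γ * t) • (y t + _) - Real.exp (-γ * t) • (y t + _) = _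
      rw [← smul_sub, add_sub_add_left_eq_sub]
    have h2 : ∀ s ∈ Ioc (0 : ℝ) t, ‖K (t - s) (IccExtend hτ (fun s => F s (expWeight γ U s)) s) -
          K (t - s) (IccExtend hτ (fun s => F s (expWeight γ U' s)) s)‖ ≤
        L * δ * (‖K (t - s)‖ * Real.exp (γ * s)) := by
      intro s hs
      have hs' : s ∈ Icc 0 τ := ⟨hs.1.le, hs.2.trans t.2.2⟩
      rw [← map_sub, IccExtend_of_mem _ _ hs', IccExtend_of_mem _ _ hs']
      have h3 : ‖F ⟨s, hs'⟩ (expWeight γ U ⟨s, hs'⟩) - F ⟨s, hs'⟩ (expWeight γ U' ⟨s, hs'⟩)‖ ≤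
          L * (Real.exp (γ * s) * δ) := by
        rw [← dist_eq_norm]
        refine ((hL ⟨s, hs'⟩).dist_le_mul _ _).trans ?_
        gcongr
        change dist (Real.exp (γ * s) • U ⟨s, hs'⟩) (Real.exp (γ * s) • U' ⟨s, hs'⟩) ≤ _
        rw [dist_smul₀, Real.norm_of_nonneg (Real.exp_pos _).le]
        gcongr
        exact ContinuousMap.dist_apply_le_dist _
      calc _ ≤ ‖K (t - s)‖ * (L * (Real.exp (γ * s) * δ)) :=
            ((K (t - s)).le_opNorm _).trans (mul_le_mul_of_nonneg_left h3 (norm_nonneg _))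
        _ = _ := by ring
    have hexpg : Continuous fun r : ℝ => Real.exp (γ * r) := by fun_prop
    have h4 : ‖∫ s in (0 : ℝ)..t, (K (t - s) (IccExtend hτ (fun s => F s (expWeight γ U s)) s) -
          K (t - s) (IccExtend hτ (fun s => F s (expWeight γ U' s)) s))‖ ≤
        ∫ s in (0 : ℝ)..t, L * δ * (‖K (t - s)‖ * Real.exp (γ * s)) :=
      intervalIntegral.norm_integral_le_of_norm_le t.2.1 (Eventually.of_forall h2)
        (((intervalIntegrable_kernel_sub (hKt t)).norm.mul_continuousOn
          hexpg.continuousOn).const_mul _)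
    -- Since e^(γs) = e^(γt) e^(-γ(t-s)), the weight moves onto the kernel, and e^(γt) cancels the
    -- outer factor.
    have h5 : ∫ s in (0 : ℝ)..t, ‖K (t - s)‖ * Real.exp (γ * s) =
        Real.exp (γ * t) * ∫ r in (0 : ℝ)..t, ‖K r‖ * Real.exp (-(γ * r)) := by
      rw [← intervalIntegral.integral_const_mul]
      have := intervalIntegral.integral_comp_sub_left
        (fun r => Real.exp (γ * t) * (‖K r‖ * Real.exp (-(γ * r)))) (t : ℝ) (a := 0) (b := t)
      rw [sub_self, sub_zero] at this
      rw [← this]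
      refine intervalIntegral.integral_congr fun s _ => ?_
      rw [mul_left_comm, ← Real.exp_add]
      congr 2
      ring
    have h6 : ∫ r in (0 : ℝ)..t, ‖K r‖ * Real.exp (-(γ * r)) ≤ κ :=
      intervalIntegral.integral_mono_interval le_rfl t.2.1 t.2.2
        (Eventually.of_forall fun r => by positivity) hkint
    rw [intervalIntegral.integral_const_mul, h5] at h4
    rw [dist_eq_norm, h1, norm_smul, Real.norm_of_nonneg (Real.exp_pos _).le]
    have hee : Real.exp (-γ * t) * Real.exp (γ * t) = 1 := by
      rw [← Real.exp_add]; simp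
    have hδ0 : 0 ≤ δ := dist_nonneg
    calc _ ≤ Real.exp (-γ * t) * (L * δ * (Real.exp (γ * t) *
          ∫ r in (0 : ℝ)..t, ‖K r‖ * Real.exp (-(γ * r)))) := by gcongr
      _ = (Real.exp (-γ * t) * Real.exp (γ * t)) * (L * δ *
          ∫ r in (0 : ℝ)..t, ‖K r‖ * Real.exp (-(γ * r))) := by ring
      _ ≤ 1 * (L * δ * κ) := by rw [hee]; gcongr
      _ = (L * κ) * δ := by ring
      _ ≤ 1 / 2 * δ := by gcongr
      _ = _ := by norm_num
  have hww : ∀ (γ : ℝ) (V : C(Icc (0 : ℝ) τ, X)), expWeight γ (expWeight (-γ) V) = V := by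
    intro γ V
    ext t
    change Real.exp (γ * t) • Real.exp (-γ * t) • V t = V t
    rw [smul_smul, ← Real.exp_add]
    simp
  have hiff : ∀ V : C(Icc (0 : ℝ) τ, X), (∀ t : Icc (0 : ℝ) τ,
      V t = y t + ∫ s in (0 : ℝ)..t, K (t - s) (IccExtend hτ (fun s => F s (V s)) s)) ↔
      Function.IsFixedPt Ψ (expWeight (-γ) V) := by
    intro V
    have h1 : (∀ t : Icc (0 : ℝ) τ,
      V t = y t + ∫ s in (0 : ℝ)..t, K (t - s) (IccExtend hτ (fun s => F s (V s)) s)) ↔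
      N V = V := by
      rw [eq_comm, ContinuousMap.ext_iff]
      rfl
    rw [h1, Function.IsFixedPt, hΨ]
    simp only
    rw [hww]
    refine ⟨fun h => by rw [h], fun h => ?_⟩
    have := congrArg (expWeight γ) h
    rwa [hww, hww] at this
  refine ⟨expWeight γ hcontr.fixedPoint, ?_, fun V hV => ?_⟩
  · refine (hiff _).mpr ?_
    have := hww (-γ) hcontr.fixedPoint
    rw [neg_neg] at this
    rw [this]
    exact hcontr.fixedPoint_isFixedPt
  · rw [← hcontr.fixedPoint_unique ((hiff V).mp hV), hww]

end Volterra

/-! ### The linear inhomogeneous problem. -/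

section Linear

variable {X E : Type*} [NormedAddCommGroup X] [NormedSpace ℂ X] [NormedAddCommGroup E]
  [NormedSpace ℂ E] [CompleteSpace X]

namespace IsExtrapolatedSemigroup

variable {A : E →ₗ.[ℂ] E} {ι : X →L[ℂ] E} {l : ℂ} {R : E →L[ℂ] X} {Rf : ℂ → X →L[ℂ] X} {a : ℝ}
  {T D : ℝ → X →L[ℂ] X}

theorem resolvent_convolution (h : IsExtrapolatedSemigroup A ι l R Rf a T D) {f : ℝ → E}
    (hf : Continuous f) {t : ℝ} (ht : 0 ≤ t) :
    Rf l (∫ s in (0 : ℝ)..t, extrapolatedKernel l R T D (t - s) (f s)) =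
      ∫ s in (0 : ℝ)..t, T (max (t - s) 0) (R (f s)) := by
  rw [← ContinuousLinearMap.intervalIntegral_comp_comm _
      (intervalIntegrable_convolution (h.integrable t ht) hf),
    intervalIntegral.integral_of_le ht, intervalIntegral.integral_of_le ht,
    integral_Ioc_eq_integral_Ioo, integral_Ioc_eq_integral_Ioo]
  refine setIntegral_congr_fun measurableSet_Ioo fun s hs => ?_
  have hts : 0 < t - s := sub_pos.mpr hs.2
  rw [h.resolvent_extrapolatedKernel hts, max_eq_left hts.le]

variable [CompleteSpace E]

/-- Integrated solutions of the linear inhomogeneous problem are mild solutions and conversely. -/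
theorem integrated_iff_mild (h : IsExtrapolatedSemigroup A ι l R Rf a T D) {f : ℝ → E}
    (hf : Continuous f) {V : ℝ → X} (hV : Continuous V) (x : X) (τ : ℝ) :
    (∀ t ∈ Icc 0 τ, (∫ s in (0 : ℝ)..t, ι (V s),
        ι (V t) - ι x - ∫ s in (0 : ℝ)..t, f s) ∈ A.graph) ↔
      ∀ t ∈ Icc 0 τ, V t = T t x +
        ∫ s in (0 : ℝ)..t, extrapolatedKernel l R T D (t - s) (f s) := by
  have hVi : ∀ t, IntervalIntegrable V volume 0 t := fun t => hV.intervalIntegrable _ _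
  have hfi : ∀ t, IntervalIntegrable f volume 0 t := fun t => hf.intervalIntegrable _ _
  have hRf : Continuous fun s => R (f s) := R.continuous.comp hf
  have hJV : Continuous fun s => (l • Rf l - 1) (V s) := (l • Rf l - 1).continuous.comp hV
  have hcm : ∀ t, 0 ≤ t → ∀ z, Rf l (T t z) = T t (Rf l z) := fun t ht z =>
    (congrArg (fun S => S z) (h.semigroup.commute t ht l h.lt_re).eq).symm
  have hJint : ∀ t, ∫ s in (0 : ℝ)..t, (l • Rf l - 1) (V s) =
      l • Rf l (∫ s in (0 : ℝ)..t, V s) - ∫ s in (0 : ℝ)..t, V s := fun t =>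
    ContinuousLinearMap.intervalIntegral_comp_comm _ (hVi t)
  -- Membership in the graph of A is one equation for the resolvent; solved for R(l)V(t), it has
  -- only bounded operators in it.
  have hred : ∀ t, (∫ s in (0 : ℝ)..t, ι (V s),
        ι (V t) - ι x - ∫ s in (0 : ℝ)..t, f s) ∈ A.graph ↔
      Rf l (V t) = Rf l x + (∫ s in (0 : ℝ)..t, (l • Rf l - 1) (V s)) +
        ∫ s in (0 : ℝ)..t, R (f s) := by
    intro t
    rw [h.mem_graph_iff, ContinuousLinearMap.intervalIntegral_comp_comm _ (hVi t),
      h.injective.eq_iff, hJint, ContinuousLinearMap.intervalIntegral_comp_comm _ (hfi t)]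
    simp only [map_sub, map_smul, h.part]
    constructor
    · intro h1
      nth_rw 2 [← h1]
      abel
    · intro h1
      rw [h1]
      abel
  rw [forall₂_congr fun t _ => hred t]
  constructor
  · intro hsol t ht
    apply h.injective_part
    rw [map_add, h.resolvent_convolution hf ht.1, hcm t ht.1]
    exact h.semigroup.duhamel_of_integral_eq h.lt_re hV hRf hsol ht
  · intro hmild
    set Z : ℝ → X := fun t => ∫ s in (0 : ℝ)..t, T (max (t - s) 0) (R (f s)) with hZ
    have hZc : Continuous Z := h.semigroup.continuous_duhamel hRf
    have hRV : ∀ t ∈ Icc 0 τ, Rf l (V t) = T (max t 0) (Rf l x) + Z t := by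
      intro t ht
      rw [hmild t ht, map_add, h.resolvent_convolution hf ht.1, hcm t ht.1, max_eq_left ht.1]
    intro t ht
    -- A second resolvent is applied because the equations for the orbit and for the Duhamel
    -- integral are available only under R(l).
    apply h.injective_part
    have hTx : Continuous fun s : ℝ => (l • Rf l - 1) (T (max s 0) (Rf l x)) :=
      (l • Rf l - 1).continuous.comp (h.semigroup.continuous_comp continuous_id continuous_const)
    have hJZ : Continuous fun s => (l • Rf l - 1) (Z s) := (l • Rf l - 1).continuous.comp hZc
    have e1 : Rf l (∫ s in (0 : ℝ)..t, (l • Rf l - 1) (V s)) =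
        (∫ s in (0 : ℝ)..t, (l • Rf l - 1) (T (max s 0) (Rf l x))) +
          ∫ s in (0 : ℝ)..t, (l • Rf l - 1) (Z s) := by
      rw [← ContinuousLinearMap.intervalIntegral_comp_comm _ (hJV.intervalIntegrable _ _),
        ← intervalIntegral.integral_add (hTx.intervalIntegrable _ _)
          (hJZ.intervalIntegrable _ _)]
      refine intervalIntegral.integral_congr fun s hs => ?_
      rw [uIcc_of_le ht.1] at hs
      rw [← map_add, ← hRV s ⟨hs.1, hs.2.trans ht.2⟩]
      change Rf l (l • Rf l (V s) - V s) = l • Rf l (Rf l (V s)) - Rf l (V s)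
      rw [map_sub, map_smul]
    have e2 := h.semigroup.resolvent_duhamel h.lt_re hRf ht.1
    have e3 := h.semigroup.resolvent_apply h.lt_re ht.1 (Rf l x)
    rw [map_add, map_add, e1, hRV t ht, map_add, max_eq_left ht.1, e3,
      ← ContinuousLinearMap.intervalIntegral_comp_comm _ (hRf.intervalIntegrable _ _)]
    rw [hZ]
    simp only
    rw [e2]
    abel

end IsExtrapolatedSemigroup

end Linear

/-! ### Semilinear problems with an operator whose domain is not dense -/

section Semilinear

variable {E : Type*} [NormedAddCommGroup E] [NormedSpace ℂ E]

theorem exists_isExtrapolatedSemigroup [CompleteSpace E] {A : E →ₗ.[ℂ] E}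
    (hsect : IsSectorialOp (partInClosure A)) {ωA : ℝ}
    (hres : ∀ r : ℝ, ωA < r → (r : ℂ) ∈ opResolventSet A) {p : ℝ} (hp : 1 ≤ p)
    (hgrowth : ∃ C : ℝ, ∀ᶠ r : ℝ in atTop, r ^ (1 / p) * ‖opResolvent A (r : ℂ)‖ ≤ C) :
    ∃ (l : ℂ) (a : ℝ) (T D : ℝ → domainClosure A →L[ℂ] domainClosure A),
      l ∈ opResolventSet (partInClosure A) ∧
      IsExtrapolatedSemigroup A (domainClosure A).subtypeL l (resolventToClosure A l)
        (opResolvent (partInClosure A)) a T D := by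
  obtain ⟨w, T, D, hw, h⟩ := exists_analyticSemigroup_partInClosure hsect hres hp hgrowth
  obtain ⟨C, hC⟩ := hgrowth
  obtain ⟨r₁, hr₁⟩ := eventually_atTop.mp hC
  set r : ℝ := max w ωA + 1 with hr
  have hwr : w < ((r : ℝ) : ℂ).re := by
    rw [Complex.ofReal_re]
    exact (le_max_left w ωA).trans_lt (lt_add_one _)
  have hAr : ωA < r := (le_max_right w ωA).trans_lt (lt_add_one _)
  have hR : ∀ x : domainClosure A, resolventToClosure A (r : ℂ) ((domainClosure A).subtypeL x) =
      opResolvent (partInClosure A) (r : ℂ) x := resolventToClosure_coe (hres r hAr) (hw _ hwr)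
  have hp0 : 0 < 1 / p := by positivity
  refine ⟨(r : ℂ), w, T, D, hw _ hwr, h, hwr, Subtype.val_injective,
    isResolventAt_opResolvent (hres r hAr), hR, fun τ hτ => ?_⟩
  refine h.intervalIntegrable_extrapolatedKernel (ι := (domainClosure A).subtypeL)
    (RE := fun s : ℝ => resolventToClosure A (s : ℂ)) (C := C) hwr hR hp0
    -- Beyond this threshold the growth bound holds and s lies in the resolvent set; the 1 keeps it
    -- positive.
    (r₀ := max (max r₁ 1) (ωA + 1)) (by positivity) (fun s hs => ⟨fun x => ?_, ?_⟩) τ hτ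
  · exact resolventToClosure_sub (hres r hAr)
      (hres s ((lt_add_one _).trans_le ((le_max_right _ _).trans hs))) x
  · have hs1 : max r₁ 1 ≤ s := (le_max_left _ _).trans hs
    have hs0 : 0 ≤ s := zero_le_one.trans ((le_max_right _ _).trans hs1)
    exact (mul_le_mul_of_nonneg_left (norm_resolventToClosure_le A _)
      (Real.rpow_nonneg hs0 _)).trans (hr₁ s ((le_max_left _ _).trans hs1))

variable {A : E →ₗ.[ℂ] E} {l : ℂ} {a : ℝ} {T D : ℝ → domainClosure A →L[ℂ] domainClosure A}
  {F : ℝ → domainClosure A → E} {x : domainClosure A} {τ : ℝ} {V : ℝ → domainClosure A}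
  {f : ℝ → E}

/-- The nonlinear term is replaced by a function continuous on all of ℝ that agrees with it only on
[0, τ], which is all that the integrals see. -/
theorem isIntegratedSolution_iff (hV : Continuous V) (hf : Continuous f)
    (hfF : ∀ s ∈ Icc 0 τ, F s (V s) = f s) :
    IsIntegratedSolution A F x τ V ↔ ∀ t ∈ Icc 0 τ,
      (∫ s in (0 : ℝ)..t, (domainClosure A).subtypeL (V s), (domainClosure A).subtypeL (V t) -
        (domainClosure A).subtypeL x - ∫ s in (0 : ℝ)..t, f s) ∈ A.graph := by
  rw [IsIntegratedSolution, and_iff_right hV.continuousOn]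
  refine forall₂_congr fun t ht => ?_
  have hEq : EqOn (fun s => F s (V s)) f (uIcc 0 t) := fun s hs => by
    rw [uIcc_of_le ht.1] at hs
    exact hfF s ⟨hs.1, hs.2.trans ht.2⟩
  have hint : IntervalIntegrable (fun s => F s (V s)) volume 0 t :=
    (hf.intervalIntegrable 0 t).congr (fun s hs => (hEq (uIoc_subset_uIcc hs)).symm)
  rw [and_iff_right hint, intervalIntegral.integral_congr hEq, LinearPMap.mem_graph_iff]
  simp only [Submodule.subtypeL_apply]
  constructor
  · rintro ⟨h, h1⟩
    exact ⟨⟨_, h⟩, rfl, by rw [h1]; abel⟩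
  · rintro ⟨v, h1, h2⟩
    have hv : (∫ s in (0 : ℝ)..t, (V s : E)) ∈ A.domain := h1 ▸ v.2
    have e : v = ⟨_, hv⟩ := Subtype.ext h1
    subst e
    exact ⟨hv, by rw [h2]; abel⟩

variable [CompleteSpace E]

theorem isMildSolution_iff
    (h : IsExtrapolatedSemigroup A (domainClosure A).subtypeL l (resolventToClosure A l)
      (opResolvent (partInClosure A)) a T D) (hl : l ∈ opResolventSet (partInClosure A))
    (hV : Continuous V) (hf : Continuous f) (hfF : ∀ s ∈ Icc 0 τ, F s (V s) = f s) :
    IsMildSolution A F x τ V ↔ ∀ t ∈ Icc 0 τ, V t = T t x +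
      ∫ s in (0 : ℝ)..t, extrapolatedKernel l (resolventToClosure A l) T D (t - s) (f s) := by
  rw [IsMildSolution, and_iff_right hV.continuousOn]
  refine forall₂_congr fun t ht => ?_
  have hi := intervalIntegrable_convolution (h.integrable t ht.1) hf
  have hEq : ∀ᵐ s ∂volume, s ∈ uIoc 0 t →
      deriv (generatedIntegratedSemigroup A) (t - s) (F s (V s)) = (domainClosure A).subtypeL
        (extrapolatedKernel l (resolventToClosure A l) T D (t - s) (f s)) := by
    -- The formula for the derivative holds at positive times; s = t, where it would be taken at 0,
    -- is a null set.
    filter_upwards [Measure.ae_ne volume t] with s hst hs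
    rw [uIoc_of_le ht.1] at hs
    rw [h.deriv_generatedIntegratedSemigroup (sub_pos.mpr (lt_of_le_of_ne hs.2 hst)),
      hfF s ⟨hs.1.le, hs.2.trans ht.2⟩]
    rfl
  have hi' : IntervalIntegrable (fun s => (domainClosure A).subtypeL
      (extrapolatedKernel l (resolventToClosure A l) T D (t - s) (f s))) volume 0 t := by
    rw [intervalIntegrable_iff] at hi ⊢
    exact (domainClosure A).subtypeL.integrable_comp hi
  have hint : IntervalIntegrable (fun s => deriv (generatedIntegratedSemigroup A) (t - s)
      (F s (V s))) volume 0 t :=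
    hi'.congr_ae ((ae_restrict_iff' measurableSet_uIoc).mpr
      (hEq.mono fun s hs hst => (hs hst).symm))
  rw [and_iff_right hint, intervalIntegral.integral_congr_ae hEq,
    h.semigroup.generatedSemigroup_eq h.lt_re (isResolventAt_opResolvent hl) ht.1,
    ContinuousLinearMap.intervalIntegral_comp_comm _ hi]
  exact (Subtype.ext_iff (a1 := V t) (a2 := T t x +
    ∫ s in (0 : ℝ)..t, extrapolatedKernel l (resolventToClosure A l) T D (t - s) (f s))).symm

theorem isIntegratedSolution_iff_isMildSolution
    (h : IsExtrapolatedSemigroup A (domainClosure A).subtypeL l (resolventToClosure A l)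
      (opResolvent (partInClosure A)) a T D) (hl : l ∈ opResolventSet (partInClosure A))
    (hV : Continuous V) (hf : Continuous f) (hfF : ∀ s ∈ Icc 0 τ, F s (V s) = f s) :
    IsIntegratedSolution A F x τ V ↔ IsMildSolution A F x τ V := by
  rw [isIntegratedSolution_iff hV hf hfF, isMildSolution_iff h hl hV hf hfF]
  exact h.integrated_iff_mild hf hV x τ

theorem existsUnique_isMildSolution
    (h : IsExtrapolatedSemigroup A (domainClosure A).subtypeL l (resolventToClosure A l)
      (opResolvent (partInClosure A)) a T D) (hl : l ∈ opResolventSet (partInClosure A))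
    (hτ : 0 ≤ τ) (hF : Continuous fun q : Icc (0 : ℝ) τ × domainClosure A => F q.1 q.2)
    {L : ℝ≥0} (hL : ∀ s ∈ Icc 0 τ, LipschitzWith L (F s)) (x : domainClosure A) :
    ∃! V : C(Icc (0 : ℝ) τ, domainClosure A), IsMildSolution A F x τ (IccExtend hτ V) := by
  have hy : Continuous fun t : Icc (0 : ℝ) τ => T t x :=
    (h.semigroup.cont x).comp_continuous continuous_subtype_val fun t => t.2.1
  have key := existsUnique_volterra hτ (h.integrable τ hτ)
    (F := fun (s : Icc (0 : ℝ) τ) v => F s v) hF (fun s => hL s s.2) ⟨_, hy⟩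
  refine (existsUnique_congr fun V => ?_).mpr key
  have hf : Continuous (IccExtend hτ fun s : Icc (0 : ℝ) τ => F s (V s)) :=
    (hF.comp (continuous_id.prodMk V.continuous)).Icc_extend'
  rw [isMildSolution_iff h hl V.continuous.Icc_extend' hf fun s hs => by
    rw [IccExtend_of_mem hτ _ hs, IccExtend_of_mem hτ _ hs]]
  rw [Subtype.forall]
  refine forall₂_congr fun t ht => ?_
  rw [IccExtend_of_mem hτ _ ht]
  rfl

end Semilinear

/-! ### The random equation, path by path. -/

theorem theorem3p4
    {H : Type*} [NormedAddCommGroup H] [InnerProductSpace ℂ H] [CompleteSpace H]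
    [TopologicalSpace.SeparableSpace H] [MeasurableSpace H] [BorelSpace H]
    {Ω : Type*} [MeasurableSpace Ω] (P : Measure Ω) [IsProbabilityMeasure P]
    -- the operator `A`
    (A : H →ₗ.[ℂ] H) (hsect : IsSectorialOp (partInClosure A))
    (ωA : ℝ) (hωA : ωA < 0) (hres : ∀ r : ℝ, ωA < r → (r : ℂ) ∈ opResolventSet A)
    (p : ℝ) (hp : 1 ≤ p)
    (hgrowth : ∃ C : ℝ, ∀ᶠ r : ℝ in atTop, r ^ (1 / p) * ‖opResolvent A (r : ℂ)‖ ≤ C)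
    -- the nonlinearity
    (G : domainClosure A → H) (hG : ∃ L : ℝ≥0, LipschitzWith L G)
    -- the noise
    (θ : ℝ → Ω → Ω) (hθ : IsErgodicMDS P θ)
    (Q : H →L[ℝ] H) (W : ℝ → Ω → H) (hW : IsTwoSidedQWiener P Q W)
    (hshift : ∀ s t ω, W t (θ s ω) = W (t + s) ω - W s ω)
    (Y : Ω → domainClosure A) (hY : IsStationaryConvolution P θ Q W A Y) :
    -- for all `ω` with a continuous path of `Y`, hence for almost all `ω`
    ∀ ω, ContinuousOn (fun t => Y (θ t ω)) (Ici 0) →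
      ∀ (ξ : domainClosure A) (τ : ℝ) (hτ : 0 < τ),
        (∃! V : C(Icc (0 : ℝ) τ, domainClosure A),
          IsIntegratedSolution A (fun t v => G (v + Y (θ t ω))) (ξ - Y ω) τ
            (IccExtend hτ.le V)) ∧
        ∀ V : C(Icc (0 : ℝ) τ, domainClosure A),
          IsIntegratedSolution A (fun t v => G (v + Y (θ t ω))) (ξ - Y ω) τ
              (IccExtend hτ.le V) ↔
            IsMildSolution A (fun t v => G (v + Y (θ t ω))) (ξ - Y ω) τ (IccExtend hτ.le V) := by
  intro ω hcont ξ τ hτ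
  obtain ⟨l, a, T, D, hl, h⟩ := exists_isExtrapolatedSemigroup hsect hres hp hgrowth
  obtain ⟨L, hL⟩ := hG
  -- Solutions are elements of C([0, τ], H₀), continued by constants; both notions of solution
  -- depend only on values in [0, τ].
  have hYc : Continuous fun s : Icc (0 : ℝ) τ => Y (θ s ω) :=
    hcont.comp_continuous continuous_subtype_val fun s => s.2.1
  have hF : Continuous fun q : Icc (0 : ℝ) τ × domainClosure A => G (q.2 + Y (θ q.1 ω)) :=
    hL.continuous.comp (continuous_snd.add (hYc.comp continuous_fst))
  have hLip : ∀ s ∈ Icc 0 τ, LipschitzWith L fun v => G (v + Y (θ s ω)) := fun s _ => by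
    have h1 := hL.comp (isometry_add_right (Y (θ s ω))).lipschitz
    rwa [mul_one] at h1
  have hiff : ∀ V : C(Icc (0 : ℝ) τ, domainClosure A),
      IsIntegratedSolution A (fun t v => G (v + Y (θ t ω))) (ξ - Y ω) τ (IccExtend hτ.le V) ↔
        IsMildSolution A (fun t v => G (v + Y (θ t ω))) (ξ - Y ω) τ (IccExtend hτ.le V) :=
    fun V => isIntegratedSolution_iff_isMildSolution h hl V.continuous.Icc_extend'
      (hF.comp (continuous_id.prodMk V.continuous)).Icc_extend' fun s hs => by
        rw [IccExtend_of_mem hτ.le _ hs, IccExtend_of_mem hτ.le _ hs]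
        rfl
  exact ⟨(existsUnique_congr hiff).mpr (existsUnique_isMildSolution h hl hτ.le hF hLip _), hiff⟩
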